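/- Let $\mathcal{H}$ be a complex Hilbert space and let $\mathcal{F}_{\mathcal{H}}=\mathbb{C}\oplus\mathcal{H}\oplus(\mathcal{H}\wedge\mathcal{H})\oplus\cdots$ be the fermion Fock space over $\mathcal{H}$, with creators $a^\dagger_h$, annihilators $a_h$ ($h\in\mathcal{H}$), vacuum $\Omega$ and number operator $N=\sum_j a^\dagger_{b_j}a_{b_j}$ (for any orthonormal basis $(b_j)$ of $\mathcal{H}$). Let $\mathcal{D}$ be the set of the density operators $\Delta$ on $\mathcal{F}_{\mathcal{H}}$ with $\Delta N=N\Delta$ and $\mathrm{Tr}(\Delta N)<\infty$. For $\Delta\in\mathcal{D}$ let $\gamma_\Delta$ be its $1$-particle statistical operator, the bounded operator on $\mathcal{H}$ with $\langle h|\gamma_\Delta g\rangle=\mathrm{Tr}(\Delta a^\dagger_g a_h)$ for all $g,h\in\mathcal{H}$. Let $$\Gamma_{\gamma}=\sum_{\mathbf{s}}\Big(\prod_{i\in\mathbf{s}}p_i\prod_{j\notin\mathbf{s}}(1-p_j)\Big)\,|a^\dagger_{\mathbf{s}}\Omega\rangle\langle a^\dagger_{\mathbf{s}}\Omega|$$ be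 the density operator of the free state with $1$-particle statistical operator $\gamma$, where $(f_j)$ is an orthonormal basis of $\mathcal{H}$ with $\gamma f_j=p_jf_j$, the sum is over the finite sets $\mathbf{s}$ of indices, and $a^\dagger_{\mathbf{s}}$ is the product of the $a^\dagger_{f_j}$, $j\in\mathbf{s}$, in some order. The nonfreeness of $\Delta$ is $\mathfrak{C}(\Delta)=S(\Delta|\Gamma_{\gamma_\Delta})\in[0,\infty]$, where the relative entropy $S(X|Y)$ of density operators $X$ and $Y$ is $+\infty$ if $\ker Y\not\subset\ker X$, and otherwise is $\mathrm{Tr}(X(\log X-\log Y))$, defined as the sum $$\sum_{j,k}|\langle\phi_j|\psi_k\rangle|^2\,(x_j\log x_j-x_j\log y_k+y_k-x_j)$$ of nonnegative terms, with $(\phi_j)$, $(\psi_k)$ orthonormal bases of eigenvectors of $X$ and $Y$ with eigenvalues $x_j$, $y_k$ (terms with $\langle\phi_j|\psi_k\rangle=0$ count as $0$, and $0\log 0=0\cdot\log y_k=0$, also for $y_k=0$). Let $\mathcal{H}=\mathcal{H}_1\oplus\mathcal{H}_2$ with $\mathcal{H}_1$ a closed subspace and $\mathcal{H}_2=\mathcal{H}_1^\perp$.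 Identify $\mathcal{F}_{\mathcal{H}}$ with $\mathcal{F}_{\mathcal{H}_1}\otimes\mathcal{F}_{\mathcal{H}_2}$ by $$(x_1\wedge\cdots\wedge x_m)\otimes(y_1\wedge\cdots\wedge y_n)\ \longleftrightarrow\ x_1\wedge\cdots\wedge x_m\wedge y_1\wedge\cdots\wedge y_n \qquad (x_i\in\mathcal{H}_1,\ y_j\in\mathcal{H}_2).$$ Let $\Delta\in\mathcal{D}$, and let $\Delta_1=\mathrm{Tr}_{\mathcal{F}_{\mathcal{H}_2}}(\Delta)$ and $\Delta_2=\mathrm{Tr}_{\mathcal{F}_{\mathcal{H}_1}}(\Delta)$ be its restrictions (partial traces) over $\mathcal{H}_1$ and $\mathcal{H}_2$. If $\gamma_\Delta=\gamma_{\Delta_1}\oplus\gamma_{\Delta_2}$, then $$\mathfrak{C}(\Delta)\ \ge\ \mathfrak{C}(\Delta_1)+\mathfrak{C}(\Delta_2).$$ If moreover $\mathfrak{C}(\Delta)<\infty$, then equality holds if and only if $\Delta=\Delta_1\otimes\Delta_2$ under this identification. -/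

import Mathlib

open scoped ENNReal ComplexConjugate InnerProductSpace

noncomputable section

/-! ## The fermion Fock space

The fermion Fock space over `H` is the completion of the exterior algebra of `H` with respect to the
inner product for which `n`-particle and `m`-particle vectors are orthogonal when `n ≠ m`, and
`⟪x₁ ∧ ⋯ ∧ xₙ, y₁ ∧ ⋯ ∧ yₙ⟫ = det ⟪xᵢ, yⱼ⟫`. -/

namespace Fermion

universe u

/-- The continuous extension of a bounded linear map to the completion of its domain. -/
def extendCompletion {E G : Type*} [SeminormedAddCommGroup E] [NormedSpace ℂ E]
    [NormedAddCommGroup G] [NormedSpace ℂ G] [CompleteSpace G] (f : E →L[ℂ] G) :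
    UniformSpace.Completion E →L[ℂ] G :=
  f.extend UniformSpace.Completion.toComplL

theorem extendCompletion_coe {E G : Type*} [SeminormedAddCommGroup E] [NormedSpace ℂ E]
    [NormedAddCommGroup G] [NormedSpace ℂ G] [CompleteSpace G] (f : E →L[ℂ] G) (x : E) :
    extendCompletion f (x : UniformSpace.Completion E) = f x :=
  ContinuousLinearMap.extend_eq f UniformSpace.Completion.denseRange_coe
    (UniformSpace.Completion.isUniformInducing_coe _) x

section FockSpace

variable {H : Type u} [NormedAddCommGroup H] [InnerProductSpace ℂ H]

/-- Finite tuples of vectors; `⟨n, x⟩` stands for the symbol `x₀ ∧ ⋯ ∧ xₙ₋₁`. -/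
abbrev Tuples (H : Type u) : Type u := Σ n : ℕ, (Fin n → H)

/-- The inner product of two wedge products: a Gram determinant, or `0` if the particle numbers
differ. -/
def gramKernel (x y : Tuples H) : ℂ :=
  if h : x.1 = y.1 then Matrix.det (Matrix.of fun i j => ⟪x.2 i, y.2 (Fin.cast h j)⟫_ℂ) else 0

theorem gramKernel_mk (n : ℕ) (x y : Fin n → H) :
    gramKernel ⟨n, x⟩ ⟨n, y⟩ = Matrix.det (Matrix.of fun i j => ⟪x i, y j⟫_ℂ) := by
  simp [gramKernel]

theorem gramKernel_ne {x y : Tuples H} (h : x.1 ≠ y.1) : gramKernel x y = 0 := by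
  simp [gramKernel, h]

theorem conj_gramKernel (x y : Tuples H) : conj (gramKernel y x) = gramKernel x y := by
  obtain ⟨m, x⟩ := x
  obtain ⟨n, y⟩ := y
  by_cases h : m = n
  · subst h
    rw [gramKernel_mk, gramKernel_mk, RingHom.map_det, ← Matrix.det_transpose]
    congr 1
    ext i j
    simp
  · rw [gramKernel_ne (by simpa using Ne.symm h), gramKernel_ne (by simpa using h), map_zero]

/-- Formal linear combinations of wedge products. -/
abbrev FockPre (H : Type u) : Type u := Tuples H →₀ ℂ

/-- The semi-inner product of two formal linear combinations. -/
def preInner (f g : FockPre H) : ℂ :=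
  Finsupp.sum f fun x a => Finsupp.sum g fun y b => conj a * b * gramKernel x y

open scoped ComplexOrder in
theorem prod_gram_posSemidef {ι : Type*} [Finite ι] (n : ℕ) (x : ι → Fin n → H) :
    (Matrix.of fun a b : ι => ∏ i, ⟪x a i, x b i⟫_ℂ).PosSemidef := by
  have key : ∀ s : Finset (Fin n),
      (Matrix.of fun a b : ι => ∏ i ∈ s, ⟪x a i, x b i⟫_ℂ).PosSemidef := by
    intro s
    induction s using Finset.induction_on with
    | empty =>
      have h := Matrix.posSemidef_gram (𝕜 := ℂ) (n := ι) (fun _ => (1 : ℂ))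
      have e : (Matrix.of fun a b : ι => ∏ i ∈ (∅ : Finset (Fin n)), ⟪x a i, x b i⟫_ℂ) =
          Matrix.gram ℂ (fun _ : ι => (1 : ℂ)) := by
        ext a b
        simp [Matrix.gram]
      rw [e]
      exact h
    | insert i s hi ih =>
      have h := (Matrix.posSemidef_gram (𝕜 := ℂ) (fun a => x a i)).hadamard ih
      have e : (Matrix.of fun a b : ι => ∏ i ∈ insert i s, ⟪x a i, x b i⟫_ℂ) =
          (Matrix.gram ℂ (fun a => x a i)).hadamard
            (Matrix.of fun a b : ι => ∏ i ∈ s, ⟪x a i, x b i⟫_ℂ) := by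
        ext a b
        simp [Matrix.gram, Finset.prod_insert hi]
      rw [e]
      exact h
  exact key Finset.univ

theorem factorial_mul_det_gram {n : ℕ} (x y : Fin n → H) :
    (n.factorial : ℂ) * Matrix.det (Matrix.of fun i j => ⟪x i, y j⟫_ℂ) =
      ∑ σ : Equiv.Perm (Fin n), ∑ τ : Equiv.Perm (Fin n),
        ((σ.sign : ℤ) : ℂ) * ((τ.sign : ℤ) : ℂ) * ∏ i, ⟪x (σ i), y (τ i)⟫_ℂ := by
  have h : ∀ σ : Equiv.Perm (Fin n), ∑ τ : Equiv.Perm (Fin n),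
        ((σ.sign : ℤ) : ℂ) * ((τ.sign : ℤ) : ℂ) * ∏ i, ⟪x (σ i), y (τ i)⟫_ℂ =
        Matrix.det (Matrix.of fun i j => ⟪x i, y j⟫_ℂ) := by
    intro σ
    rw [← Matrix.det_transpose, Matrix.det_apply']
    refine Fintype.sum_equiv (Equiv.mulRight σ⁻¹) _ _ fun τ => ?_
    rw [← Equiv.prod_comp σ (fun i => (Matrix.of fun i j => ⟪x i, y j⟫_ℂ).transpose
      (Equiv.mulRight σ⁻¹ τ i) i)]
    simp [mul_comm]
  rw [Finset.sum_congr rfl fun σ _ => h σ]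
  simp [Fintype.card_perm]

open scoped ComplexOrder in
theorem sum_gram_nonneg {n : ℕ} (s : Finset (Fin n → H)) (c : (Fin n → H) → ℂ) :
    0 ≤ (∑ x ∈ s, ∑ y ∈ s, conj (c x) * c y *
      Matrix.det (Matrix.of fun i j => ⟪x i, y j⟫_ℂ)).re := by
  have hp := prod_gram_posSemidef n
    (fun (a : s × Equiv.Perm (Fin n)) i => (a.1 : Fin n → H) (a.2 i))
  have h0 := hp.dotProduct_mulVec_nonneg
    (fun a => c a.1 * ((a.2.sign : ℤ) : ℂ))
  have h1 : (n.factorial : ℂ) * (∑ x ∈ s, ∑ y ∈ s, conj (c x) * c y *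
      Matrix.det (Matrix.of fun i j => ⟪x i, y j⟫_ℂ)) =
      star (fun a : s × Equiv.Perm (Fin n) => c a.1 * ((a.2.sign : ℤ) : ℂ)) ⬝ᵥ
        (Matrix.of fun a b : s × Equiv.Perm (Fin n) =>
          ∏ i, ⟪(a.1 : Fin n → H) (a.2 i), (b.1 : Fin n → H) (b.2 i)⟫_ℂ).mulVec
        (fun a => c a.1 * ((a.2.sign : ℤ) : ℂ)) := by
    simp only [dotProduct, Matrix.mulVec, Fintype.sum_prod_type, Finset.mul_sum]
    rw [← Finset.sum_coe_sort s]
    refine Finset.sum_congr rfl fun x _ => ?_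
    rw [Finset.sum_comm' (t' := Finset.univ) (s' := fun _ => Finset.univ) (by simp)]
    rw [← Finset.sum_coe_sort s]
    refine Finset.sum_congr rfl fun y _ => ?_
    rw [mul_left_comm, factorial_mul_det_gram, Finset.mul_sum]
    refine Finset.sum_congr rfl fun σ _ => ?_
    rw [Finset.mul_sum]
    refine Finset.sum_congr rfl fun τ _ => ?_
    simp
    ring
  rw [← h1] at h0
  have h2 := (Complex.le_def.1 h0).1
  rw [← Complex.ofReal_natCast, Complex.re_ofReal_mul] at h2
  exact nonneg_of_mul_nonneg_right h2 (by positivity)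

theorem preInner_nonneg (f : FockPre H) : 0 ≤ (preInner f f).re := by
  classical
  have h : preInner f f = ∑ n ∈ Finsupp.splitSupport f,
      ∑ x ∈ (Finsupp.split f n).support, ∑ y ∈ (Finsupp.split f n).support,
        conj (Finsupp.split f n x) * Finsupp.split f n y *
          Matrix.det (Matrix.of fun i j => ⟪x i, y j⟫_ℂ) := by
    unfold preInner
    rw [Finsupp.sigma_sum]
    refine Finset.sum_congr rfl fun n hn => ?_
    rw [Finsupp.sum]
    refine Finset.sum_congr rfl fun x _ => ?_
    rw [Finsupp.sigma_sum, Finset.sum_eq_single n]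
    · rw [Finsupp.sum]
      refine Finset.sum_congr rfl fun y _ => ?_
      rw [gramKernel_mk]
    · intro m _ hm
      rw [Finsupp.sum]
      refine Finset.sum_eq_zero fun y _ => ?_
      rw [gramKernel_ne (by simpa using hm.symm), mul_zero]
    · exact fun h => absurd hn h
  rw [h, Complex.re_sum]
  exact Finset.sum_nonneg fun n _ => sum_gram_nonneg _ _

/-- The semi-inner product on formal linear combinations of wedge products. -/
instance preCore : PreInnerProductSpace.Core ℂ (FockPre H) where
  inner := preInner
  conj_inner_symm f g := by
    unfold preInner
    rw [Finsupp.sum_comm]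
    simp only [map_finsuppSum, map_mul, conj_gramKernel, Complex.conj_conj]
    refine Finsupp.sum_congr fun x _ => Finsupp.sum_congr fun y _ => ?_
    ring
  re_inner_nonneg := preInner_nonneg
  add_left f g k := by
    unfold preInner
    rw [Finsupp.sum_add_index'] <;> simp [add_mul, ← Finsupp.sum_add]
  smul_left f g r := by
    unfold preInner
    rw [Finsupp.sum_smul_index] <;> simp [Finsupp.mul_sum, mul_assoc]

instance : SeminormedAddCommGroup (FockPre H) :=
  InnerProductSpace.Core.toSeminormedAddCommGroup (𝕜 := ℂ)

instance : InnerProductSpace ℂ (FockPre H) := InnerProductSpace.ofCore preCore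

/-- The fermion Fock space over `H`. -/
abbrev Fock (H : Type u) [NormedAddCommGroup H] [InnerProductSpace ℂ H] : Type u :=
  UniformSpace.Completion (FockPre H)

/-- The generator `x₀ ∧ ⋯ ∧ xₙ₋₁` as a formal symbol. -/
def preWedge (x : Tuples H) : FockPre H := Finsupp.single x 1

/-- The vector `x₀ ∧ ⋯ ∧ xₙ₋₁` of Fock space. -/
def wedge {n : ℕ} (x : Fin n → H) : Fock H := (preWedge ⟨n, x⟩ : FockPre H)

theorem inner_def (f g : FockPre H) : ⟪f, g⟫_ℂ = preInner f g := rfl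

theorem inner_preWedge (x y : Tuples H) : ⟪preWedge x, preWedge y⟫_ℂ = gramKernel x y := by
  rw [inner_def]
  simp [preInner, preWedge]

theorem inner_wedge {n : ℕ} (x y : Fin n → H) :
    ⟪wedge x, wedge y⟫_ℂ = Matrix.det (Matrix.of fun i j => ⟪x i, y j⟫_ℂ) := by
  rw [wedge, wedge, UniformSpace.Completion.inner_coe, inner_preWedge, gramKernel_mk]

/-! ### Creators and annihilators -/

/-- `h ∧ f`, on formal linear combinations. -/
def prependPre (h : H) : FockPre H →ₗ[ℂ] FockPre H :=
  Finsupp.lmapDomain ℂ ℂ fun x : Tuples H => (⟨x.1 + 1, Fin.cons h x.2⟩ : Tuples H)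

/-- The contraction `x₀ ∧ ⋯ ∧ xₙ ↦ ∑ᵢ (-1)ⁱ ⟪h, xᵢ⟫ x₀ ∧ ⋯ x̂ᵢ ⋯ ∧ xₙ` of a formal wedge product. -/
def contractTuple (h : H) : Tuples H → FockPre H
  | ⟨0, _⟩ => 0
  | ⟨n + 1, x⟩ =>
    ∑ i : Fin (n + 1), ((-1) ^ (i : ℕ) * ⟪h, x i⟫_ℂ) • preWedge ⟨n, fun j => x (i.succAbove j)⟩

/-- The contraction with `h`, on formal linear combinations. -/
def contractPre (h : H) : FockPre H →ₗ[ℂ] FockPre H :=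
  Finsupp.linearCombination ℂ (contractTuple h)

set_option linter.unusedSectionVars false in
theorem prependPre_preWedge (h : H) (x : Tuples H) :
    prependPre h (preWedge x) = preWedge ⟨x.1 + 1, Fin.cons h x.2⟩ := by
  simp [prependPre, preWedge]

theorem contractPre_preWedge (h : H) (x : Tuples H) :
    contractPre h (preWedge x) = contractTuple h x := by
  simp [contractPre, preWedge]

set_option linter.unusedSectionVars false in
theorem fockPre_induction {p : FockPre H → Prop} (h0 : p 0) (hadd : ∀ f g, p f → p g → p (f + g))
    (hsmul : ∀ (c : ℂ) (x : Tuples H), p (c • preWedge x)) (f : FockPre H) : p f := by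
  induction f using Finsupp.induction_linear with
  | zero => exact h0
  | add f g hf hg => exact hadd f g hf hg
  | single x c =>
    have h := hsmul c x
    rwa [preWedge, Finsupp.smul_single, smul_eq_mul, mul_one] at h

/-- Two successive Laplace expansions of a Gram determinant. -/
theorem gramKernel_cons (h k : H) (x y : Tuples H) :
    gramKernel ⟨x.1 + 1, Fin.cons h x.2⟩ ⟨y.1 + 1, Fin.cons k y.2⟩ =
      ⟪h, k⟫_ℂ * gramKernel x y - ⟪contractTuple k x, contractTuple h y⟫_ℂ := by
  obtain ⟨m, x⟩ := x
  obtain ⟨n, y⟩ := y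
  by_cases hmn : m = n
  · subst hmn
    rw [gramKernel_mk, gramKernel_mk, Matrix.det_succ_row_zero, Fin.sum_univ_succ]
    cases m with
    | zero => simp [contractTuple]
    | succ m =>
      rw [sub_eq_add_neg]
      congr 1
      · simp only [Fin.val_zero, pow_zero, one_mul, Matrix.of_apply, Fin.cons_zero]
        congr 2
      · simp only [contractTuple, sum_inner, inner_sum, inner_smul_left, inner_smul_right,
          inner_preWedge, gramKernel_mk]
        rw [← Finset.sum_neg_distrib]
        refine Finset.sum_congr rfl fun j _ => ?_
        rw [Matrix.det_succ_column_zero, Finset.mul_sum, Finset.mul_sum, ← Finset.sum_neg_distrib]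
        refine Finset.sum_congr rfl fun i _ => ?_
        have e : ((((Matrix.of fun i j => ⟪(Fin.cons h x : Fin (m + 1 + 1) → H) i,
              (Fin.cons k y : Fin (m + 1 + 1) → H) j⟫_ℂ).submatrix Fin.succ
              j.succ.succAbove).submatrix i.succAbove Fin.succ)) =
            Matrix.of fun a b => ⟪x (i.succAbove a), y (j.succAbove b)⟫_ℂ := by
          ext a b
          simp
        rw [e]
        simp only [Matrix.submatrix_apply, Matrix.of_apply, Fin.cons_zero, Fin.cons_succ,
          Fin.succ_succAbove_zero, Fin.val_succ, map_mul, map_pow, map_neg, map_one,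
          inner_conj_symm]
        ring
  · rw [gramKernel_ne (by simpa using hmn), gramKernel_ne (by simpa using hmn), mul_zero, zero_sub,
      eq_comm, neg_eq_zero]
    cases m with
    | zero => simp [contractTuple]
    | succ m =>
      cases n with
      | zero => simp [contractTuple]
      | succ n =>
        simp only [contractTuple, sum_inner, inner_sum, inner_smul_left, inner_smul_right,
          inner_preWedge]
        refine Finset.sum_eq_zero fun i _ => mul_eq_zero_of_right _ ?_
        refine Finset.sum_eq_zero fun j _ => mul_eq_zero_of_right _ ?_
        exact gramKernel_ne (by simpa using hmn)

theorem inner_prependPre (h k : H) (f g : FockPre H) :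
    ⟪prependPre h f, prependPre k g⟫_ℂ =
      ⟪h, k⟫_ℂ * ⟪f, g⟫_ℂ - ⟪contractPre k f, contractPre h g⟫_ℂ := by
  induction f using fockPre_induction with
  | h0 => simp
  | hadd f f' hf hf' => simp only [map_add, inner_add_left, hf, hf']; ring
  | hsmul c x =>
    induction g using fockPre_induction with
    | h0 => simp
    | hadd g g' hg hg' => simp only [map_add, inner_add_right, hg, hg']; ring
    | hsmul d y =>
      simp only [map_smul, inner_smul_left, inner_smul_right, prependPre_preWedge,
        contractPre_preWedge, inner_preWedge, gramKernel_cons]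
      ring

theorem norm_prependPre_le (h : H) (f : FockPre H) : ‖prependPre h f‖ ≤ ‖h‖ * ‖f‖ := by
  have e := inner_prependPre h h f f
  rw [inner_self_eq_norm_sq_to_K, inner_self_eq_norm_sq_to_K, inner_self_eq_norm_sq_to_K,
    inner_self_eq_norm_sq_to_K] at e
  norm_cast at e
  refine le_of_sq_le_sq ?_ (by positivity)
  nlinarith [sq_nonneg ‖contractPre h f‖]

/-- The creator `a†_h`: the bounded operator on Fock space with
`a†_h (x₀ ∧ ⋯ ∧ xₙ₋₁) = h ∧ x₀ ∧ ⋯ ∧ xₙ₋₁`. -/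
def creator (h : H) : Fock H →L[ℂ] Fock H :=
  extendCompletion (UniformSpace.Completion.toComplL ∘L
    (prependPre h).mkContinuous ‖h‖ (norm_prependPre_le h))

/-- The annihilator `a_h`, the adjoint of the creator. -/
def annihilator (h : H) : Fock H →L[ℂ] Fock H := (creator h).adjoint

theorem creator_coe (h : H) (f : FockPre H) :
    creator h (f : Fock H) = ((prependPre h f : FockPre H) : Fock H) :=
  extendCompletion_coe _ f

theorem creator_wedge (h : H) {n : ℕ} (x : Fin n → H) :
    creator h (wedge x) = wedge (Fin.cons h x : Fin (n + 1) → H) := by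
  rw [wedge, creator_coe, prependPre_preWedge]
  rfl

end FockSpace

/-! ### Fock space over an orthogonal sum -/

section Sum

variable {H : Type u} [NormedAddCommGroup H] [InnerProductSpace ℂ H] (K : Submodule ℂ H)

/-- The concatenation of a tuple in `K` and a tuple in the orthogonal complement of `K`. -/
def appendTuple (x : Tuples K) (y : Tuples Kᗮ) : Tuples H :=
  ⟨x.1 + y.1, Fin.append (fun i => (x.2 i : H)) (fun j => (y.2 j : H))⟩

/-- A square matrix with a zero block of large size is singular. -/
theorem det_eq_zero_of_zero_block {N : ℕ} (M : Matrix (Fin N) (Fin N) ℂ) (s t : Finset (Fin N))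
    (hst : N < s.card + t.card) (h : ∀ i ∈ s, ∀ j ∈ t, M i j = 0) : M.det = 0 := by
  rw [Matrix.det_apply]
  refine Finset.sum_eq_zero fun σ _ => ?_
  have : ∃ j ∈ t, σ j ∈ s := by
    by_contra! hc
    have hd : Disjoint s (t.map σ.toEmbedding) := by
      rw [Finset.disjoint_left]
      intro a ha hb
      obtain ⟨j, hj, rfl⟩ := Finset.mem_map.1 hb
      exact hc j hj ha
    have hcard := Finset.card_le_univ (s ∪ t.map σ.toEmbedding)
    rw [Finset.card_union_of_disjoint hd, Finset.card_map, Fintype.card_fin] at hcard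
    omega
  obtain ⟨j, hj, hs⟩ := this
  have h0 : ∏ i, M (σ i) i = 0 := Finset.prod_eq_zero (Finset.mem_univ j) (h _ hs j hj)
  rw [h0, smul_zero]

theorem gramKernel_append (x x' : Tuples K) (y y' : Tuples Kᗮ) :
    gramKernel (appendTuple K x y) (appendTuple K x' y') = gramKernel x x' * gramKernel y y' := by
  obtain ⟨m, x⟩ := x
  obtain ⟨m', x'⟩ := x'
  obtain ⟨n, y⟩ := y
  obtain ⟨n', y'⟩ := y'
  have h12 : ∀ (a : K) (b : Kᗮ), ⟪(a : H), (b : H)⟫_ℂ = 0 := fun a b => b.2 a a.2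
  have h21 : ∀ (a : K) (b : Kᗮ), ⟪(b : H), (a : H)⟫_ℂ = 0 := fun a b => by
    rw [← inner_conj_symm, h12, map_zero]
  by_cases hN : m + n = m' + n'
  · by_cases hm : m = m'
    · subst hm
      obtain rfl : n = n' := by omega
      rw [gramKernel_mk, gramKernel_mk]
      simp only [appendTuple]
      rw [gramKernel_mk, ← Matrix.det_submatrix_equiv_self finSumFinEquiv]
      rw [← Matrix.det_fromBlocks_zero₂₁ _ 0]
      congr 1
      ext i j
      rcases i with i | i <;> rcases j with j | j <;> simp [h12, h21]
    · rw [gramKernel_ne (x := ⟨m, x⟩) (by simpa using hm), zero_mul]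
      unfold gramKernel
      rw [dif_pos (by simpa [appendTuple] using hN)]
      rcases Nat.lt_or_gt_of_ne hm with hlt | hlt
      · refine det_eq_zero_of_zero_block _ (Finset.univ.map (Fin.natAddEmb m))
          (Finset.univ.map ((Fin.castAddEmb n').trans (finCongr hN.symm).toEmbedding)) ?_ ?_
        · simp [appendTuple]
          omega
        · intro i hi j hj
          obtain ⟨a, -, rfl⟩ := Finset.mem_map.1 hi
          obtain ⟨b, -, rfl⟩ := Finset.mem_map.1 hj
          change ⟪Fin.append (fun i => (x i : H)) (fun j => (y j : H)) (Fin.natAdd m a),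
            Fin.append (fun i => (x' i : H)) (fun j => (y' j : H))
              (Fin.cast hN (Fin.cast hN.symm (Fin.castAdd n' b)))⟫_ℂ = 0
          simp [h21]
      · refine det_eq_zero_of_zero_block _ (Finset.univ.map (Fin.castAddEmb n))
          (Finset.univ.map ((Fin.natAddEmb m').trans (finCongr hN.symm).toEmbedding)) ?_ ?_
        · simp [appendTuple]
          omega
        · intro i hi j hj
          obtain ⟨a, -, rfl⟩ := Finset.mem_map.1 hi
          obtain ⟨b, -, rfl⟩ := Finset.mem_map.1 hj
          change ⟪Fin.append (fun i => (x i : H)) (fun j => (y j : H)) (Fin.castAdd n a),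
            Fin.append (fun i => (x' i : H)) (fun j => (y' j : H))
              (Fin.cast hN (Fin.cast hN.symm (Fin.natAdd m' b)))⟫_ℂ = 0
          simp [h12]
  · rw [gramKernel_ne (by simpa [appendTuple] using hN)]
    by_cases hm : m = m'
    · rw [gramKernel_ne (x := ⟨n, y⟩) (by simp; omega), mul_zero]
    · rw [gramKernel_ne (x := ⟨m, x⟩) (by simpa using hm), zero_mul]

/-- The wedge product of vectors over `K` and over its orthogonal complement, on formal linear
combinations. -/
def mulPre : FockPre K →ₗ[ℂ] FockPre Kᗮ →ₗ[ℂ] FockPre H :=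
  Finsupp.linearCombination ℂ fun x : Tuples K => Finsupp.lmapDomain ℂ ℂ (appendTuple K x)

theorem mulPre_preWedge (x : Tuples K) (y : Tuples Kᗮ) :
    mulPre K (preWedge x) (preWedge y) = preWedge (appendTuple K x y) := by
  simp [mulPre, preWedge]

theorem inner_mulPre (f f' : FockPre K) (g g' : FockPre Kᗮ) :
    ⟪mulPre K f g, mulPre K f' g'⟫_ℂ = ⟪f, f'⟫_ℂ * ⟪g, g'⟫_ℂ := by
  induction f using fockPre_induction with
  | h0 => simp
  | hadd f₁ f₂ h₁ h₂ => simp only [map_add, LinearMap.add_apply, inner_add_left, h₁, h₂]; ring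
  | hsmul a x =>
    induction f' using fockPre_induction with
    | h0 => simp
    | hadd f₁ f₂ h₁ h₂ => simp only [map_add, LinearMap.add_apply, inner_add_right, h₁, h₂]; ring
    | hsmul b x' =>
      induction g using fockPre_induction with
      | h0 => simp
      | hadd f₁ f₂ h₁ h₂ => simp only [map_add, inner_add_left, h₁, h₂]; ring
      | hsmul c y =>
        induction g' using fockPre_induction with
        | h0 => simp
        | hadd f₁ f₂ h₁ h₂ => simp only [map_add, inner_add_right, h₁, h₂]; ring
        | hsmul d y' =>
          simp only [map_smul, LinearMap.smul_apply, inner_smul_left, inner_smul_right,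
            mulPre_preWedge, inner_preWedge, gramKernel_append]
          ring

theorem norm_mulPre (f : FockPre K) (g : FockPre Kᗮ) : ‖mulPre K f g‖ = ‖f‖ * ‖g‖ := by
  have e := inner_mulPre K f f g g
  rw [inner_self_eq_norm_sq_to_K, inner_self_eq_norm_sq_to_K, inner_self_eq_norm_sq_to_K] at e
  norm_cast at e
  rw [← mul_pow] at e
  exact (pow_left_inj₀ (norm_nonneg _) (by positivity) two_ne_zero).1 e

/-- The wedge product with a formal linear combination over `K`, as a bounded operator. -/
def mulExt (f : FockPre K) : Fock Kᗮ →L[ℂ] Fock H :=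
  extendCompletion (UniformSpace.Completion.toComplL ∘L
    (mulPre K f).mkContinuous ‖f‖ fun g => (norm_mulPre K f g).le)

theorem mulExt_coe (f : FockPre K) (g : FockPre Kᗮ) :
    mulExt K f (g : Fock Kᗮ) = ((mulPre K f g : FockPre H) : Fock H) :=
  extendCompletion_coe _ g

theorem norm_mulExt (f : FockPre K) (ψ : Fock Kᗮ) : ‖mulExt K f ψ‖ = ‖f‖ * ‖ψ‖ := by
  induction ψ using UniformSpace.Completion.induction_on with
  | hp => exact isClosed_eq (by fun_prop) (by fun_prop)
  | ih g =>
    rw [mulExt_coe, UniformSpace.Completion.norm_coe, UniformSpace.Completion.norm_coe, norm_mulPre]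

theorem mulExt_add (f f' : FockPre K) : mulExt K (f + f') = mulExt K f + mulExt K f' := by
  ext ψ
  induction ψ using UniformSpace.Completion.induction_on with
  | hp => exact isClosed_eq (by fun_prop) (by fun_prop)
  | ih g =>
    rw [add_apply, mulExt_coe, mulExt_coe, mulExt_coe, map_add,
      LinearMap.add_apply]
    exact UniformSpace.Completion.coe_add _ _

theorem mulExt_smul (c : ℂ) (f : FockPre K) : mulExt K (c • f) = c • mulExt K f := by
  ext ψ
  induction ψ using UniformSpace.Completion.induction_on with
  | hp => exact isClosed_eq (mulExt K (c • f)).continuous (c • mulExt K f).continuous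
  | ih g =>
    rw [smul_apply, mulExt_coe, mulExt_coe, LinearMap.map_smul,
      LinearMap.smul_apply]
    exact UniformSpace.Completion.coe_smul _ _

/-- `mulExt` as a bounded linear map. -/
def mulExtL : FockPre K →L[ℂ] Fock Kᗮ →L[ℂ] Fock H :=
  LinearMap.mkContinuous
    { toFun := mulExt K
      map_add' := mulExt_add K
      map_smul' := mulExt_smul K } 1
    fun f => ContinuousLinearMap.opNorm_le_bound _ (by positivity) fun ψ => by
      rw [one_mul]
      exact (norm_mulExt K f ψ).le

/-- The bounded bilinear map `(φ, ψ) ↦ φ ∧ ψ` on the Fock spaces over `K` and `Kᗮ`, with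
`(x₀ ∧ ⋯ ∧ xₘ₋₁) ∧ (y₀ ∧ ⋯ ∧ yₙ₋₁) = x₀ ∧ ⋯ ∧ xₘ₋₁ ∧ y₀ ∧ ⋯ ∧ yₙ₋₁`. This is the
canonical identification of `Fock K ⊗ Fock Kᗮ` with `Fock H`: `φ ∧ ψ` is the image of `φ ⊗ ψ`. -/
def fockMul : Fock K →L[ℂ] Fock Kᗮ →L[ℂ] Fock H :=
  extendCompletion (E := FockPre K) (G := Fock Kᗮ →L[ℂ] Fock H) (mulExtL K)

theorem fockMul_coe (f : FockPre K) (g : FockPre Kᗮ) :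
    fockMul K (f : Fock K) (g : Fock Kᗮ) = ((mulPre K f g : FockPre H) : Fock H) := by
  rw [fockMul, extendCompletion_coe]
  exact mulExt_coe K f g

theorem fockMul_wedge {m n : ℕ} (x : Fin m → K) (y : Fin n → Kᗮ) :
    fockMul K (wedge x) (wedge y) =
      wedge (Fin.append (fun i => (x i : H)) (fun j => (y j : H))) := by
  rw [wedge, wedge, fockMul_coe, mulPre_preWedge]
  rfl

theorem inner_fockMul (φ φ' : Fock K) (ψ ψ' : Fock Kᗮ) :
    ⟪fockMul K φ ψ, fockMul K φ' ψ'⟫_ℂ = ⟪φ, φ'⟫_ℂ * ⟪ψ, ψ'⟫_ℂ := by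
  induction φ using UniformSpace.Completion.induction_on with
  | hp => exact isClosed_eq (by fun_prop) (by fun_prop)
  | ih f =>
    induction φ' using UniformSpace.Completion.induction_on with
    | hp => exact isClosed_eq (by fun_prop) (by fun_prop)
    | ih f' =>
      induction ψ using UniformSpace.Completion.induction_on with
      | hp => exact isClosed_eq (by fun_prop) (by fun_prop)
      | ih g =>
        induction ψ' using UniformSpace.Completion.induction_on with
        | hp => exact isClosed_eq (by fun_prop) (by fun_prop)
        | ih g' =>
          rw [fockMul_coe, fockMul_coe, UniformSpace.Completion.inner_coe,
            UniformSpace.Completion.inner_coe, UniformSpace.Completion.inner_coe, inner_mulPre]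

end Sum
/-! ## Operators with an eigenbasis, traces, density operators, relative entropy -/

section Operators

variable {E : Type u} [NormedAddCommGroup E] [InnerProductSpace ℂ E]

/-- An orthonormal basis of `E` consisting of eigenvectors of `T`, with real eigenvalues. -/
structure Eigenbasis (T : E →L[ℂ] E) where
  /-- the index set -/
  index : Type u
  /-- the orthonormal basis -/
  basis : HilbertBasis index ℂ E
  /-- the eigenvalues, listed with multiplicity -/
  val : index → ℝ
  /-- the eigenvalue equation -/
  apply_basis : ∀ i, T (basis i) = (val i : ℂ) • basis i

/-- The relative entropy `S(D | G) = Tr (D (log D - log G))` of two density operators, with values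
in `[0, ∞]`. It is `∞` if the kernel of `G` is not contained in the kernel of `D`; otherwise it is
`∑ⱼₖ |⟪φⱼ, ψₖ⟫|² (dⱼ log dⱼ - dⱼ log gₖ + gₖ - dⱼ)` for eigenbases `φ` of `D` and `ψ` of `G`. All
terms are nonnegative, and the sum is the same for all choices of eigenbases. (With `log 0 = 0` the
expression is right at `dⱼ = 0`; if `gₖ = 0` then `ψₖ` is in the kernel of `D`, so that `dⱼ = 0` or
`⟪φⱼ, ψₖ⟫ = 0`.) -/
def relEntropy (D G : E →L[ℂ] E) : ℝ≥0∞ :=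
  open Classical in
  if ∀ v, G v = 0 → D v = 0 then
    ⨅ (φ : Eigenbasis D) (ψ : Eigenbasis G), ∑' (j : φ.index) (k : ψ.index),
      ENNReal.ofReal (‖⟪φ.basis j, ψ.basis k⟫_ℂ‖ ^ 2 *
        (φ.val j * Real.log (φ.val j) - φ.val j * Real.log (ψ.val k) + ψ.val k - φ.val j))
  else ⊤

variable [CompleteSpace E]

/-- The index set of some orthonormal basis of `E`. -/
def stdIndex (E : Type u) [NormedAddCommGroup E] [InnerProductSpace ℂ E] [CompleteSpace E] :
    Set E :=
  (exists_hilbertBasis ℂ E).choose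

/-- Some orthonormal basis of `E`. -/
def stdBasis (E : Type u) [NormedAddCommGroup E] [InnerProductSpace ℂ E] [CompleteSpace E] :
    HilbertBasis (stdIndex E) ℂ E :=
  (exists_hilbertBasis ℂ E).choose_spec.choose

/-- The trace of a trace class operator; it does not depend on the orthonormal basis. -/
def trace (T : E →L[ℂ] E) : ℂ := ∑' i, ⟪stdBasis E i, T (stdBasis E i)⟫_ℂ

/-- Density operators: positive operators of trace one. -/
structure IsDensity (ρ : E →L[ℂ] E) : Prop where
  pos : ρ.IsPositive
  trace_one : ∀ (ι : Type u) (b : HilbertBasis ι ℂ E), HasSum (fun i => ⟪b i, ρ (b i)⟫_ℂ) 1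

end Operators

/-! ## States of many fermions and their nonfreeness -/

section States

variable {H : Type u} [NormedAddCommGroup H] [InnerProductSpace ℂ H]

/-- `φ` is in the domain of the number operator `N = ∑ⱼ a†ⱼ aⱼ`, and `N φ = χ`; here
`aⱼ = a_{bⱼ}` for an orthonormal basis `b`, on which `N` does not depend. -/
def IsNumberImage {ι : Type u} (b : HilbertBasis ι ℂ H) (φ χ : Fock H) : Prop :=
  HasSum (fun j => creator (b j) (annihilator (b j) φ)) χ

/-- The class `𝒟` of the density operators `Δ` on Fock space with `Δ N = N Δ` and
`Tr (Δ N) < ∞`. The first condition is that `Δ` maps the domain of `N` into itself and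
`N Δ φ = Δ N φ` there; the second is that the series `∑ⱼ Tr (Δ a†ⱼ aⱼ)` of nonnegative terms
converges. -/
structure IsClassD (Δ : Fock H →L[ℂ] Fock H) : Prop where
  density : IsDensity Δ
  commutes : ∀ (ι : Type u) (b : HilbertBasis ι ℂ H) (φ χ : Fock H),
    IsNumberImage b φ χ → IsNumberImage b (Δ φ) (Δ χ)
  finite_number : ∀ (ι : Type u) (b : HilbertBasis ι ℂ H),
    Summable fun j => (trace (Δ ∘L creator (b j) ∘L annihilator (b j))).re

/-- The defining property `⟪h, γ g⟫ = Tr (Δ a†_g a_h)` of the `1`-particle statistical operator. -/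
def IsOneParticle (Δ : Fock H →L[ℂ] Fock H) (γ : H →L[ℂ] H) : Prop :=
  ∀ g h : H, ⟪h, γ g⟫_ℂ = trace (Δ ∘L creator g ∘L annihilator h)

/-- The `1`-particle statistical operator `γ_Δ`: the unique bounded operator with
`⟪h, γ_Δ g⟫ = Tr (Δ a†_g a_h)` for all `g` and `h`. (For a density operator `Δ` it exists.) -/
def oneParticle (Δ : Fock H →L[ℂ] Fock H) : H →L[ℂ] H :=
  open Classical in
  if h : ∃ γ : H →L[ℂ] H, IsOneParticle Δ γ then h.choose else 0

/-- The weight `p(s) = ∏_{i ∈ s} pᵢ ∏_{j ∉ s} (1 - pⱼ)`. -/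
def weight {ι : Type u} (p : ι → ℝ) (s : Finset ι) : ℝ :=
  open Classical in ∏' j, if j ∈ s then p j else 1 - p j

/-- The Slater determinant of the vectors `fⱼ`, `j ∈ s`, taken in some order. -/
def slater {ι : Type u} (f : ι → H) (s : Finset ι) : Fock H :=
  wedge fun i : Fin s.card => f (s.equivFin.symm i)

/-- The density operator `Γ_γ = ∑_s p(s) |Ψ_s⟩⟨Ψ_s|` of the free state with `1`-particle
statistical operator `γ`, where `Ψ_s` are the Slater determinants in an orthonormal basis of
eigenvectors of `γ` and the `pⱼ` are the eigenvalues. (Such a basis exists if `γ` is Hermitian of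
finite trace, and `Γ_γ` does not depend on it.) -/
def freeState (γ : H →L[ℂ] H) : Fock H →L[ℂ] Fock H :=
  open Classical in
  if h : Nonempty (Eigenbasis γ) then
    ∑' s : Finset h.some.index, (weight h.some.val s : ℂ) •
      InnerProductSpace.rankOne ℂ (slater h.some.basis s) (slater h.some.basis s)
  else 0

/-- The nonfreeness `𝔠(Δ) = S(Δ | Γ_{γ_Δ})`. -/
def nonfreeness (Δ : Fock H →L[ℂ] Fock H) : ℝ≥0∞ :=
  relEntropy Δ (freeState (oneParticle Δ))

end States

/-! ## Subsystems -/

section Subsystems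

variable {H : Type u} [NormedAddCommGroup H] [InnerProductSpace ℂ H] (K : Submodule ℂ H)

/-- The restriction of `Δ` over `K`: the partial trace of `Δ` over the second factor of
`Fock H ≅ Fock K ⊗ Fock Kᗮ`. With an orthonormal basis `e` of `Fock Kᗮ` and the isometries
`Rᵢ φ = φ ∧ eᵢ` it is `∑ᵢ Rᵢ† Δ Rᵢ`, that is, `⟪φ, Δ₁ φ'⟫ = ∑ᵢ ⟪φ ∧ eᵢ, Δ (φ' ∧ eᵢ)⟫`. -/
def restrictFst (Δ : Fock H →L[ℂ] Fock H) : Fock K →L[ℂ] Fock K :=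
  ∑' i, ((fockMul K).flip (stdBasis (Fock Kᗮ) i)).adjoint ∘L Δ ∘L
    (fockMul K).flip (stdBasis (Fock Kᗮ) i)

/-- The restriction of `Δ` over `Kᗮ`: the partial trace of `Δ` over the first factor of
`Fock H ≅ Fock K ⊗ Fock Kᗮ`. -/
def restrictSnd (Δ : Fock H →L[ℂ] Fock H) : Fock Kᗮ →L[ℂ] Fock Kᗮ :=
  ∑' i, (fockMul K (stdBasis (Fock K) i)).adjoint ∘L Δ ∘L fockMul K (stdBasis (Fock K) i)

/-- `Δ ≅ A ⊗ B` under the identification of `Fock H` with `Fock K ⊗ Fock Kᗮ`. -/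
def IsTensor (Δ : Fock H →L[ℂ] Fock H) (A : Fock K →L[ℂ] Fock K) (B : Fock Kᗮ →L[ℂ] Fock Kᗮ) :
    Prop :=
  ∀ (φ : Fock K) (ψ : Fock Kᗮ), Δ (fockMul K φ ψ) = fockMul K (A φ) (B ψ)

/-- The operator `A ⊕ B` on `H = K ⊕ Kᗮ`. -/
def directSum [K.HasOrthogonalProjection] (A : K →L[ℂ] K) (B : Kᗮ →L[ℂ] Kᗮ) : H →L[ℂ] H :=
  K.subtypeL ∘L A ∘L K.orthogonalProjectionOnto + Kᗮ.subtypeL ∘L B ∘L Kᗮ.orthogonalProjectionOnto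

end Subsystems

end Fermion

end

noncomputable section

set_option linter.unusedSectionVars false

namespace Fermion

universe u

/-! ### Orthonormal bases and quadratic forms with values in `[0, ∞]` -/

section HilbertSpace

variable {E : Type u} [NormedAddCommGroup E] [InnerProductSpace ℂ E]

/-! The hypothesis on `γ_Δ` makes the reference state a product. In an eigenbasis adapted to `K ⊕
Kᗮ` the Slater determinants are, up to sign, products of Slater determinants over `K` and `Kᗮ`, and
their weights multiply; hence `Γ_{γ₁ ⊕ γ₂} = Γ_{γ₁} ⊗ Γ_{γ₂}` (`freeState_directSum`). What remains
concerns a density operator `D` on a tensor product, with partial traces `D₁`, `D₂`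
(`relEntropy_tensor`). Formally, `S(D | G₁ ⊗ G₂) = S(D₁ | G₁) + S(D₂ | G₂) + S(D | D₁ ⊗ D₂)`, and
the last term is nonnegative and vanishes only for `D = D₁ ⊗ D₂`.

This chain rule comes from adding and cancelling entropies, which may be infinite. It is therefore
proved for operators of finite entropy and trace at most one (`entSum_tensor`) and applied to
finite-rank spectral truncations of `D`. In the limit, the two marginal terms are lower
semicontinuous (`eventually_lt_entSum`); truncation raises `S(D | G₁ ⊗ G₂)` by at most a tail of the
trace of `G₁ ⊗ G₂`; and the third term is bounded below by a quarter of the squared difference of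
the expectations of `D` and `D₁ ⊗ D₂` at a unit product vector (`sq_le_entSum`), which is
continuous. The outcome is superadditivity with an explicit remainder (`entSum_superadditive`).
Equality at a finite value kills the remainder at every product vector, and polarization gives `D =
D₁ ⊗ D₂`; the converse is additivity on products (`entSum_prod`).

Lower semicontinuity rests on a regularization. Adding `ε` to all eigenvalues does not raise any
summand (log-sum inequality), and the regularized sum is a convex trace function of `D`, bounded
below through finitely many diagonal entries by Peierls' inequality, minus a finite term that is
linear in `D`, up to constants. -/

theorem enorm_inner_comm (x y : E) : ‖⟪x, y⟫_ℂ‖ₑ = ‖⟪y, x⟫_ℂ‖ₑ := by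
  rw [← ofReal_norm, ← ofReal_norm, norm_inner_symm]

theorem enorm_sq_eq_ofReal {F : Type*} [SeminormedAddCommGroup F] (x : F) :
    ‖x‖ₑ ^ 2 = ENNReal.ofReal (‖x‖ ^ 2) := by
  rw [← ofReal_norm, ENNReal.ofReal_pow (norm_nonneg _)]

theorem hasSum_norm_inner_sq {ι : Type*} (b : HilbertBasis ι ℂ E) (x : E) :
    HasSum (fun i => ‖⟪b i, x⟫_ℂ‖ ^ 2) (‖x‖ ^ 2) := by
  have h := (Complex.hasSum_re (b.hasSum_inner_mul_inner x x))
  have e : (fun i => (⟪x, b i⟫_ℂ * ⟪b i, x⟫_ℂ).re) = fun i => ‖⟪b i, x⟫_ℂ‖ ^ 2 := by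
    ext i
    rw [← inner_conj_symm, ← Complex.normSq_eq_conj_mul_self, Complex.ofReal_re,
      Complex.normSq_eq_norm_sq]
  rw [e] at h
  convert h using 1
  rw [inner_self_eq_norm_sq_to_K]
  norm_cast

theorem tsum_enorm_inner_sq {ι : Type*} (b : HilbertBasis ι ℂ E) (x : E) :
    ∑' i, ‖⟪b i, x⟫_ℂ‖ₑ ^ 2 = ‖x‖ₑ ^ 2 := by
  have h := hasSum_norm_inner_sq b x
  simp only [enorm_sq_eq_ofReal]
  rw [← ENNReal.ofReal_tsum_of_nonneg (fun i => sq_nonneg _) h.summable, h.tsum_eq]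

theorem tsum_enorm_inner_sq' {ι : Type*} (b : HilbertBasis ι ℂ E) (x : E) :
    ∑' i, ‖⟪x, b i⟫_ℂ‖ₑ ^ 2 = ‖x‖ₑ ^ 2 := by
  simp_rw [enorm_inner_comm x]
  exact tsum_enorm_inner_sq b x

theorem enorm_basis {ι : Type*} (b : HilbertBasis ι ℂ E) (i : ι) : ‖b i‖ₑ = 1 := by
  rw [← ofReal_norm, b.orthonormal.1 i, ENNReal.ofReal_one]

theorem eq_of_forall_basis {ι : Type*} (b : HilbertBasis ι ℂ E) {G : Type*}
    [NormedAddCommGroup G] [NormedSpace ℂ G] {S T : E →L[ℂ] G} (h : ∀ i, S (b i) = T (b i)) :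
    S = T := by
  ext x
  have hS := (b.hasSum_repr x).mapL S
  have hT := (b.hasSum_repr x).mapL T
  simp only [map_smul, h] at hS hT
  exact hS.unique hT

theorem eq_of_forall_inner_basis {ι : Type*} (b : HilbertBasis ι ℂ E) {x y : E}
    (h : ∀ i, ⟪b i, x⟫_ℂ = ⟪b i, y⟫_ℂ) : x = y := by
  apply b.repr.injective
  ext i
  rw [b.repr_apply_apply, b.repr_apply_apply, h]

/-- The quadratic form of an operator, as an extended nonnegative real. -/
def qf (T : E →L[ℂ] E) (x : E) : ℝ≥0∞ := ENNReal.ofReal (⟪x, T x⟫_ℂ).re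

theorem inner_eq_re {T : E →L[ℂ] E} (hT : T.IsPositive) (x : E) :
    ⟪x, T x⟫_ℂ = ((⟪x, T x⟫_ℂ).re : ℂ) :=
  Complex.ext rfl (Complex.nonneg_iff.1 (hT.inner_nonneg_right x)).2.symm

theorem re_inner_nonneg {T : E →L[ℂ] E} (hT : T.IsPositive) (x : E) : 0 ≤ (⟪x, T x⟫_ℂ).re :=
  (Complex.nonneg_iff.1 (hT.inner_nonneg_right x)).1

theorem qf_ne_top (T : E →L[ℂ] E) (x : E) : qf T x ≠ ∞ := ENNReal.ofReal_ne_top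

/-! ### Trace, compactness and diagonalization of positive operators. -/

variable [CompleteSpace E]

/-- With `T = S²` the form `⟪x, T x⟫` becomes `‖S x‖²`, so that a finite trace of `T` says that `S`
is Hilbert-Schmidt. -/
theorem exists_sqrt {T : E →L[ℂ] E} (hT : T.IsPositive) :
    ∃ S : E →L[ℂ] E, S.IsPositive ∧ S ∘L S = T := by
  have h0 : 0 ≤ T := (ContinuousLinearMap.nonneg_iff_isPositive T).2 hT
  exact ⟨CFC.sqrt T, (ContinuousLinearMap.nonneg_iff_isPositive _).1 (CFC.sqrt_nonneg T),
    CFC.sqrt_mul_sqrt_self T h0⟩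

theorem qf_comp_self {S : E →L[ℂ] E} (hS : S.IsPositive) (x : E) :
    qf (S ∘L S) x = ‖S x‖ₑ ^ 2 := by
  rw [qf, ContinuousLinearMap.comp_apply, ← hS.inner_left_eq_inner_right,
    inner_self_eq_norm_sq_to_K, enorm_sq_eq_ofReal]
  norm_cast

/-- The trace of a positive operator, in `[0, ∞]`. -/
def posTrace (T : E →L[ℂ] E) : ℝ≥0∞ := ∑' i, qf T (stdBasis E i)

/-- Parseval turns both sides into the same double sum of `|⟪S bᵢ, cₖ⟫|²`. This is the basis
independence of the trace of `S²`. -/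
theorem tsum_enorm_sq_comm {S : E →L[ℂ] E} (hS : ∀ x y, ⟪S x, y⟫_ℂ = ⟪x, S y⟫_ℂ) {ι κ : Type*}
    (b : HilbertBasis ι ℂ E) (c : HilbertBasis κ ℂ E) :
    ∑' i, ‖S (b i)‖ₑ ^ 2 = ∑' k, ‖S (c k)‖ₑ ^ 2 := by
  simp_rw [← tsum_enorm_inner_sq c (S (b _)), ← tsum_enorm_inner_sq b (S (c _))]
  rw [ENNReal.tsum_comm]
  refine tsum_congr fun k => tsum_congr fun i => ?_
  rw [← hS, enorm_inner_comm]

theorem enorm_apply_sq_le {S : E →L[ℂ] E} (hS : ∀ x y, ⟪S x, y⟫_ℂ = ⟪x, S y⟫_ℂ) {ι : Type*}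
    (b : HilbertBasis ι ℂ E) (x : E) :
    ‖S x‖ₑ ^ 2 ≤ (∑' i, ‖S (b i)‖ₑ ^ 2) * ‖x‖ₑ ^ 2 := by
  rw [← tsum_enorm_inner_sq b (S x), ← ENNReal.tsum_mul_right]
  refine ENNReal.tsum_le_tsum fun i => ?_
  rw [← hS, ← mul_pow]
  gcongr
  rw [← ofReal_norm, ← ofReal_norm, ← ofReal_norm, ← ENNReal.ofReal_mul (norm_nonneg _)]
  exact ENNReal.ofReal_le_ofReal (norm_inner_le_norm _ _)

theorem tsum_qf {T : E →L[ℂ] E} (hT : T.IsPositive) {ι : Type*} (b : HilbertBasis ι ℂ E) :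
    ∑' i, qf T (b i) = posTrace T := by
  obtain ⟨S, hS, rfl⟩ := exists_sqrt hT
  simp only [posTrace, qf_comp_self hS]
  exact tsum_enorm_sq_comm hS.inner_left_eq_inner_right _ _

theorem qf_le_posTrace {T : E →L[ℂ] E} (hT : T.IsPositive) (x : E) :
    qf T x ≤ posTrace T * ‖x‖ₑ ^ 2 := by
  obtain ⟨S, hS, rfl⟩ := exists_sqrt hT
  simp only [posTrace, qf_comp_self hS]
  exact enorm_apply_sq_le hS.inner_left_eq_inner_right _ x

theorem norm_le_posTrace {T : E →L[ℂ] E} (hT : T.IsPositive) (ht : posTrace T ≠ ∞) :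
    ‖T‖ ≤ (posTrace T).toReal := by
  obtain ⟨S, hS, rfl⟩ := exists_sqrt hT
  set t := (posTrace (S ∘L S)).toReal with ht'
  have h1 : ∀ x, ‖S x‖ ≤ √t * ‖x‖ := fun x => by
    have h := qf_le_posTrace hT x
    rw [qf_comp_self hS, enorm_sq_eq_ofReal, enorm_sq_eq_ofReal, ← ENNReal.ofReal_toReal ht,
      ← ENNReal.ofReal_mul ENNReal.toReal_nonneg] at h
    have h2 := (ENNReal.ofReal_le_ofReal_iff (by positivity)).1 h
    rw [← Real.sqrt_sq (norm_nonneg (S x)), ← Real.sqrt_sq (norm_nonneg x),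
      ← Real.sqrt_mul ENNReal.toReal_nonneg]
    exact Real.sqrt_le_sqrt h2
  refine ContinuousLinearMap.opNorm_le_bound _ ENNReal.toReal_nonneg fun x => ?_
  calc ‖S (S x)‖ ≤ √t * (√t * ‖x‖) := (h1 _).trans (by gcongr; exact h1 x)
    _ = t * ‖x‖ := by rw [← mul_assoc, Real.mul_self_sqrt ENNReal.toReal_nonneg]

/-- A positive operator of finite trace is compact. -/
theorem isCompactOperator_of_posTrace {T : E →L[ℂ] E} (hT : T.IsPositive)
    (ht : posTrace T ≠ ∞) : IsCompactOperator T := by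
  obtain ⟨S, hS, rfl⟩ := exists_sqrt hT
  -- It suffices that the Hilbert-Schmidt operator `S` is compact. It is the norm limit of the
  -- finite-rank operators `P F`, namely `S` followed by the projection onto the span of the `bᵢ`,
  -- `i ∈ F`; the error is bounded by the tail of the Hilbert-Schmidt norm.
  refine IsCompactOperator.comp_clm ?_ S
  set b := stdBasis E
  have hsum : Summable fun i => ‖S (b i)‖ ^ 2 := by
    have : ∑' i, ‖S (b i)‖ₑ ^ 2 ≠ ∞ := by
      simpa only [posTrace, qf_comp_self hS] using ht
    simp only [enorm_sq_eq_ofReal] at this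
    have h := ENNReal.summable_toReal this
    simpa [ENNReal.toReal_ofReal] using h
  let P : Finset (stdIndex E) → E →L[ℂ] E := fun F =>
    ∑ i ∈ F, InnerProductSpace.rankOne ℂ (b i) (S (b i))
  have hP : ∀ F, IsCompactOperator (P F) := fun F => by
    have : P F ∈ compactOperator (RingHom.id ℂ) E E := by
      refine Submodule.sum_mem _ fun i _ => ?_
      change IsCompactOperator (InnerProductSpace.rankOne ℂ (b i) (S (b i)))
      have e : InnerProductSpace.rankOne ℂ (b i) (S (b i)) =
        (ContinuousLinearMap.toSpanSingleton ℂ (b i)) ∘L (innerSL ℂ (S (b i))) :=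
          InnerProductSpace.rankOne_def' _ _
      rw [e]
      have hid : IsCompactOperator (id : ℂ → ℂ) :=
        isCompactOperator_id_iff_finiteDimensional (𝕜 := ℂ).2 inferInstance
      exact (hid.clm_comp (ContinuousLinearMap.toSpanSingleton ℂ (b i))).comp_clm _
    exact this
  refine isCompactOperator_of_tendsto (F := P) (l := Filter.atTop) ?_
    (Filter.Eventually.of_forall hP)
  have hb : ∀ F, ‖P F - S‖ ≤ √(∑' i, ‖S (b i)‖ ^ 2 - ∑ i ∈ F, ‖S (b i)‖ ^ 2) := fun F => by
    have hs' := hsum.subtype (fun i => i ∉ F)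
    have e1 : ∑' i, ‖S (b i)‖ ^ 2 - ∑ i ∈ F, ‖S (b i)‖ ^ 2 =
        ∑' i : {i // i ∉ F}, ‖S (b i)‖ ^ 2 := by
      rw [← hsum.sum_add_tsum_subtype_compl F]
      ring
    rw [e1]
    refine ContinuousLinearMap.opNorm_le_bound _ (Real.sqrt_nonneg _) fun x => ?_
    refine le_of_sq_le_sq ?_ (by positivity)
    rw [mul_pow, Real.sq_sqrt (tsum_nonneg fun _ => by positivity), ← tsum_mul_right]
    classical
    have hx := hasSum_norm_inner_sq b ((P F - S) x)
    have hin : ∀ i, ‖⟪b i, (P F - S) x⟫_ℂ‖ ^ 2 = if i ∈ F then 0 else ‖⟪S (b i), x⟫_ℂ‖ ^ 2 := by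
      intro i
      have : ⟪b i, P F x⟫_ℂ = if i ∈ F then ⟪S (b i), x⟫_ℂ else 0 := by
        simp [P, orthonormal_iff_ite.1 b.orthonormal]
      rw [sub_apply, inner_sub_right, this, hS.inner_left_eq_inner_right]
      split_ifs <;> simp
    rw [← hx.tsum_eq]
    have h2 : ∑' i, ‖⟪b i, (P F - S) x⟫_ℂ‖ ^ 2 = ∑' i : {i // i ∉ F}, ‖⟪S (b i), x⟫_ℂ‖ ^ 2 := by
      rw [← hx.summable.sum_add_tsum_subtype_compl F, Finset.sum_eq_zero, zero_add]
      · exact tsum_congr fun i => by rw [hin, if_neg i.2]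
      · intro i hi
        rw [hin, if_pos hi]
    rw [h2]
    have hle : ∀ i : {i // i ∉ F}, ‖⟪S (b i), x⟫_ℂ‖ ^ 2 ≤ ‖S (b i)‖ ^ 2 * ‖x‖ ^ 2 := fun i => by
      rw [← mul_pow]
      gcongr
      exact norm_inner_le_norm _ _
    exact Summable.tsum_le_tsum hle (Summable.of_nonneg_of_le (fun _ => by positivity) hle
      (hs'.mul_right _)) (hs'.mul_right _)
  rw [tendsto_iff_norm_sub_tendsto_zero]
  refine squeeze_zero (fun _ => norm_nonneg _) hb ?_
  have : Filter.Tendsto (fun F => ∑' i, ‖S (b i)‖ ^ 2 - ∑ i ∈ F, ‖S (b i)‖ ^ 2) Filter.atTop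
      (nhds (∑' i, ‖S (b i)‖ ^ 2 - ∑' i, ‖S (b i)‖ ^ 2)) := hsum.hasSum.const_sub _
  rw [sub_self] at this
  simpa using this.sqrt

/-- A positive operator of finite trace has an eigenbasis. -/
theorem nonempty_eigenbasis {T : E →L[ℂ] E} (hT : T.IsPositive) (ht : posTrace T ≠ ∞) :
    Nonempty (Eigenbasis T) := by
  have hsym : (T : E →ₗ[ℂ] E).IsSymmetric := hT.isSymmetric
  have hbot := ContinuousLinearMap.orthogonalComplement_iSup_eigenspaces_eq_bot
    (isCompactOperator_of_posTrace hT ht) hT.isSymmetric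
  let V : ℂ → Submodule ℂ E := fun μ => Module.End.eigenspace (T : E →ₗ[ℂ] E) μ
  have hcomplete : ∀ μ, CompleteSpace (V μ) := fun μ => by
    have : IsClosed (V μ : Set E) := by
      have e : (V μ : Set E) = {x | T x = μ • x} := by
        ext x
        simp [V]
      rw [e]
      exact isClosed_eq T.continuous (continuous_const_smul μ)
    exact this.completeSpace_coe
  -- Every complex `μ` is admitted: trivial eigenspaces have an empty basis, and `μ = 0` supplies a
  -- basis of the kernel.
  let v : (Σ μ : ℂ, stdIndex (V μ)) → E := fun i => (stdBasis (V i.1) i.2 : V i.1)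
  have hv : Orthonormal ℂ v :=
    hsym.orthogonalFamily_eigenspaces.orthonormal_sigma_orthonormal
      (v_family := fun μ => stdBasis (V μ)) fun μ => (stdBasis (V μ)).orthonormal
  have hspan : (Submodule.span ℂ (Set.range v))ᗮ = ⊥ := by
    rw [eq_bot_iff, ← hbot]
    intro x hx
    rw [Submodule.mem_orthogonal'] at hx ⊢
    intro y hy
    induction hy using Submodule.iSup_induction' with
    | zero => simp
    | add y z _ _ h1 h2 => rw [inner_add_right, h1, h2, add_zero]
    | mem μ y hy =>
      have h0 : (innerSL ℂ x) ∘L (V μ).subtypeL = 0 := eq_of_forall_basis (stdBasis (V μ)) fun i =>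
        hx _ (Submodule.subset_span ⟨⟨μ, i⟩, rfl⟩)
      exact DFunLike.congr_fun h0 (⟨y, hy⟩ : V μ)
  have hcoe := HilbertBasis.coe_mkOfOrthogonalEqBot hv hspan
  refine ⟨⟨_, HilbertBasis.mkOfOrthogonalEqBot hv hspan, fun i => i.1.re, fun i => ?_⟩⟩
  rw [hcoe]
  have h1 : T (v i) = i.1 • v i := Module.End.mem_eigenspace_iff.1 (stdBasis (V i.1) i.2).2
  -- Positivity makes the eigenvalue real, so nothing is lost by recording its real part.
  have h2 : (i.1.re : ℂ) = i.1 := by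
    have h3 := inner_eq_re hT (v i)
    rw [h1, inner_smul_right, inner_self_eq_norm_sq_to_K, hv.1 i] at h3
    simpa using h3.symm
  rw [h1, h2]

/-! ### Eigenvalues and expansions in an eigenbasis. -/

theorem Eigenbasis.inner_apply {T : E →L[ℂ] E} (hT : T.IsPositive) (φ : Eigenbasis T)
    (i : φ.index) (x : E) : ⟪φ.basis i, T x⟫_ℂ = φ.val i * ⟪φ.basis i, x⟫_ℂ := by
  rw [← hT.inner_left_eq_inner_right, φ.apply_basis, inner_smul_left, Complex.conj_ofReal]

theorem Eigenbasis.val_eq {T : E →L[ℂ] E} (φ : Eigenbasis T)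
    (i : φ.index) : (φ.val i : ℂ) = ⟪φ.basis i, T (φ.basis i)⟫_ℂ := by
  rw [φ.apply_basis, inner_smul_right, inner_self_eq_norm_sq_to_K, φ.basis.orthonormal.1]
  simp

theorem Eigenbasis.val_nonneg {T : E →L[ℂ] E} (hT : T.IsPositive) (φ : Eigenbasis T)
    (i : φ.index) : 0 ≤ φ.val i := by
  have := re_inner_nonneg hT (φ.basis i)
  rwa [← φ.val_eq, Complex.ofReal_re] at this

theorem Eigenbasis.qf_basis {T : E →L[ℂ] E} (φ : Eigenbasis T) (i : φ.index) :
    qf T (φ.basis i) = ENNReal.ofReal (φ.val i) := by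
  rw [qf, ← φ.val_eq, Complex.ofReal_re]

theorem Eigenbasis.tsum_val {T : E →L[ℂ] E} (hT : T.IsPositive) (φ : Eigenbasis T) :
    ∑' i, ENNReal.ofReal (φ.val i) = posTrace T := by
  simp_rw [← φ.qf_basis]
  exact tsum_qf hT _

theorem Eigenbasis.val_le {T : E →L[ℂ] E} (hT : T.IsPositive) (φ : Eigenbasis T)
    (ht : posTrace T ≤ 1) (i : φ.index) : φ.val i ≤ 1 := by
  rw [← ENNReal.ofReal_le_one]
  exact ((ENNReal.le_tsum i).trans_eq (φ.tsum_val hT)).trans ht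

theorem Eigenbasis.qf_eq {T : E →L[ℂ] E} (hT : T.IsPositive) (φ : Eigenbasis T) (x : E) :
    qf T x = ∑' i, ENNReal.ofReal (φ.val i) * ‖⟪φ.basis i, x⟫_ℂ‖ₑ ^ 2 := by
  have h := Complex.hasSum_re (φ.basis.hasSum_inner_mul_inner x (T x))
  have e : (fun i => (⟪x, φ.basis i⟫_ℂ * ⟪φ.basis i, T x⟫_ℂ).re) =
      fun i => φ.val i * ‖⟪φ.basis i, x⟫_ℂ‖ ^ 2 := by
    ext i
    rw [φ.inner_apply hT, mul_left_comm, ← inner_conj_symm, ← Complex.normSq_eq_conj_mul_self,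
      Complex.normSq_eq_norm_sq, ← Complex.ofReal_mul, Complex.ofReal_re]
  rw [e] at h
  rw [qf, ← h.tsum_eq, ENNReal.ofReal_tsum_of_nonneg
    (fun i => mul_nonneg (φ.val_nonneg hT i) (sq_nonneg _)) h.summable]
  refine tsum_congr fun i => ?_
  rw [ENNReal.ofReal_mul (φ.val_nonneg hT i), enorm_sq_eq_ofReal]

theorem IsDensity.posTrace_eq {T : E →L[ℂ] E} (hT : IsDensity T) : posTrace T = 1 := by
  have h := Complex.hasSum_re (hT.trace_one _ (stdBasis E))
  rw [Complex.one_re] at h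
  rw [posTrace, ← ENNReal.ofReal_one, ← h.tsum_eq, ENNReal.ofReal_tsum_of_nonneg
    (fun i => re_inner_nonneg hT.pos _) h.summable]
  rfl

open scoped ComplexOrder in
theorem isPositive_of_inner {T : E →L[ℂ] E} (h : ∀ x, 0 ≤ ⟪x, T x⟫_ℂ) : T.IsPositive := by
  rw [ContinuousLinearMap.isPositive_iff_complex]
  intro x
  have h1 := Complex.nonneg_iff.1 (h x)
  have h2 : ⟪T x, x⟫_ℂ = ⟪x, T x⟫_ℂ := by
    rw [← inner_conj_symm, Complex.conj_eq_iff_im.2 h1.2.symm]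
  rw [h2]
  exact ⟨Complex.ext rfl h1.2, h1.1⟩

end HilbertSpace

/-! ### The scalar function `d log d - d log g + g - d` -/

/-- The summand of the relative entropy. -/
def relTerm (d g : ℝ) : ℝ := d * Real.log d - d * Real.log g + g - d

/-- This is `log t ≤ t - 1` at `t = x / d`; the lower bounds for `relTerm` are drawn from it. -/
theorem sub_le_mul_log_sub {d x : ℝ} (hd : 0 ≤ d) (hx : 0 < x) :
    d - x ≤ d * Real.log d - d * Real.log x := by
  rcases hd.eq_or_lt with rfl | hd
  · simpa using hx.le
  · have h := Real.log_le_sub_one_of_pos (div_pos hx hd)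
    rw [Real.log_div hx.ne' hd.ne'] at h
    have h2 := mul_le_mul_of_nonneg_left h hd.le
    have h3 : d * (x / d - 1) = x - d := by field_simp
    rw [h3] at h2
    linarith

theorem relTerm_nonneg {d g : ℝ} (hd : 0 ≤ d) (hg : 0 < g) : 0 ≤ relTerm d g := by
  have := sub_le_mul_log_sub hd hg
  unfold relTerm
  linarith

theorem relTerm_zero (g : ℝ) : relTerm 0 g = g := by simp [relTerm]

theorem relTerm_self (g : ℝ) : relTerm g g = 0 := by simp [relTerm]

theorem relTerm_add_le {u g ε : ℝ} (hu : 0 ≤ u) (hg : 0 < g) (hε : 0 < ε) :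
    relTerm (u + ε) (g + ε) ≤ relTerm u g := by
  -- Log-sum inequality: with `R = (u + ε) / (g + ε)`, the tangent bounds at `g R` and `ε R` are
  -- added, and the left sides cancel because `(g + ε) R = u + ε`.
  have hR : 0 < (u + ε) / (g + ε) := by positivity
  have h1 := sub_le_mul_log_sub hu (mul_pos hg hR)
  have h2 := sub_le_mul_log_sub hε.le (mul_pos hε hR)
  rw [Real.log_mul hg.ne' hR.ne'] at h1
  rw [Real.log_mul hε.ne' hR.ne'] at h2
  have h3 : (g + ε) * ((u + ε) / (g + ε)) = u + ε := by field_simp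
  have h4 : Real.log ((u + ε) / (g + ε)) = Real.log (u + ε) - Real.log (g + ε) :=
    Real.log_div (by positivity) (by positivity)
  unfold relTerm
  rw [h4] at h1 h2
  nlinarith

theorem tendsto_relTerm_add {u g : ℝ} (hg : 0 < g) :
    Filter.Tendsto (fun ε : ℝ => relTerm (u + ε) (g + ε)) (nhds 0) (nhds (relTerm u g)) := by
  have h1 : ContinuousAt (fun ε : ℝ => (u + ε) * Real.log (u + ε)) 0 :=
    (Real.continuous_mul_log.comp (continuous_const_add u)).continuousAt
  have h2 : ContinuousAt (fun ε : ℝ => Real.log (g + ε)) 0 :=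
    ContinuousAt.log (by fun_prop) (by simpa using hg.ne')
  have h3 : ContinuousAt (fun ε : ℝ => relTerm (u + ε) (g + ε)) 0 := by
    unfold relTerm
    fun_prop
  simpa [ContinuousAt] using h3

/-- For `d = a²` and `g = b²` the logarithms double, and the tangent bound for `a`, `b` gives `(a -
b)² ≤ relTerm d g`. The constant `1/4` is the price of `(a + b)² ≤ 4`. -/
theorem sq_sub_le_relTerm {d g : ℝ} (hd : 0 ≤ d) (hd1 : d ≤ 1) (hg : 0 < g) (hg1 : g ≤ 1) :
    (d - g) ^ 2 / 4 ≤ relTerm d g := by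
  obtain ⟨a, ha, rfl⟩ : ∃ a, 0 ≤ a ∧ a ^ 2 = d := ⟨√d, Real.sqrt_nonneg _, Real.sq_sqrt hd⟩
  obtain ⟨b, hb, rfl⟩ : ∃ b, 0 < b ∧ b ^ 2 = g := ⟨√g, Real.sqrt_pos.2 hg, Real.sq_sqrt hg.le⟩
  have ha1 : a ≤ 1 := by nlinarith
  have hb1 : b ≤ 1 := by nlinarith
  have h := mul_le_mul_of_nonneg_left (sub_le_mul_log_sub ha hb) ha
  have h2 : (a - b) ^ 2 ≤ relTerm (a ^ 2) (b ^ 2) := by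
    unfold relTerm
    rw [Real.log_pow, Real.log_pow]
    push_cast
    nlinarith
  have h3 : (a + b) ^ 2 ≤ 4 := by nlinarith
  have h4 := mul_le_mul_of_nonneg_left h3 (sq_nonneg (a - b))
  have h5 : (a ^ 2 - b ^ 2) ^ 2 = (a - b) ^ 2 * (a + b) ^ 2 := by ring
  linarith

/-- `log (1 + x / ε)` -/
def shiftLog (ε x : ℝ) : ℝ := Real.log (1 + x / ε)

/-- `(x + ε) log (1 + x / ε) - x` -/
def shiftEnt (ε x : ℝ) : ℝ := (x + ε) * shiftLog ε x - x

theorem shiftLog_nonneg {ε x : ℝ} (hε : 0 < ε) (hx : 0 ≤ x) : 0 ≤ shiftLog ε x :=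
  Real.log_nonneg (by have := div_nonneg hx hε.le; linarith)

theorem mul_shiftLog_le {ε x : ℝ} (hε : 0 < ε) (hx : 0 ≤ x) : ε * shiftLog ε x ≤ x := by
  have h := Real.log_le_sub_one_of_pos (show 0 < 1 + x / ε by positivity)
  have h2 := mul_le_mul_of_nonneg_left h hε.le
  have h3 : ε * (1 + x / ε - 1) = x := by field_simp; ring
  rwa [h3] at h2

theorem log_add_eq_shiftLog {ε x : ℝ} (hε : 0 < ε) (hx : 0 ≤ x) :
    Real.log (x + ε) = Real.log ε + shiftLog ε x := by
  rw [shiftLog, ← Real.log_mul hε.ne' (by positivity)]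
  congr 1
  field_simp
  ring

/-- Separates a function of `u` alone from terms linear in `u`. Since `log ε` cancels, every term is
nonnegative, so the identity can be summed in `[0, ∞]`. -/
theorem relTerm_add_eq {ε u g : ℝ} (hε : 0 < ε) (hu : 0 ≤ u) (hg : 0 ≤ g) :
    relTerm (u + ε) (g + ε) + u * shiftLog ε g + ε * shiftLog ε g = shiftEnt ε u + g := by
  unfold relTerm shiftEnt
  rw [log_add_eq_shiftLog hε hu, log_add_eq_shiftLog hε hg]
  ring

theorem shiftEnt_nonneg {ε u : ℝ} (hε : 0 < ε) (hu : 0 ≤ u) : 0 ≤ shiftEnt ε u := by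
  have h := relTerm_add_eq hε hu le_rfl
  have h2 := relTerm_nonneg (add_nonneg hu hε.le) (show 0 < 0 + ε by simpa using hε)
  simp only [shiftLog, zero_div, add_zero, Real.log_one, mul_zero] at h
  linarith

theorem continuousAt_shiftEnt {ε u : ℝ} (hε : 0 < ε) (hu : 0 ≤ u) :
    ContinuousAt (shiftEnt ε) u := by
  have h : ContinuousAt (shiftLog ε) u := by
    unfold shiftLog
    exact ContinuousAt.log (by fun_prop) (by positivity)
  unfold shiftEnt
  fun_prop

/-! ### Relative entropy as a double sum over eigenbases -/

section Entropy

variable {E : Type u} [NormedAddCommGroup E] [InnerProductSpace ℂ E]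

/-- The double sum defining the relative entropy, for two orthonormal bases with weights. -/
def entSum {ι κ : Type*} (φ : HilbertBasis ι ℂ E) (d : ι → ℝ) (ψ : HilbertBasis κ ℂ E)
    (g : κ → ℝ) : ℝ≥0∞ :=
  ∑' (j : ι) (k : κ), ‖⟪φ j, ψ k⟫_ℂ‖ₑ ^ 2 * ENNReal.ofReal (relTerm (d j) (g k))

/-- The kernel of the diagonal operator `(ψ, g)` is contained in the kernel of `(φ, d)`. -/
def KerCompat {ι κ : Type*} (φ : HilbertBasis ι ℂ E) (d : ι → ℝ) (ψ : HilbertBasis κ ℂ E)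
    (g : κ → ℝ) : Prop :=
  ∀ j k, g k = 0 → d j = 0 ∨ ⟪φ j, ψ k⟫_ℂ = 0

variable [CompleteSpace E]

theorem inner_eq_zero_of_val_ne {G : E →L[ℂ] E} (hG : G.IsPositive) (ψ ψ' : Eigenbasis G)
    {k : ψ.index} {l : ψ'.index} (h : ψ.val k ≠ ψ'.val l) :
    ⟪ψ.basis k, ψ'.basis l⟫_ℂ = 0 := by
  have h1 := ψ.inner_apply hG k (ψ'.basis l)
  rw [ψ'.apply_basis, inner_smul_right] at h1
  by_contra h0
  exact h (Complex.ofReal_injective (mul_right_cancel₀ h0 h1).symm)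

/-- The projection of `x` onto the eigenspace is orthogonal to the basis vectors with another
eigenvalue, and pairs like `x` with the others. The right side does not mention the eigenbasis,
whence the relative entropy does not depend on it. -/
theorem tsum_eigenspace {G : E →L[ℂ] E} (hG : G.IsPositive) (ψ : Eigenbasis G) (μ : ℝ) (x : E) :
    open Classical in
    ∑' k, (if ψ.val k = μ then ‖⟪x, ψ.basis k⟫_ℂ‖ₑ ^ 2 else 0) =
      ‖((G - (μ : ℂ) • ContinuousLinearMap.id ℂ E).ker).starProjection x‖ₑ ^ 2 := by
  classical
  set W := (G - (μ : ℂ) • ContinuousLinearMap.id ℂ E).ker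
  have hW : ∀ y, y ∈ W ↔ G y = (μ : ℂ) • y := fun y => by
    simp [W, sub_eq_zero]
  rw [← tsum_enorm_inner_sq' ψ.basis]
  refine tsum_congr fun k => ?_
  have hp : G (W.starProjection x) = (μ : ℂ) • W.starProjection x :=
    (hW _).1 (Submodule.starProjection_apply_mem W x)
  split_ifs with h
  · have hk : ψ.basis k ∈ W := (hW _).2 (by rw [ψ.apply_basis, h])
    have : W.starProjection (ψ.basis k) = ψ.basis k :=
      Submodule.starProjection_eq_self_iff.2 hk
    rw [Submodule.inner_starProjection_left_eq_right, this]
  · have h1 := ψ.inner_apply hG k (W.starProjection x)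
    rw [hp, inner_smul_right] at h1
    have h0 : ⟪ψ.basis k, W.starProjection x⟫_ℂ = 0 := by
      by_contra h0
      exact h (Complex.ofReal_injective (mul_right_cancel₀ h0 h1)).symm
    rw [enorm_inner_comm, h0]
    simp

theorem tsum_eigenbasis_eq {G : E →L[ℂ] E} (hG : G.IsPositive) (ψ ψ' : Eigenbasis G)
    (F : ℝ → ℝ≥0∞) (x : E) :
    ∑' k, ‖⟪x, ψ.basis k⟫_ℂ‖ₑ ^ 2 * F (ψ.val k) =
      ∑' k, ‖⟪x, ψ'.basis k⟫_ℂ‖ₑ ^ 2 * F (ψ'.val k) := by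
  classical
  -- The sum is organized by all real `μ`; the index `k` is counted only at `μ = ψ.val k`.
  have key : ∀ ψ : Eigenbasis G, ∑' k, ‖⟪x, ψ.basis k⟫_ℂ‖ₑ ^ 2 * F (ψ.val k) =
      ∑' μ : ℝ, ‖((G - (μ : ℂ) • ContinuousLinearMap.id ℂ E).ker).starProjection x‖ₑ ^ 2 *
        F μ := by
    intro ψ
    simp_rw [← tsum_eigenspace hG ψ, ← ENNReal.tsum_mul_right]
    rw [ENNReal.tsum_comm]
    refine tsum_congr fun k => ?_
    rw [tsum_eq_single (ψ.val k) fun μ hμ => by rw [if_neg hμ.symm, zero_mul], if_pos rfl]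
  rw [key, key]

theorem entSum_eq_of_eigenbasis {D G : E →L[ℂ] E} (hD : D.IsPositive) (hG : G.IsPositive)
    (φ φ' : Eigenbasis D) (ψ ψ' : Eigenbasis G) :
    entSum φ.basis φ.val ψ.basis ψ.val = entSum φ'.basis φ'.val ψ'.basis ψ'.val := by
  unfold entSum
  have h1 : ∀ j, _ := fun j => tsum_eigenbasis_eq hG ψ ψ'
    (fun g => ENNReal.ofReal (relTerm (φ.val j) g)) (φ.basis j)
  simp_rw [h1]
  rw [ENNReal.tsum_comm]
  conv_rhs => rw [ENNReal.tsum_comm]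
  refine tsum_congr fun k => ?_
  simp_rw [enorm_inner_comm _ (ψ'.basis k)]
  exact tsum_eigenbasis_eq hD φ φ' (fun d => ENNReal.ofReal (relTerm d (ψ'.val k))) (ψ'.basis k)

/-- The infimum in `relEntropy` runs over a family that is constant, and nonempty once one pair of
eigenbases is given. -/
theorem relEntropy_eq {D G : E →L[ℂ] E} (hD : D.IsPositive) (hG : G.IsPositive)
    (hker : ∀ v, G v = 0 → D v = 0) (φ : Eigenbasis D) (ψ : Eigenbasis G) :
    relEntropy D G = entSum φ.basis φ.val ψ.basis ψ.val := by
  have h : ∀ (φ' : Eigenbasis D) (ψ' : Eigenbasis G), (∑' (j : φ'.index) (k : ψ'.index),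
      ENNReal.ofReal (‖⟪φ'.basis j, ψ'.basis k⟫_ℂ‖ ^ 2 *
        (φ'.val j * Real.log (φ'.val j) - φ'.val j * Real.log (ψ'.val k) + ψ'.val k -
          φ'.val j))) = entSum φ.basis φ.val ψ.basis ψ.val := by
    intro φ' ψ'
    rw [entSum_eq_of_eigenbasis hD hG φ φ' ψ ψ']
    unfold entSum
    refine tsum_congr fun j => tsum_congr fun k => ?_
    rw [ENNReal.ofReal_mul (sq_nonneg _), enorm_sq_eq_ofReal]
    rfl
  have : Nonempty (Eigenbasis D) := ⟨φ⟩
  have : Nonempty (Eigenbasis G) := ⟨ψ⟩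
  rw [relEntropy, if_pos hker]
  simp_rw [h, ciInf_const]

theorem kerCompat_of_ker {D G : E →L[ℂ] E} (hD : D.IsPositive)
    (hker : ∀ v, G v = 0 → D v = 0) (φ : Eigenbasis D) (ψ : Eigenbasis G) :
    KerCompat φ.basis φ.val ψ.basis ψ.val := by
  intro j k hk
  have h1 := φ.inner_apply hD j (ψ.basis k)
  rw [hker (ψ.basis k) (by rw [ψ.apply_basis, hk]; simp), inner_zero_right] at h1
  simpa using h1.symm

/-- `⟪ψₖ, D ψₖ⟫` is a sum of nonnegative terms `dⱼ |⟪φⱼ, ψₖ⟫|²`, so it vanishes only if all of them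
do. -/
theorem kerCompat_of_qf {D : E →L[ℂ] E} (hD : D.IsPositive) (φ : Eigenbasis D) {κ : Type*}
    (ψ : HilbertBasis κ ℂ E) (g : κ → ℝ) (h : ∀ k, g k = 0 → qf D (ψ k) = 0) :
    KerCompat φ.basis φ.val ψ g := by
  intro j k hk
  have h1 := h k hk
  rw [φ.qf_eq hD, ENNReal.tsum_eq_zero] at h1
  refine (mul_eq_zero.1 (h1 j)).imp (fun h2 => ?_) fun h2 => by simpa using h2
  exact le_antisymm (ENNReal.ofReal_eq_zero.1 h2) (φ.val_nonneg hD j)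

theorem KerCompat.qf_eq_zero {D : E →L[ℂ] E} (hD : D.IsPositive) {φ : Eigenbasis D} {κ : Type*}
    {ψ : HilbertBasis κ ℂ E} {g : κ → ℝ} (h : KerCompat φ.basis φ.val ψ g) (k : κ)
    (hk : g k = 0) : qf D (ψ k) = 0 := by
  rw [φ.qf_eq hD, ENNReal.tsum_eq_zero]
  intro j
  rcases h j k hk with h | h <;> simp [h]

/-! ### Double sums with the weights `|⟪φⱼ, ψₖ⟫|²`. -/

section Sums

variable {ι κ : Type*} {φ : HilbertBasis ι ℂ E} {d : ι → ℝ} {ψ : HilbertBasis κ ℂ E} {g : κ → ℝ}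

/-- The weights are doubly stochastic. Writing single sums as weighted double sums lets identities
between traces be checked summand by summand. -/
theorem tsum_tsum_left (φ : HilbertBasis ι ℂ E) (ψ : HilbertBasis κ ℂ E) (a : ι → ℝ≥0∞) :
    ∑' (j : ι) (k : κ), ‖⟪φ j, ψ k⟫_ℂ‖ₑ ^ 2 * a j = ∑' j, a j := by
  refine tsum_congr fun j => ?_
  rw [ENNReal.tsum_mul_right, tsum_enorm_inner_sq', enorm_basis, one_pow, one_mul]

theorem tsum_tsum_right (φ : HilbertBasis ι ℂ E) (ψ : HilbertBasis κ ℂ E) (a : κ → ℝ≥0∞) :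
    ∑' (j : ι) (k : κ), ‖⟪φ j, ψ k⟫_ℂ‖ₑ ^ 2 * a k = ∑' k, a k := by
  rw [ENNReal.tsum_comm]
  simp_rw [enorm_inner_comm (φ _)]
  exact tsum_tsum_left ψ φ a

/-- The cross term `- ∑ |⟪φⱼ, ψₖ⟫|² dⱼ log gₖ`. -/
def crossSum (φ : HilbertBasis ι ℂ E) (d : ι → ℝ) (ψ : HilbertBasis κ ℂ E) (g : κ → ℝ) : ℝ≥0∞ :=
  ∑' (j : ι) (k : κ), ‖⟪φ j, ψ k⟫_ℂ‖ₑ ^ 2 * (ENNReal.ofReal (d j) * ENNReal.ofReal (-Real.log (g k)))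

/-- Relative entropy in terms of entropy and the cross term. -/
theorem entSum_add (hd : ∀ j, 0 ≤ d j) (hd1 : ∀ j, d j ≤ 1) (hg : ∀ k, 0 ≤ g k)
    (hg1 : ∀ k, g k ≤ 1) (hc : KerCompat φ d ψ g) :
    entSum φ d ψ g + ∑' j, ENNReal.ofReal (Real.negMulLog (d j)) + ∑' j, ENNReal.ofReal (d j) =
      crossSum φ d ψ g + ∑' k, ENNReal.ofReal (g k) := by
  rw [← tsum_tsum_left φ ψ (fun j => ENNReal.ofReal (Real.negMulLog (d j))),
    ← tsum_tsum_left φ ψ (fun j => ENNReal.ofReal (d j)),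
    ← tsum_tsum_right φ ψ (fun k => ENNReal.ofReal (g k))]
  unfold entSum crossSum
  simp_rw [← ENNReal.tsum_add]
  refine tsum_congr fun j => tsum_congr fun k => ?_
  simp_rw [← mul_add]
  by_cases hw : ⟪φ j, ψ k⟫_ℂ = 0
  · simp [hw]
  congr 1
  -- If `gₖ = 0` then `dⱼ = 0` as well, both sides vanish, and the convention `log 0 = 0` does no
  -- harm.
  rcases (hg k).eq_or_lt with h0 | h0
  · have hdj := (hc j k h0.symm).resolve_right hw
    simp [← h0, hdj, relTerm_zero]
  · have hlog := Real.log_nonpos (hg k) (hg1 k)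
    rw [← ENNReal.ofReal_mul (hd j), ← ENNReal.ofReal_add (relTerm_nonneg (hd j) h0)
      (Real.negMulLog_nonneg (hd j) (hd1 j)), ← ENNReal.ofReal_add
      (add_nonneg (relTerm_nonneg (hd j) h0) (Real.negMulLog_nonneg (hd j) (hd1 j))) (hd j),
      ← ENNReal.ofReal_add (mul_nonneg (hd j) (by linarith)) (hg k)]
    congr 1
    unfold relTerm Real.negMulLog
    ring

/-- The regularization of `entSum` obtained by adding `ε` to all eigenvalues. -/
theorem entSum_shift_le {ε : ℝ} (hε : 0 < ε) (hd : ∀ j, 0 ≤ d j) (hg : ∀ k, 0 ≤ g k)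
    (hc : KerCompat φ d ψ g) :
    entSum φ (fun j => d j + ε) ψ (fun k => g k + ε) ≤ entSum φ d ψ g := by
  refine ENNReal.tsum_le_tsum fun j => ENNReal.tsum_le_tsum fun k => ?_
  by_cases hw : ⟪φ j, ψ k⟫_ℂ = 0
  · simp [hw]
  rcases (hg k).eq_or_lt with h0 | h0
  · have hdj := (hc j k h0.symm).resolve_right hw
    simp [← h0, hdj, relTerm_self]
  · gcongr
    exact relTerm_add_le (hd j) h0 hε

/-- With `entSum_shift_le` this makes the sum the supremum of its regularizations. A finite partial
sum already exceeds `c`, and each of its terms is continuous at `ε = 0`; those with `gₖ = 0` and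
nonzero weight have `dⱼ = 0` and vanish for all `ε`. -/
theorem exists_lt_entSum_shift {c : ℝ≥0∞} (hg : ∀ k, 0 ≤ g k)
    (hc : KerCompat φ d ψ g) (h : c < entSum φ d ψ g) :
    ∃ ε > 0, c < entSum φ (fun j => d j + ε) ψ (fun k => g k + ε) := by
  unfold entSum at h ⊢
  rw [← ENNReal.tsum_prod (f := fun j k => ‖⟪φ j, ψ k⟫_ℂ‖ₑ ^ 2 *
    ENNReal.ofReal (relTerm (d j) (g k))), ENNReal.tsum_eq_iSup_sum, lt_iSup_iff] at h
  obtain ⟨s, hs⟩ := h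
  have ht : Filter.Tendsto (fun ε : ℝ => ∑ p ∈ s, ‖⟪φ p.1, ψ p.2⟫_ℂ‖ₑ ^ 2 *
      ENNReal.ofReal (relTerm (d p.1 + ε) (g p.2 + ε))) (nhds 0)
      (nhds (∑ p ∈ s, ‖⟪φ p.1, ψ p.2⟫_ℂ‖ₑ ^ 2 * ENNReal.ofReal (relTerm (d p.1) (g p.2)))) := by
    refine tendsto_finsetSum s fun p _ => ?_
    by_cases hw : ⟪φ p.1, ψ p.2⟫_ℂ = 0
    · simp [hw]
    refine ENNReal.Tendsto.const_mul (ENNReal.tendsto_ofReal ?_) (Or.inr (by simp))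
    rcases (hg p.2).eq_or_lt with h0 | h0
    · have hdj := (hc p.1 p.2 h0.symm).resolve_right hw
      simp [← h0, hdj, relTerm_self]
    · exact tendsto_relTerm_add h0
  have hev := (ht.mono_left nhdsWithin_le_nhds).eventually (lt_mem_nhds hs)
    |>.and (self_mem_nhdsWithin (s := Set.Ioi (0 : ℝ)))
  obtain ⟨ε, hε, hε0⟩ := hev.exists
  refine ⟨ε, hε0, hε.trans_le ?_⟩
  rw [← ENNReal.tsum_prod (f := fun j k => ‖⟪φ j, ψ k⟫_ℂ‖ₑ ^ 2 *
    ENNReal.ofReal (relTerm (d j + ε) (g k + ε)))]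
  exact ENNReal.sum_le_tsum s

end Sums

/-- `relTerm_add_eq` summed with the weights. Apart from the regularized entropy itself, `D` enters
through one trace function of its eigenvalues and one linear term. -/
theorem entSum_shift_add {D : E →L[ℂ] E} (hD : D.IsPositive) (φ : Eigenbasis D) {κ : Type*}
    (ψ : HilbertBasis κ ℂ E) {g : κ → ℝ} (hg : ∀ k, 0 ≤ g k) {ε : ℝ} (hε : 0 < ε) :
    entSum φ.basis (fun j => φ.val j + ε) ψ (fun k => g k + ε) +
        ∑' k, ENNReal.ofReal (shiftLog ε (g k)) * qf D (ψ k) +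
        ∑' k, ENNReal.ofReal (ε * shiftLog ε (g k)) =
      ∑' j, ENNReal.ofReal (shiftEnt ε (φ.val j)) + ∑' k, ENNReal.ofReal (g k) := by
  have e : ∑' k, ENNReal.ofReal (shiftLog ε (g k)) * qf D (ψ k) =
      ∑' (j : φ.index) (k : κ), ‖⟪φ.basis j, ψ k⟫_ℂ‖ₑ ^ 2 *
        (ENNReal.ofReal (φ.val j) * ENNReal.ofReal (shiftLog ε (g k))) := by
    rw [ENNReal.tsum_comm]
    refine tsum_congr fun k => ?_
    rw [φ.qf_eq hD, ← ENNReal.tsum_mul_left]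
    refine tsum_congr fun j => ?_
    ring
  rw [e, ← tsum_tsum_right φ.basis ψ, ← tsum_tsum_left φ.basis ψ
    (fun j => ENNReal.ofReal (shiftEnt ε (φ.val j))), ← tsum_tsum_right φ.basis ψ
    (fun k => ENNReal.ofReal (g k))]
  unfold entSum
  simp_rw [← ENNReal.tsum_add]
  refine tsum_congr fun j => tsum_congr fun k => ?_
  simp_rw [← mul_add]
  congr 1
  have hd := φ.val_nonneg hD j
  have hl := shiftLog_nonneg hε (hg k)
  have hr : 0 ≤ relTerm (φ.val j + ε) (g k + ε) :=
    relTerm_nonneg (by positivity) (by have := hg k; positivity)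
  rw [← ENNReal.ofReal_mul hd, ← ENNReal.ofReal_add hr (by positivity),
    ← ENNReal.ofReal_add (by positivity) (by positivity),
    ← ENNReal.ofReal_add (shiftEnt_nonneg hε hd) (hg k), relTerm_add_eq hε hd (hg k)]

/-- Peierls' inequality for the convex function `shiftEnt ε`. -/
theorem sum_shiftEnt_le {B : E →L[ℂ] E} (hB : B.IsPositive) (β : Eigenbasis B) {ι : Type*}
    (α : HilbertBasis ι ℂ E) {ε : ℝ} (hε : 0 < ε) (s : Finset ι) :
    ∑ a ∈ s, ENNReal.ofReal (shiftEnt ε (qf B (α a)).toReal) ≤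
      ∑' i, ENNReal.ofReal (shiftEnt ε (β.val i)) := by
  rw [← tsum_tsum_right α β.basis]
  refine le_trans ?_ (ENNReal.sum_le_tsum s)
  refine Finset.sum_le_sum fun a _ => ?_
  set c := (qf B (α a)).toReal with hc
  have hc0 : 0 ≤ c := ENNReal.toReal_nonneg
  have hqc : qf B (α a) = ENNReal.ofReal c := (ENNReal.ofReal_toReal (qf_ne_top _ _)).symm
  have hw : ∑' i, ‖⟪α a, β.basis i⟫_ℂ‖ₑ ^ 2 = 1 := by
    rw [tsum_enorm_inner_sq', enorm_basis, one_pow]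
  have hl := shiftLog_nonneg hε hc0
  -- The graph of `shiftEnt ε` lies above its tangent at `c`, by nonnegativity of `relTerm (b + ε)
  -- (c + ε)`. Averaging over the eigenvalues of `B` with weights of mean `c` gives the claim; `c`
  -- is added on both sides to avoid subtraction.
  have h1 : ENNReal.ofReal (shiftEnt ε c) + ENNReal.ofReal c ≤
      ∑' i, ‖⟪α a, β.basis i⟫_ℂ‖ₑ ^ 2 * ENNReal.ofReal (shiftEnt ε (β.val i)) +
        ENNReal.ofReal c := by
    calc ENNReal.ofReal (shiftEnt ε c) + ENNReal.ofReal c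
        = ENNReal.ofReal c * ENNReal.ofReal (shiftLog ε c) + ENNReal.ofReal (ε * shiftLog ε c) := by
          rw [← ENNReal.ofReal_add (shiftEnt_nonneg hε hc0) hc0, ← ENNReal.ofReal_mul hc0,
            ← ENNReal.ofReal_add (by positivity) (by positivity)]
          congr 1
          unfold shiftEnt
          ring
      _ = ∑' i, (‖⟪α a, β.basis i⟫_ℂ‖ₑ ^ 2 *
            (ENNReal.ofReal (β.val i) * ENNReal.ofReal (shiftLog ε c)) +
            ‖⟪α a, β.basis i⟫_ℂ‖ₑ ^ 2 * ENNReal.ofReal (ε * shiftLog ε c)) := by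
          rw [ENNReal.tsum_add, ENNReal.tsum_mul_right, hw, one_mul, ← hqc, β.qf_eq hB,
            ← ENNReal.tsum_mul_right]
          congr 1
          refine tsum_congr fun i => ?_
          rw [enorm_inner_comm]
          ring
      _ ≤ ∑' i, (‖⟪α a, β.basis i⟫_ℂ‖ₑ ^ 2 * ENNReal.ofReal (shiftEnt ε (β.val i)) +
            ‖⟪α a, β.basis i⟫_ℂ‖ₑ ^ 2 * ENNReal.ofReal c) := by
          refine ENNReal.tsum_le_tsum fun i => ?_
          rw [← mul_add, ← mul_add]
          refine mul_le_mul' le_rfl ?_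
          have hb := β.val_nonneg hB i
          rw [← ENNReal.ofReal_mul hb, ← ENNReal.ofReal_add (by positivity) (by positivity),
            ← ENNReal.ofReal_add (shiftEnt_nonneg hε hb) hc0]
          refine ENNReal.ofReal_le_ofReal ?_
          have h := relTerm_add_eq hε hb hc0
          have hr : 0 ≤ relTerm (β.val i + ε) (c + ε) :=
            relTerm_nonneg (by positivity) (by positivity)
          linarith
      _ = _ := by
          rw [ENNReal.tsum_add, ENNReal.tsum_mul_right (a := ENNReal.ofReal c), hw, one_mul]
  exact ENNReal.le_of_add_le_add_right ENNReal.ofReal_ne_top h1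

/-- Lower semicontinuity of the relative entropy in the first argument, along families that are
dominated by their limit. -/
theorem eventually_lt_entSum {A : E →L[ℂ] E} (hA : A.IsPositive) (hAt : posTrace A ≠ ∞)
    (α : Eigenbasis A) {J : Type*} {l : Filter J} {B : J → E →L[ℂ] E}
    (hB : ∀ i, (B i).IsPositive) (β : ∀ i, Eigenbasis (B i)) (hBA : ∀ i x, qf (B i) x ≤ qf A x)
    (hlim : ∀ x, Filter.Tendsto (fun i => qf (B i) x) l (nhds (qf A x)))
    {κ : Type*} (ψ : HilbertBasis κ ℂ E) {g : κ → ℝ} (hg : ∀ k, 0 ≤ g k)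
    (hgs : ∑' k, ENNReal.ofReal (g k) ≠ ∞) (hc : KerCompat α.basis α.val ψ g)
    {c : ℝ≥0∞} (h : c < entSum α.basis α.val ψ g) :
    ∀ᶠ i in l, c < entSum (β i).basis (β i).val ψ g := by
  obtain ⟨ε, hε, hcε⟩ := exists_lt_entSum_shift hg hc h
  -- The linear part for `A`. It is finite because `shiftLog ε g ≤ g / ε`, and it dominates the
  -- linear part for every `B i`, so it can be cancelled.
  set L := ∑' k, ENNReal.ofReal (shiftLog ε (g k)) * qf A (ψ k) +
    ∑' k, ENNReal.ofReal (ε * shiftLog ε (g k)) with hL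
  have hLt : L ≠ ∞ := by
    refine ENNReal.add_ne_top.2 ⟨?_, ?_⟩
    · refine ne_top_of_le_ne_top (b := (∑' k, ENNReal.ofReal (g k)) *
        (ENNReal.ofReal ε⁻¹ * posTrace A)) (by finiteness) ?_
      rw [← ENNReal.tsum_mul_right]
      refine ENNReal.tsum_le_tsum fun k => ?_
      rw [← mul_assoc, ← ENNReal.ofReal_mul (hg k)]
      gcongr
      · have := mul_shiftLog_le hε (hg k)
        rw [← div_eq_mul_inv, le_div_iff₀ hε]
        linarith
      · simpa [enorm_basis] using qf_le_posTrace hA (ψ k)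
    · refine ne_top_of_le_ne_top hgs (ENNReal.tsum_le_tsum fun k => ?_)
      exact ENNReal.ofReal_le_ofReal (mul_shiftLog_le hε (hg k))
  have h1 := entSum_shift_add hA α ψ hg hε
  rw [add_assoc, ← hL] at h1
  have h2 : c + L < ∑' j, ENNReal.ofReal (shiftEnt ε (α.val j)) + ∑' k, ENNReal.ofReal (g k) := by
    rw [← h1]
    exact (ENNReal.add_lt_add_iff_right hLt).2 hcε
  rw [ENNReal.tsum_eq_iSup_sum (f := fun j => ENNReal.ofReal (shiftEnt ε (α.val j))),
    ENNReal.iSup_add, lt_iSup_iff] at h2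
  obtain ⟨s, hs⟩ := h2
  -- Only finitely many diagonal entries of `B i`, in the eigenbasis of `A`, have to converge; their
  -- limits are eigenvalues of `A`.
  have ht : Filter.Tendsto (fun i => ∑ a ∈ s, ENNReal.ofReal
      (shiftEnt ε (qf (B i) (α.basis a)).toReal) + ∑' k, ENNReal.ofReal (g k)) l
      (nhds (∑ a ∈ s, ENNReal.ofReal (shiftEnt ε (α.val a)) + ∑' k, ENNReal.ofReal (g k))) := by
    refine (tendsto_finsetSum s fun a _ => ENNReal.tendsto_ofReal ?_).add_const _
    have h3 := (ENNReal.tendsto_toReal (qf_ne_top A (α.basis a))).comp (hlim (α.basis a))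
    rw [α.qf_basis, ENNReal.toReal_ofReal (α.val_nonneg hA a)] at h3
    exact (continuousAt_shiftEnt hε (α.val_nonneg hA a)).tendsto.comp h3
  filter_upwards [ht.eventually (lt_mem_nhds hs)] with i hi
  have hci : KerCompat (β i).basis (β i).val ψ g :=
    kerCompat_of_qf (hB i) (β i) ψ g fun k hk =>
      le_antisymm ((hBA i _).trans_eq (hc.qf_eq_zero hA k hk)) zero_le
  refine lt_of_lt_of_le ?_ (entSum_shift_le hε ((β i).val_nonneg (hB i)) hg hci)
  have h4 := entSum_shift_add (hB i) (β i) ψ hg hε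
  rw [add_assoc] at h4
  have h5 : ∑' k, ENNReal.ofReal (shiftLog ε (g k)) * qf (B i) (ψ k) +
      ∑' k, ENNReal.ofReal (ε * shiftLog ε (g k)) ≤ L := by
    rw [hL]
    gcongr
    exact hBA i _
  refine (ENNReal.add_lt_add_iff_right hLt).1 ?_
  calc c + L < _ := hi
    _ ≤ ∑' j, ENNReal.ofReal (shiftEnt ε ((β i).val j)) + ∑' k, ENNReal.ofReal (g k) := by
        gcongr
        exact sum_shiftEnt_le (hB i) (β i) α.basis hε s
    _ ≤ _ := by rw [← h4]; gcongr

end Entropy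

/-! ### Diagonal operators -/

section Diagonal

variable {E : Type u} [NormedAddCommGroup E] [InnerProductSpace ℂ E] [CompleteSpace E]

/-- The operator that is diagonal in the orthonormal basis `b`, with (summable) eigenvalues `x`. -/
def diagOp {ι : Type*} (b : HilbertBasis ι ℂ E) (x : ι → ℝ) : E →L[ℂ] E :=
  ∑' i, (x i : ℂ) • InnerProductSpace.rankOne ℂ (b i) (b i)

variable {ι : Type u} (b : HilbertBasis ι ℂ E) {x : ι → ℝ}

theorem hasSum_diagOp (hx : Summable x) :
    HasSum (fun i => (x i : ℂ) • InnerProductSpace.rankOne ℂ (b i) (b i)) (diagOp b x) := by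
  refine Summable.hasSum (Summable.of_norm ?_)
  simpa [norm_smul, b.orthonormal.1] using hx.abs

theorem diagOp_apply_basis (hx : Summable x) (i : ι) : diagOp b x (b i) = (x i : ℂ) • b i := by
  classical
  have h := (hasSum_diagOp b hx).mapL (ContinuousLinearMap.apply ℂ E (b i))
  have h2 := hasSum_single (f := fun j => ContinuousLinearMap.apply ℂ E (b i)
    ((x j : ℂ) • InnerProductSpace.rankOne ℂ (b j) (b j))) i fun j hj => by
      simp [b.orthonormal.2 hj]
  refine (h.unique h2).trans ?_
  simp [inner_self_eq_norm_sq_to_K, b.orthonormal.1]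

/-- The eigenbasis of a diagonal operator. -/
def diagEigenbasis (hx : Summable x) : Eigenbasis (diagOp b x) where
  index := ι
  basis := b
  val := x
  apply_basis := diagOp_apply_basis b hx

open scoped ComplexOrder in
theorem isPositive_of_basis {T : E →L[ℂ] E} (h0 : ∀ i, 0 ≤ x i)
    (h : ∀ i, T (b i) = (x i : ℂ) • b i) : T.IsPositive := by
  refine isPositive_of_inner fun y => ?_
  have hadj : ContinuousLinearMap.adjoint T = T := by
    refine eq_of_forall_basis b fun i => eq_of_forall_inner_basis b fun j => ?_
    rw [ContinuousLinearMap.adjoint_inner_right, h, h, inner_smul_left, inner_smul_right,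
      Complex.conj_ofReal]
    classical
    rw [orthonormal_iff_ite.1 b.orthonormal]
    split_ifs with hij
    · rw [hij]
    · simp
  have hs := b.hasSum_inner_mul_inner y (T y)
  rw [← hs.tsum_eq]
  refine tsum_nonneg fun i => ?_
  have : ⟪b i, T y⟫_ℂ = x i * ⟪b i, y⟫_ℂ := by
    rw [← ContinuousLinearMap.adjoint_inner_left, hadj, h, inner_smul_left, Complex.conj_ofReal]
  rw [this, mul_left_comm, ← inner_conj_symm, ← Complex.normSq_eq_conj_mul_self,
    ← Complex.ofReal_mul]
  exact_mod_cast mul_nonneg (h0 i) (Complex.normSq_nonneg _)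

theorem diagOp_isPositive (hx : Summable x) (h0 : ∀ i, 0 ≤ x i) : (diagOp b x).IsPositive :=
  isPositive_of_basis b h0 (diagOp_apply_basis b hx)

theorem posTrace_diagOp (hx : Summable x) (h0 : ∀ i, 0 ≤ x i) :
    posTrace (diagOp b x) = ∑' i, ENNReal.ofReal (x i) :=
  ((diagEigenbasis b hx).tsum_val (diagOp_isPositive b hx h0)).symm

theorem qf_diagOp (hx : Summable x) (h0 : ∀ i, 0 ≤ x i) (y : E) :
    qf (diagOp b x) y = ∑' i, ENNReal.ofReal (x i) * ‖⟪b i, y⟫_ℂ‖ₑ ^ 2 :=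
  (diagEigenbasis b hx).qf_eq (diagOp_isPositive b hx h0) y

end Diagonal

/-! ### Tensor products and partial traces -/

section Tensor

variable {E₁ E₂ E : Type u} [NormedAddCommGroup E₁] [InnerProductSpace ℂ E₁] [CompleteSpace E₁]
  [NormedAddCommGroup E₂] [InnerProductSpace ℂ E₂] [CompleteSpace E₂]
  [NormedAddCommGroup E] [InnerProductSpace ℂ E] [CompleteSpace E]

/-- The bounded bilinear map `m` exhibits `E` as the Hilbert space tensor product of `E₁` and
`E₂`. -/
structure IsHilbertTensor (m : E₁ →L[ℂ] E₂ →L[ℂ] E) : Prop where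
  inner_eq : ∀ a a' b b', ⟪m a b, m a' b'⟫_ℂ = ⟪a, a'⟫_ℂ * ⟪b, b'⟫_ℂ
  total : ∀ x, (∀ a b, ⟪m a b, x⟫_ℂ = 0) → x = 0

variable {m : E₁ →L[ℂ] E₂ →L[ℂ] E}

theorem IsHilbertTensor.flip (hm : IsHilbertTensor m) : IsHilbertTensor m.flip :=
  ⟨fun a a' b b' => by simp [hm.inner_eq, mul_comm], fun x hx => hm.total x fun a b => hx b a⟩

theorem IsHilbertTensor.norm_eq (hm : IsHilbertTensor m) (a : E₁) (b : E₂) :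
    ‖m a b‖ = ‖a‖ * ‖b‖ := by
  have e := hm.inner_eq a a b b
  rw [inner_self_eq_norm_sq_to_K, inner_self_eq_norm_sq_to_K, inner_self_eq_norm_sq_to_K] at e
  norm_cast at e
  rw [← mul_pow] at e
  exact (pow_left_inj₀ (norm_nonneg _) (by positivity) two_ne_zero).1 e

section ProdBasis

variable {ι κ : Type*} (b : HilbertBasis ι ℂ E₁) (c : HilbertBasis κ ℂ E₂)

theorem IsHilbertTensor.orthonormal (hm : IsHilbertTensor m) : Orthonormal ℂ fun p : ι × κ => m (b p.1) (c p.2) := by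
  classical
  rw [orthonormal_iff_ite]
  rintro ⟨i, k⟩ ⟨j, l⟩
  rw [hm.inner_eq, orthonormal_iff_ite.1 b.orthonormal, orthonormal_iff_ite.1 c.orthonormal]
  simp only [Prod.ext_iff]
  split_ifs <;> simp_all

theorem IsHilbertTensor.orthogonal_eq_bot (hm : IsHilbertTensor m) :
    (Submodule.span ℂ (Set.range fun p : ι × κ => m (b p.1) (c p.2)))ᗮ = ⊥ := by
  rw [eq_bot_iff]
  intro x hx
  rw [Submodule.mem_orthogonal'] at hx
  have h0 : ∀ i k, ⟪x, m (b i) (c k)⟫_ℂ = 0 := fun i k =>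
    hx _ (Submodule.subset_span ⟨(i, k), rfl⟩)
  have h1 : ∀ i, innerSL ℂ x ∘L m (b i) = 0 := fun i => eq_of_forall_basis c fun k => h0 i k
  have h2 : ∀ y, innerSL ℂ x ∘L m.flip y = 0 := fun y => eq_of_forall_basis b fun i =>
    DFunLike.congr_fun (h1 i) y
  refine hm.total x fun a y => ?_
  rw [← inner_conj_symm, map_eq_zero]
  exact DFunLike.congr_fun (h2 y) a

/-- The product of two orthonormal bases. -/
def IsHilbertTensor.basis (hm : IsHilbertTensor m) : HilbertBasis (ι × κ) ℂ E :=
  HilbertBasis.mkOfOrthogonalEqBot (hm.orthonormal b c) (hm.orthogonal_eq_bot b c)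

theorem IsHilbertTensor.basis_apply (hm : IsHilbertTensor m) (p : ι × κ) : hm.basis b c p = m (b p.1) (c p.2) :=
  congr_fun (HilbertBasis.coe_mkOfOrthogonalEqBot (hm.orthonormal b c) (hm.orthogonal_eq_bot b c)) p

end ProdBasis

/-- The partial trace over the second factor. -/
def ptrace (m : E₁ →L[ℂ] E₂ →L[ℂ] E) (D : E →L[ℂ] E) : E₁ →L[ℂ] E₁ :=
  ∑' i, (m.flip (stdBasis E₂ i)).adjoint ∘L D ∘L m.flip (stdBasis E₂ i)

theorem isPositive_conj {F : Type*} [NormedAddCommGroup F] [InnerProductSpace ℂ F]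
    [CompleteSpace F] {D : E →L[ℂ] E} (hD : D.IsPositive) (R : F →L[ℂ] E) :
    (R.adjoint ∘L D ∘L R).IsPositive :=
  hD.adjoint_conj R

theorem qf_conj {F : Type*} [NormedAddCommGroup F] [InnerProductSpace ℂ F]
    [CompleteSpace F] (D : E →L[ℂ] E) (R : F →L[ℂ] E) (x : F) :
    qf (R.adjoint ∘L D ∘L R) x = qf D (R x) := by
  simp [qf, ContinuousLinearMap.adjoint_inner_right]

/-! ### Convergence and quadratic form of the partial trace. -/

section PTrace

variable {D : E →L[ℂ] E}

theorem tsum_qf_prod (hm : IsHilbertTensor m) (hD : D.IsPositive) {ι κ : Type*}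
    (b : HilbertBasis ι ℂ E₁) (c : HilbertBasis κ ℂ E₂) :
    ∑' (i) (k), qf D (m (b i) (c k)) = posTrace D := by
  rw [← tsum_qf hD (hm.basis b c), ENNReal.tsum_prod']
  simp_rw [hm.basis_apply]

/-- The summands are positive, their traces add up to that of `D`, and the norm of a positive
operator is at most its trace; so the series converges absolutely in norm. -/
theorem hasSum_ptrace (hm : IsHilbertTensor m) (hD : D.IsPositive) (ht : posTrace D ≠ ∞) :
    HasSum (fun i => (m.flip (stdBasis E₂ i)).adjoint ∘L D ∘L m.flip (stdBasis E₂ i))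
      (ptrace m D) := by
  have h : ∑' i, posTrace ((m.flip (stdBasis E₂ i)).adjoint ∘L D ∘L m.flip (stdBasis E₂ i)) =
      posTrace D := by
    rw [← tsum_qf_prod hm.flip hD (stdBasis E₂) (stdBasis E₁)]
    simp_rw [posTrace, qf_conj]
  rw [← h] at ht
  exact Summable.hasSum (Summable.of_norm_bounded (ENNReal.summable_toReal ht) fun i =>
    norm_le_posTrace (isPositive_conj hD _) (ENNReal.ne_top_of_tsum_ne_top ht i))

theorem hasSum_inner_ptrace (hm : IsHilbertTensor m) (hD : D.IsPositive) (ht : posTrace D ≠ ∞)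
    (x y : E₁) : HasSum (fun i => ⟪m x (stdBasis E₂ i), D (m y (stdBasis E₂ i))⟫_ℂ)
      ⟪x, ptrace m D y⟫_ℂ := by
  have h := ((hasSum_ptrace hm hD ht).mapL (ContinuousLinearMap.apply ℂ E₁ y)).mapL (innerSL ℂ x)
  simpa [ContinuousLinearMap.adjoint_inner_right] using h

open scoped ComplexOrder in
theorem ptrace_isPositive (hm : IsHilbertTensor m) (hD : D.IsPositive) (ht : posTrace D ≠ ∞) :
    (ptrace m D).IsPositive :=
  isPositive_of_inner fun x => by
    rw [← (hasSum_inner_ptrace hm hD ht x x).tsum_eq]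
    exact tsum_nonneg fun i => hD.inner_nonneg_right _

/-- The value at `x` is the trace over `E₂` of the compression of `D` by `m x`, so any orthonormal
basis may replace the one in the definition. -/
theorem qf_ptrace (hm : IsHilbertTensor m) (hD : D.IsPositive) (ht : posTrace D ≠ ∞) {κ : Type*}
    (c : HilbertBasis κ ℂ E₂) (x : E₁) : qf (ptrace m D) x = ∑' k, qf D (m x (c k)) := by
  simp_rw [← qf_conj]
  rw [tsum_qf (isPositive_conj hD (m x)), posTrace, qf]
  have h := Complex.hasSum_re (hasSum_inner_ptrace hm hD ht x x)
  rw [← h.tsum_eq, ENNReal.ofReal_tsum_of_nonneg (fun i => re_inner_nonneg hD _) h.summable]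
  simp_rw [qf_conj]
  rfl

theorem posTrace_ptrace (hm : IsHilbertTensor m) (hD : D.IsPositive) (ht : posTrace D ≠ ∞) :
    posTrace (ptrace m D) = posTrace D := by
  rw [← tsum_qf_prod hm hD (stdBasis E₁) (stdBasis E₂), posTrace]
  simp_rw [qf_ptrace hm hD ht (stdBasis E₂)]

theorem qf_ptrace_flip (hm : IsHilbertTensor m) (hD : D.IsPositive) (ht : posTrace D ≠ ∞)
    {ι : Type*} (b : HilbertBasis ι ℂ E₁) (y : E₂) :
    qf (ptrace m.flip D) y = ∑' i, qf D (m (b i) y) :=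
  qf_ptrace hm.flip hD ht b y

end PTrace

/-! ### The relative entropy with respect to a product -/

theorem crossSum_eq {D : E →L[ℂ] E} (hD : D.IsPositive) (φ : Eigenbasis D) {κ : Type*}
    (ψ : HilbertBasis κ ℂ E) (g : κ → ℝ) :
    crossSum φ.basis φ.val ψ g = ∑' k, ENNReal.ofReal (-Real.log (g k)) * qf D (ψ k) := by
  unfold crossSum
  rw [ENNReal.tsum_comm]
  refine tsum_congr fun k => ?_
  rw [φ.qf_eq hD, ← ENNReal.tsum_mul_left]
  exact tsum_congr fun j => by ring

theorem crossSum_self {D : E →L[ℂ] E} (hD : D.IsPositive) (φ : Eigenbasis D)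
    (h1 : posTrace D ≤ 1) :
    ∑' k, ENNReal.ofReal (-Real.log (φ.val k)) * qf D (φ.basis k) =
      ∑' k, ENNReal.ofReal (Real.negMulLog (φ.val k)) := by
  refine tsum_congr fun k => ?_
  have h0 := φ.val_nonneg hD k
  rw [φ.qf_basis, ← ENNReal.ofReal_mul]
  · congr 1
    unfold Real.negMulLog
    ring
  · have := Real.log_nonpos h0 (φ.val_le hD h1 k)
    linarith

/-- The logarithm of the product splits into two parts of the same sign, and summing diagonal
entries of `D` over one index gives those of a partial trace. Where the logarithm does not split
because `g i * h k = 0`, `hc` removes the term. -/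
theorem tsum_log_mul_qf (hm : IsHilbertTensor m) {D : E →L[ℂ] E} (hD : D.IsPositive)
    (ht : posTrace D ≠ ∞) {ι κ : Type*} (b : HilbertBasis ι ℂ E₁) (c : HilbertBasis κ ℂ E₂)
    {g : ι → ℝ} {h : κ → ℝ} (hg0 : ∀ i, 0 ≤ g i) (hg1 : ∀ i, g i ≤ 1)
    (hh0 : ∀ i, 0 ≤ h i) (hh1 : ∀ i, h i ≤ 1)
    (hc : ∀ i k, g i * h k = 0 → qf D (m (b i) (c k)) = 0) :
    ∑' p : ι × κ, ENNReal.ofReal (-Real.log (g p.1 * h p.2)) * qf D (hm.basis b c p) =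
      ∑' i, ENNReal.ofReal (-Real.log (g i)) * qf (ptrace m D) (b i) +
        ∑' k, ENNReal.ofReal (-Real.log (h k)) * qf (ptrace m.flip D) (c k) := by
  simp_rw [qf_ptrace hm hD ht c, qf_ptrace_flip hm hD ht b, ← ENNReal.tsum_mul_left]
  rw [ENNReal.tsum_comm (f := fun k i => ENNReal.ofReal (-Real.log (h k)) * qf D (m (b i) (c k))),
    ENNReal.tsum_prod', ← ENNReal.tsum_add]
  refine tsum_congr fun i => ?_
  rw [← ENNReal.tsum_add]
  refine tsum_congr fun k => ?_
  rw [hm.basis_apply]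
  by_cases h0 : g i * h k = 0
  · simp [hc i k h0]
  · rw [Real.log_mul (left_ne_zero_of_mul h0) (right_ne_zero_of_mul h0), neg_add,
      ENNReal.ofReal_add, add_mul]
    · have := Real.log_nonpos (hg0 i) (hg1 i)
      linarith
    · have := Real.log_nonpos (hh0 k) (hh1 k)
      linarith

theorem tsum_ofReal_mul {ι κ : Type*} (x : ι → ℝ) (y : κ → ℝ) (hx : ∀ i, 0 ≤ x i) :
    ∑' p : ι × κ, ENNReal.ofReal (x p.1 * y p.2) =
      (∑' i, ENNReal.ofReal (x i)) * ∑' k, ENNReal.ofReal (y k) := by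
  rw [ENNReal.tsum_prod', ← ENNReal.tsum_mul_right]
  refine tsum_congr fun i => ?_
  rw [← ENNReal.tsum_mul_left]
  exact tsum_congr fun k => ENNReal.ofReal_mul (hx i)

/-- The chain rule for the relative entropy with respect to a product, for operators of finite
entropy. -/
theorem entSum_tensor (hm : IsHilbertTensor m) {D : E →L[ℂ] E} (hD : D.IsPositive)
    (ht : posTrace D ≤ 1) (φ : Eigenbasis D)
    (hH : ∑' j, ENNReal.ofReal (Real.negMulLog (φ.val j)) ≠ ∞)
    {ι κ : Type*} (ψ : HilbertBasis ι ℂ E₁) (χ : HilbertBasis κ ℂ E₂)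
    {g : ι → ℝ} {h : κ → ℝ} (hg0 : ∀ i, 0 ≤ g i) (hh0 : ∀ i, 0 ≤ h i)
    (hg : ∑' i, ENNReal.ofReal (g i) = 1) (hh : ∑' k, ENNReal.ofReal (h k) = 1)
    (hc : KerCompat φ.basis φ.val (hm.basis ψ χ) fun p => g p.1 * h p.2)
    (hfin : entSum φ.basis φ.val (hm.basis ψ χ) (fun p => g p.1 * h p.2) ≠ ∞)
    (α : Eigenbasis (ptrace m D)) (β : Eigenbasis (ptrace m.flip D)) :
    entSum α.basis α.val ψ g + entSum β.basis β.val χ h +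
        entSum φ.basis φ.val (hm.basis α.basis β.basis) (fun p => α.val p.1 * β.val p.2) +
        2 * posTrace D =
      entSum φ.basis φ.val (hm.basis ψ χ) (fun p => g p.1 * h p.2) + 1 + posTrace D ^ 2 := by
  have ht' : posTrace D ≠ ∞ := ne_top_of_le_ne_top ENNReal.one_ne_top ht
  have hg1 : ∀ i, g i ≤ 1 := fun i =>
    ENNReal.ofReal_le_one.1 ((ENNReal.le_tsum i).trans_eq hg)
  have hh1 : ∀ i, h i ≤ 1 := fun i =>
    ENNReal.ofReal_le_one.1 ((ENNReal.le_tsum i).trans_eq hh)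
  have hP₁ := ptrace_isPositive hm hD ht'
  have hP₂ := ptrace_isPositive hm.flip hD ht'
  have ht₁ := posTrace_ptrace hm hD ht'
  have ht₂ := posTrace_ptrace hm.flip hD ht'
  have hα1 := α.val_le hP₁ (ht₁.trans_le ht)
  have hβ1 := β.val_le hP₂ (ht₂.trans_le ht)
  have hα0 := α.val_nonneg hP₁
  have hβ0 := β.val_nonneg hP₂
  have hqc : ∀ i k, g i * h k = 0 → qf D (m (ψ i) (χ k)) = 0 := fun i k hik => by
    rw [← hm.basis_apply ψ χ (i, k)]
    exact hc.qf_eq_zero hD _ hik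
  have hc₁ : KerCompat α.basis α.val ψ g := kerCompat_of_qf hP₁ α ψ g fun k hk => by
    rw [qf_ptrace hm hD ht' χ, ENNReal.tsum_eq_zero]
    exact fun l => hqc k l (by rw [hk, zero_mul])
  have hc₂ : KerCompat β.basis β.val χ h := kerCompat_of_qf hP₂ β χ h fun k hk => by
    rw [qf_ptrace_flip hm hD ht' ψ, ENNReal.tsum_eq_zero]
    exact fun l => hqc l k (by rw [hk, mul_zero])
  have hqX : ∀ a b, α.val a * β.val b = 0 → qf D (m (α.basis a) (β.basis b)) = 0 := by
    intro a b hab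
    rcases mul_eq_zero.1 hab with h0 | h0
    · have h1 := α.qf_basis a
      rw [h0, ENNReal.ofReal_zero, qf_ptrace hm hD ht' β.basis, ENNReal.tsum_eq_zero] at h1
      exact h1 b
    · have h1 := β.qf_basis b
      rw [h0, ENNReal.ofReal_zero, qf_ptrace_flip hm hD ht' α.basis, ENNReal.tsum_eq_zero] at h1
      exact h1 a
  have hcX : KerCompat φ.basis φ.val (hm.basis α.basis β.basis)
      fun p => α.val p.1 * β.val p.2 := kerCompat_of_qf hD φ _ _ fun p hp => by
    rw [hm.basis_apply]
    exact hqX _ _ hp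
  have k0 := entSum_add (φ.val_nonneg hD) (φ.val_le hD ht)
    (fun p : ι × κ => mul_nonneg (hg0 p.1) (hh0 p.2))
    (fun p : ι × κ => mul_le_one₀ (hg1 p.1) (hh0 p.2) (hh1 p.2)) hc
  have k1 := entSum_add hα0 hα1 hg0 hg1 hc₁
  have k2 := entSum_add hβ0 hβ1 hh0 hh1 hc₂
  have k3 := entSum_add (φ.val_nonneg hD) (φ.val_le hD ht)
    (fun p : α.index × β.index => mul_nonneg (hα0 p.1) (hβ0 p.2))
    (fun p : α.index × β.index => mul_le_one₀ (hα1 p.1) (hβ0 p.2) (hβ1 p.2)) hcX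
  -- With `t` the trace of `D`, the references `G₁ ⊗ G₂` and `D₁ ⊗ D₂` have masses `1` and `t²`. The
  -- terms `g - d` of the four sums thus account for `2 t`, `1` and `t²`. The cross term against `D₁
  -- ⊗ D₂` is the sum of the entropies of the partial traces.
  rw [crossSum_eq hD, tsum_log_mul_qf hm hD ht' ψ χ hg0 hg1 hh0 hh1 hqc, φ.tsum_val hD,
    tsum_ofReal_mul g h hg0, hg, hh, one_mul] at k0
  rw [crossSum_eq hP₁, α.tsum_val hP₁, ht₁, hg] at k1
  rw [crossSum_eq hP₂, β.tsum_val hP₂, ht₂, hh] at k2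
  rw [crossSum_eq hD, tsum_log_mul_qf hm hD ht' α.basis β.basis hα0 hα1 hβ0 hβ1 hqX,
    φ.tsum_val hD, crossSum_self hP₁ α (ht₁.trans_le ht), crossSum_self hP₂ β (ht₂.trans_le ht),
    tsum_ofReal_mul α.val β.val hα0, α.tsum_val hP₁, ht₁, β.tsum_val hP₂, ht₂] at k3
  set t := posTrace D
  set V := entSum φ.basis φ.val (hm.basis ψ χ) (fun p => g p.1 * h p.2)
  set V1 := entSum α.basis α.val ψ g
  set V2 := entSum β.basis β.val χ h
  set V3 := entSum φ.basis φ.val (hm.basis α.basis β.basis) (fun p => α.val p.1 * β.val p.2)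
  set H := ∑' j, ENNReal.ofReal (Real.negMulLog (φ.val j))
  set H1 := ∑' j, ENNReal.ofReal (Real.negMulLog (α.val j))
  set H2 := ∑' j, ENNReal.ofReal (Real.negMulLog (β.val j))
  set Q1 := ∑' i, ENNReal.ofReal (-Real.log (g i)) * qf (ptrace m D) (ψ i)
  set Q2 := ∑' k, ENNReal.ofReal (-Real.log (h k)) * qf (ptrace m.flip D) (χ k)
  -- Finiteness of `V` and of the entropy `H` passes to the cross terms and then to the marginal
  -- entropies, which may therefore be cancelled.
  have hQ : Q1 + Q2 + 1 ≠ ∞ := by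
    rw [← k0]
    finiteness
  have hQ1 : Q1 ≠ ∞ := fun h => hQ (by simp [h])
  have hQ2 : Q2 ≠ ∞ := fun h => hQ (by simp [h])
  have hs1 : V1 + H1 + t ≠ ∞ := by rw [k1]; finiteness
  have hs2 : V2 + H2 + t ≠ ∞ := by rw [k2]; finiteness
  have hH1 : H1 ≠ ∞ := fun h => hs1 (by simp [h])
  have hH2 : H2 ≠ ∞ := fun h => hs2 (by simp [h])
  have hT : H1 + H2 + H + t ≠ ∞ := by finiteness
  refine (ENNReal.add_left_inj hT).1 ?_
  calc V1 + V2 + V3 + 2 * t + (H1 + H2 + H + t)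
      = (V1 + H1 + t) + (V2 + H2 + t) + (V3 + H + t) := by ring
    _ = (Q1 + Q2 + 1) + 1 + (H1 + H2) + t * t := by rw [k1, k2, k3]; ring
    _ = (V + H + t) + 1 + (H1 + H2) + t * t := by rw [k0]
    _ = V + 1 + t ^ 2 + (H1 + H2 + H + t) := by ring

end Tensor

/-! ### Superadditivity of the relative entropy -/

section HilbertSchmidt

variable {E : Type u} [NormedAddCommGroup E] [InnerProductSpace ℂ E] [CompleteSpace E]

/-- The relative entropy dominates the squared Hilbert-Schmidt distance. -/
theorem sq_le_entSum {D G : E →L[ℂ] E} (hD : D.IsPositive) (hG : G.IsPositive)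
    (hD1 : posTrace D ≤ 1) (hG1 : posTrace G ≤ 1) (φ : Eigenbasis D) (ψ : Eigenbasis G)
    (hc : KerCompat φ.basis φ.val ψ.basis ψ.val) {z : E} (hz : ‖z‖ = 1) :
    ENNReal.ofReal (((qf D z).toReal - (qf G z).toReal) ^ 2 / 4) ≤
      entSum φ.basis φ.val ψ.basis ψ.val := by
  have hsym : ∀ x y, ⟪(D - G) x, y⟫_ℂ = ⟪x, (D - G) y⟫_ℂ := fun x y => by
    simp only [sub_apply, inner_sub_left, inner_sub_right, hD.inner_left_eq_inner_right,
      hG.inner_left_eq_inner_right]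
  have h1 := enorm_apply_sq_le hsym ψ.basis z
  have h2 : ‖z‖ₑ = 1 := by rw [← ofReal_norm, hz, ENNReal.ofReal_one]
  -- In the mixed matrix elements, `⟪φⱼ, (D - G) ψₖ⟫ = (dⱼ - gₖ) ⟪φⱼ, ψₖ⟫`, so the Hilbert-Schmidt
  -- norm is compared with the relative entropy term by term.
  have h3 : ∑' k, ‖(D - G) (ψ.basis k)‖ₑ ^ 2 ≤ 4 * entSum φ.basis φ.val ψ.basis ψ.val := by
    unfold entSum
    rw [ENNReal.tsum_comm, ← ENNReal.tsum_mul_left]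
    refine ENNReal.tsum_le_tsum fun k => ?_
    rw [← tsum_enorm_inner_sq φ.basis, ← ENNReal.tsum_mul_left]
    refine ENNReal.tsum_le_tsum fun j => ?_
    have e : ⟪φ.basis j, (D - G) (ψ.basis k)⟫_ℂ =
        ((φ.val j - ψ.val k : ℝ) : ℂ) * ⟪φ.basis j, ψ.basis k⟫_ℂ := by
      rw [sub_apply, inner_sub_right, φ.inner_apply hD, ψ.apply_basis, inner_smul_right]
      push_cast
      ring
    by_cases hw : ⟪φ.basis j, ψ.basis k⟫_ℂ = 0
    · rw [e, hw]
      simp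
    rw [e, enorm_mul, mul_pow, mul_comm, mul_left_comm]
    refine mul_le_mul' le_rfl ?_
    have h4 : (4 : ℝ≥0∞) = ENNReal.ofReal 4 := by norm_num
    rw [enorm_sq_eq_ofReal, Complex.norm_real, Real.norm_eq_abs, sq_abs, h4,
      ← ENNReal.ofReal_mul (by norm_num)]
    refine ENNReal.ofReal_le_ofReal ?_
    rcases (ψ.val_nonneg hG k).eq_or_lt with h0 | h0
    · have hdj := (hc j k h0.symm).resolve_right hw
      simp [← h0, hdj, relTerm_zero]
    · have := sq_sub_le_relTerm (φ.val_nonneg hD j) (φ.val_le hD hD1 j) h0 (ψ.val_le hG hG1 k)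
      linarith
  rw [h2, one_pow, mul_one] at h1
  have h5 : ENNReal.ofReal (((qf D z).toReal - (qf G z).toReal) ^ 2) ≤ ‖(D - G) z‖ₑ ^ 2 := by
    rw [enorm_sq_eq_ofReal]
    refine ENNReal.ofReal_le_ofReal ?_
    have e : (qf D z).toReal - (qf G z).toReal = (⟪z, (D - G) z⟫_ℂ).re := by
      rw [qf, qf, ENNReal.toReal_ofReal (re_inner_nonneg hD z),
        ENNReal.toReal_ofReal (re_inner_nonneg hG z), sub_apply, inner_sub_right, Complex.sub_re]
    rw [e, ← sq_abs]
    gcongr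
    calc |(⟪z, (D - G) z⟫_ℂ).re| ≤ ‖⟪z, (D - G) z⟫_ℂ‖ := Complex.abs_re_le_norm _
      _ ≤ ‖z‖ * ‖(D - G) z‖ := norm_inner_le_norm _ _
      _ = ‖(D - G) z‖ := by rw [hz, one_mul]
  rw [ENNReal.ofReal_div_of_pos (by norm_num)]
  refine ENNReal.div_le_of_le_mul ?_
  rw [mul_comm]
  simpa using h5.trans (h1.trans h3)

end HilbertSchmidt

/-! ### Products of operators, truncation and passage to the limit. -/

section Tensor

variable {E₁ E₂ E : Type u} [NormedAddCommGroup E₁] [InnerProductSpace ℂ E₁] [CompleteSpace E₁]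
  [NormedAddCommGroup E₂] [InnerProductSpace ℂ E₂] [CompleteSpace E₂]
  [NormedAddCommGroup E] [InnerProductSpace ℂ E] [CompleteSpace E]
  {m : E₁ →L[ℂ] E₂ →L[ℂ] E}

/-- Exhibits the form of the partial trace as a series of nonnegative terms over the eigenvectors of
`D`; truncating `D` amounts to taking a partial sum. -/
theorem qf_ptrace_eq_tsum (hm : IsHilbertTensor m) {D : E →L[ℂ] E} (hD : D.IsPositive)
    (ht : posTrace D ≠ ∞) (φ : Eigenbasis D) (x : E₁) :
    qf (ptrace m D) x = ∑' j, ENNReal.ofReal (φ.val j) *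
      ∑' k, ‖⟪φ.basis j, m x (stdBasis E₂ k)⟫_ℂ‖ₑ ^ 2 := by
  rw [qf_ptrace hm hD ht (stdBasis E₂)]
  simp_rw [φ.qf_eq hD, ← ENNReal.tsum_mul_left]
  exact ENNReal.tsum_comm

theorem summable_val {E : Type u} [NormedAddCommGroup E] [InnerProductSpace ℂ E] [CompleteSpace E]
    {D : E →L[ℂ] E} (hD : D.IsPositive) (ht : posTrace D ≠ ∞)
    (φ : Eigenbasis D) : Summable φ.val := by
  rw [← φ.tsum_val hD] at ht
  have h := ENNReal.summable_toReal ht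
  simpa only [ENNReal.toReal_ofReal (φ.val_nonneg hD _)] using h

/-- The tensor product of two positive operators of finite trace, given eigenbases. -/
def tensorOp (hm : IsHilbertTensor m) {A : E₁ →L[ℂ] E₁} {B : E₂ →L[ℂ] E₂} (α : Eigenbasis A)
    (β : Eigenbasis B) : E →L[ℂ] E :=
  diagOp (hm.basis α.basis β.basis) fun p => α.val p.1 * β.val p.2

section TensorOp

variable (hm : IsHilbertTensor m) {A : E₁ →L[ℂ] E₁} {B : E₂ →L[ℂ] E₂} (hA : A.IsPositive)
  (hB : B.IsPositive) (hAt : posTrace A ≠ ∞) (hBt : posTrace B ≠ ∞) (α : Eigenbasis A)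
  (β : Eigenbasis B)

include hA hB hAt hBt in
theorem summable_val_mul : Summable fun p : α.index × β.index => α.val p.1 * β.val p.2 :=
  (summable_val hA hAt α).mul_of_nonneg (summable_val hB hBt β) (α.val_nonneg hA)
    (β.val_nonneg hB)

include hA hB in
theorem tensorOp_nonneg (p : α.index × β.index) : 0 ≤ α.val p.1 * β.val p.2 :=
  mul_nonneg (α.val_nonneg hA _) (β.val_nonneg hB _)

/-- The product eigenbasis. -/
def tensorEigenbasis : Eigenbasis (tensorOp hm α β) :=
  diagEigenbasis (hm.basis α.basis β.basis) (summable_val_mul hA hB hAt hBt α β)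

include hA hB hAt hBt in
theorem tensorOp_isPositive : (tensorOp hm α β).IsPositive :=
  diagOp_isPositive _ (summable_val_mul hA hB hAt hBt α β) (tensorOp_nonneg hA hB α β)

include hA hB hAt hBt in
theorem posTrace_tensorOp : posTrace (tensorOp hm α β) = posTrace A * posTrace B := by
  rw [tensorOp, posTrace_diagOp _ (summable_val_mul hA hB hAt hBt α β)
    (tensorOp_nonneg hA hB α β), tsum_ofReal_mul _ _ (α.val_nonneg hA), α.tsum_val hA,
    β.tsum_val hB]

include hA hB hAt hBt in
theorem qf_tensorOp (x : E₁) (y : E₂) : qf (tensorOp hm α β) (m x y) = qf A x * qf B y := by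
  rw [tensorOp, qf_diagOp _ (summable_val_mul hA hB hAt hBt α β) (tensorOp_nonneg hA hB α β),
    α.qf_eq hA, β.qf_eq hB, ENNReal.tsum_prod', ← ENNReal.tsum_mul_right]
  refine tsum_congr fun i => ?_
  rw [← ENNReal.tsum_mul_left]
  refine tsum_congr fun k => ?_
  rw [hm.basis_apply, hm.inner_eq, ENNReal.ofReal_mul (α.val_nonneg hA i), enorm_mul]
  ring

include hA hB hAt hBt in
-- Checked on eigenvectors and extended in one factor at a time; so `tensorOp` does not depend on
-- the eigenbases.
theorem tensorOp_apply (x : E₁) (y : E₂) : tensorOp hm α β (m x y) = m (A x) (B y) := by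
  have h1 : ∀ i, (tensorOp hm α β) ∘L m (α.basis i) = m (A (α.basis i)) ∘L B := fun i =>
    eq_of_forall_basis β.basis fun k => by
      have h := diagOp_apply_basis (hm.basis α.basis β.basis)
        (summable_val_mul hA hB hAt hBt α β) (i, k)
      rw [hm.basis_apply] at h
      simp only [ContinuousLinearMap.comp_apply, α.apply_basis, β.apply_basis, map_smul]
      rw [tensorOp, h, smul_apply, smul_smul]
      push_cast
      rw [mul_comm]
  have h2 : (tensorOp hm α β) ∘L m.flip y = m.flip (B y) ∘L A :=
    eq_of_forall_basis α.basis fun i => DFunLike.congr_fun (h1 i) y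
  exact DFunLike.congr_fun h2 x

end TensorOp

/-- Lower semicontinuity only controls numbers strictly below `a` and `b`. The alternative `a' = 0`
is for `a = 0`, below which there is nothing. -/
theorem ENNReal_add_le_of_forall_lt {a b k v : ℝ≥0∞} (hv : v ≠ ∞)
    (h : ∀ a' b', (a' < a ∨ a' = 0) → (b' < b ∨ b' = 0) → a' + b' + k ≤ v) : a + b + k ≤ v := by
  have step : ∀ {a k : ℝ≥0∞}, (∀ a', (a' < a ∨ a' = 0) → a' + k ≤ v) → a + k ≤ v := by
    intro a k h
    have hk : k ≤ v := by simpa using h 0 (Or.inr rfl)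
    have h1 : a ≤ v - k := le_of_forall_lt_imp_le_of_dense fun c hc =>
      ENNReal.le_sub_of_add_le_right (ne_top_of_le_ne_top hv hk) (h c (Or.inl hc))
    calc a + k ≤ v - k + k := by gcongr
      _ = v := tsub_add_cancel_of_le hk
  rw [add_assoc]
  refine step fun a' ha' => ?_
  rw [add_left_comm]
  refine step fun b' hb' => ?_
  rw [add_left_comm, ← add_assoc]
  exact h a' b' ha' hb'

/-- Superadditivity of the relative entropy, with a remainder that detects correlations. -/
theorem entSum_superadditive (hm : IsHilbertTensor m) {D : E →L[ℂ] E} (hD : D.IsPositive)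
    (ht : posTrace D = 1) (φ : Eigenbasis D)
    {ι κ : Type*} (ψ : HilbertBasis ι ℂ E₁) (χ : HilbertBasis κ ℂ E₂)
    {g : ι → ℝ} {h : κ → ℝ} (hg0 : ∀ i, 0 ≤ g i) (hh0 : ∀ i, 0 ≤ h i)
    (hg : ∑' i, ENNReal.ofReal (g i) = 1) (hh : ∑' k, ENNReal.ofReal (h k) = 1)
    (hc : KerCompat φ.basis φ.val (hm.basis ψ χ) fun p => g p.1 * h p.2)
    (α : Eigenbasis (ptrace m D)) (β : Eigenbasis (ptrace m.flip D))
    {x : E₁} {y : E₂} (hx : ‖x‖ = 1) (hy : ‖y‖ = 1) :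
    entSum α.basis α.val ψ g + entSum β.basis β.val χ h +
        ENNReal.ofReal (((qf D (m x y)).toReal -
          (qf (ptrace m D) x).toReal * (qf (ptrace m.flip D) y).toReal) ^ 2 / 4) ≤
      entSum φ.basis φ.val (hm.basis ψ χ) fun p => g p.1 * h p.2 := by
  classical
  set V := entSum φ.basis φ.val (hm.basis ψ χ) fun p => g p.1 * h p.2 with hV
  by_cases hVt : V = ∞
  · rw [hVt]
    exact le_top
  have ht' : posTrace D ≠ ∞ := by rw [ht]; exact ENNReal.one_ne_top
  have hφ0 := φ.val_nonneg hD
  -- spectral truncations of `D` and their partial traces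
  let d : Finset φ.index → φ.index → ℝ := fun J j => if j ∈ J then φ.val j else 0
  have hd0 : ∀ J j, 0 ≤ d J j := fun J j => by
    simp only [d]
    split_ifs
    exacts [hφ0 j, le_rfl]
  have hds : ∀ J, Summable (d J) := fun J =>
    summable_of_ne_finset_zero (s := J) fun j hj => if_neg hj
  let DJ : Finset φ.index → E →L[ℂ] E := fun J => diagOp φ.basis (d J)
  let φJ : ∀ J, Eigenbasis (DJ J) := fun J => diagEigenbasis φ.basis (hds J)
  have hDJ : ∀ J, (DJ J).IsPositive := fun J => diagOp_isPositive _ (hds J) (hd0 J)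
  have htsum : ∀ (J : Finset φ.index) (w : φ.index → ℝ≥0∞),
      ∑' j, ENNReal.ofReal (d J j) * w j = ∑ j ∈ J, ENNReal.ofReal (φ.val j) * w j := by
    intro J w
    rw [tsum_eq_sum (s := J) fun j hj => by simp [d, hj]]
    exact Finset.sum_congr rfl fun j hj => by simp [d, hj]
  have htJ : ∀ J, posTrace (DJ J) = ∑ j ∈ J, ENNReal.ofReal (φ.val j) := fun J => by
    rw [posTrace_diagOp _ (hds J) (hd0 J)]
    simpa using htsum J 1
  have htJ1 : ∀ J, posTrace (DJ J) ≤ 1 := fun J => by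
    rw [htJ, ← ht, ← φ.tsum_val hD]
    exact ENNReal.sum_le_tsum J
  have htJ' : ∀ J, posTrace (DJ J) ≠ ∞ := fun J => ne_top_of_le_ne_top ENNReal.one_ne_top (htJ1 J)
  have htlim : Filter.Tendsto (fun J => posTrace (DJ J)) Filter.atTop (nhds 1) := by
    simp_rw [htJ, ← ht, ← φ.tsum_val hD]
    exact ENNReal.summable.hasSum
  have hqJ : ∀ J z, qf (DJ J) z =
      ∑ j ∈ J, ENNReal.ofReal (φ.val j) * ‖⟪φ.basis j, z⟫_ℂ‖ₑ ^ 2 := fun J z => by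
    rw [(φJ J).qf_eq (hDJ J)]
    exact htsum J _
  have hqlim : ∀ z, Filter.Tendsto (fun J => qf (DJ J) z) Filter.atTop (nhds (qf D z)) := by
    intro z
    simp_rw [hqJ, φ.qf_eq hD]
    exact ENNReal.summable.hasSum
  have hq1J : ∀ J a, qf (ptrace m (DJ J)) a = ∑ j ∈ J, ENNReal.ofReal (φ.val j) *
      ∑' k, ‖⟪φ.basis j, m a (stdBasis E₂ k)⟫_ℂ‖ₑ ^ 2 := fun J a => by
    rw [qf_ptrace_eq_tsum hm (hDJ J) (htJ' J) (φJ J)]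
    exact htsum J _
  have hq1lim : ∀ a, Filter.Tendsto (fun J => qf (ptrace m (DJ J)) a) Filter.atTop
      (nhds (qf (ptrace m D) a)) := by
    intro a
    simp_rw [hq1J, qf_ptrace_eq_tsum hm hD ht' φ]
    exact ENNReal.summable.hasSum
  have hq1le : ∀ J a, qf (ptrace m (DJ J)) a ≤ qf (ptrace m D) a := fun J a => by
    rw [hq1J, qf_ptrace_eq_tsum hm hD ht' φ]
    exact ENNReal.sum_le_tsum J
  have hq2J : ∀ J a, qf (ptrace m.flip (DJ J)) a = ∑ j ∈ J, ENNReal.ofReal (φ.val j) *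
      ∑' k, ‖⟪φ.basis j, m.flip a (stdBasis E₁ k)⟫_ℂ‖ₑ ^ 2 := fun J a => by
    rw [qf_ptrace_eq_tsum hm.flip (hDJ J) (htJ' J) (φJ J)]
    exact htsum J _
  have hq2lim : ∀ a, Filter.Tendsto (fun J => qf (ptrace m.flip (DJ J)) a) Filter.atTop
      (nhds (qf (ptrace m.flip D) a)) := by
    intro a
    simp_rw [hq2J, qf_ptrace_eq_tsum hm.flip hD ht' φ]
    exact ENNReal.summable.hasSum
  have hq2le : ∀ J a, qf (ptrace m.flip (DJ J)) a ≤ qf (ptrace m.flip D) a := fun J a => by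
    rw [hq2J, qf_ptrace_eq_tsum hm.flip hD ht' φ]
    exact ENNReal.sum_le_tsum J
  have hP₁ := ptrace_isPositive hm hD ht'
  have hP₂ := ptrace_isPositive hm.flip hD ht'
  have hP₁J := fun J => ptrace_isPositive hm (hDJ J) (htJ' J)
  have hP₂J := fun J => ptrace_isPositive hm.flip (hDJ J) (htJ' J)
  have ht₁ := posTrace_ptrace hm hD ht'
  have ht₂ := posTrace_ptrace hm.flip hD ht'
  have ht₁J := fun J => posTrace_ptrace hm (hDJ J) (htJ' J)
  have ht₂J := fun J => posTrace_ptrace hm.flip (hDJ J) (htJ' J)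
  have ht₁J' := fun J => (ht₁J J).trans_ne (htJ' J)
  have ht₂J' := fun J => (ht₂J J).trans_ne (htJ' J)
  let αJ : ∀ J, Eigenbasis (ptrace m (DJ J)) := fun J =>
    (nonempty_eigenbasis (hP₁J J) (ht₁J' J)).some
  let βJ : ∀ J, Eigenbasis (ptrace m.flip (DJ J)) := fun J =>
    (nonempty_eigenbasis (hP₂J J) (ht₂J' J)).some
  -- kernels
  have hcJ : ∀ J, KerCompat (φJ J).basis (φJ J).val (hm.basis ψ χ) fun p => g p.1 * h p.2 := by
    intro J j p hp
    refine (hc j p hp).imp_left fun h0 => ?_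
    change d J j = 0
    simp [d, h0]
  have hq0 : ∀ i k, g i * h k = 0 → qf D (m (ψ i) (χ k)) = 0 := fun i k hik => by
    rw [← hm.basis_apply ψ χ (i, k)]
    exact hc.qf_eq_zero hD _ hik
  have hc₁ : KerCompat α.basis α.val ψ g := kerCompat_of_qf hP₁ α ψ g fun k hk => by
    rw [qf_ptrace hm hD ht' χ, ENNReal.tsum_eq_zero]
    exact fun l => hq0 k l (by rw [hk, zero_mul])
  have hc₂ : KerCompat β.basis β.val χ h := kerCompat_of_qf hP₂ β χ h fun k hk => by
    rw [qf_ptrace_flip hm hD ht' ψ, ENNReal.tsum_eq_zero]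
    exact fun l => hq0 l k (by rw [hk, mul_zero])
  -- the remainder coming from the truncation of `D`
  let ρ : φ.index → ℝ≥0∞ := fun j => ∑' p : ι × κ, ‖⟪φ.basis j, hm.basis ψ χ p⟫_ℂ‖ₑ ^ 2 *
    ENNReal.ofReal (g p.1 * h p.2)
  have hρ : ∑' j, ρ j = 1 := by
    rw [tsum_tsum_right φ.basis (hm.basis ψ χ) (fun p => ENNReal.ofReal (g p.1 * h p.2)),
      tsum_ofReal_mul g h hg0, hg, hh, one_mul]
  let r : Finset φ.index → ℝ≥0∞ := fun J => ∑' j : {j // j ∉ J}, ρ j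
  have hr : Filter.Tendsto r Filter.atTop (nhds 0) :=
    ENNReal.tendsto_tsum_compl_atTop_zero (by rw [hρ]; exact ENNReal.one_ne_top)
  -- A discarded row has `d = 0` and `relTerm 0 g = g`, so it contributes `ρ j`; the rows in `J` are
  -- unchanged.
  have hVJ : ∀ J, entSum (φJ J).basis (φJ J).val (hm.basis ψ χ) (fun p => g p.1 * h p.2) ≤
      V + r J := by
    intro J
    have e : r J = ∑' j, if j ∈ J then 0 else ρ j := by
      rw [show r J = ∑' j : ({j | j ∉ J} : Set φ.index), ρ j from rfl, tsum_subtype]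
      refine tsum_congr fun j => ?_
      by_cases hj : j ∈ J <;> simp [Set.indicator, hj]
    rw [e, hV]
    unfold entSum
    rw [← ENNReal.tsum_add]
    refine ENNReal.tsum_le_tsum fun (j : φ.index) => ?_
    change ∑' p : ι × κ, ‖⟪φ.basis j, hm.basis ψ χ p⟫_ℂ‖ₑ ^ 2 *
      ENNReal.ofReal (relTerm (d J j) (g p.1 * h p.2)) ≤ _
    by_cases hj : j ∈ J
    · simp only [d, if_pos hj, add_zero]
      exact le_rfl
    · simp only [d, if_neg hj, relTerm_zero]
      exact le_add_self
  -- Finite rank makes the entropy finite, as the chain rule requires.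
  have hHJ : ∀ J, ∑' j, ENNReal.ofReal (Real.negMulLog ((φJ J).val j)) ≠ ∞ := fun J => by
    have : ∑' j, ENNReal.ofReal (Real.negMulLog (d J j)) ≠ ∞ := by
      rw [tsum_eq_sum (s := J) fun j hj => by simp [d, hj]]
      exact ENNReal.sum_ne_top.2 fun _ _ => ENNReal.ofReal_ne_top
    exact this
  -- the inequality for the truncations
  let ℓ : Finset φ.index → ℝ≥0∞ := fun J => ENNReal.ofReal (((qf (DJ J) (m x y)).toReal -
      (qf (ptrace m (DJ J)) x).toReal * (qf (ptrace m.flip (DJ J)) y).toReal) ^ 2 / 4)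
  have hineq : ∀ J, entSum (αJ J).basis (αJ J).val ψ g + entSum (βJ J).basis (βJ J).val χ h +
      ℓ J + 2 * posTrace (DJ J) ≤ V + r J + 1 + posTrace (DJ J) ^ 2 := by
    intro J
    by_cases hrt : r J = ∞
    · simp [hrt]
    have h1 := entSum_tensor hm (hDJ J) (htJ1 J) (φJ J) (hHJ J) ψ χ hg0 hh0 hg hh (hcJ J)
      (ne_top_of_le_ne_top (ENNReal.add_ne_top.2 ⟨hVt, hrt⟩) (hVJ J)) (αJ J) (βJ J)
    -- The third term of the chain rule is bounded below at the single vector `m x y`, where the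
    -- form of the product of the partial traces factorizes.
    have hX := sq_le_entSum (hDJ J)
      (tensorOp_isPositive hm (hP₁J J) (hP₂J J) (ht₁J' J) (ht₂J' J) (αJ J) (βJ J)) (htJ1 J)
      (by
        rw [posTrace_tensorOp hm (hP₁J J) (hP₂J J) (ht₁J' J) (ht₂J' J), ht₁J, ht₂J]
        exact mul_le_one' (htJ1 J) (htJ1 J))
      (φJ J) (tensorEigenbasis hm (hP₁J J) (hP₂J J) (ht₁J' J) (ht₂J' J) (αJ J) (βJ J))
      (kerCompat_of_qf (hDJ J) (φJ J) _ _ fun (p : (αJ J).index × (βJ J).index) hp => by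
        change (αJ J).val p.1 * (βJ J).val p.2 = 0 at hp
        change qf (DJ J) (hm.basis (αJ J).basis (βJ J).basis p) = 0
        rw [hm.basis_apply]
        rcases mul_eq_zero.1 hp with h0 | h0
        · have h1 := (αJ J).qf_basis p.1
          rw [h0, ENNReal.ofReal_zero, qf_ptrace hm (hDJ J) (htJ' J) (βJ J).basis,
            ENNReal.tsum_eq_zero] at h1
          exact h1 p.2
        · have h1 := (βJ J).qf_basis p.2
          rw [h0, ENNReal.ofReal_zero, qf_ptrace_flip hm (hDJ J) (htJ' J) (αJ J).basis,
            ENNReal.tsum_eq_zero] at h1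
          exact h1 p.1)
      (z := m x y) (by rw [hm.norm_eq, hx, hy, one_mul])
    rw [qf_tensorOp hm (hP₁J J) (hP₂J J) (ht₁J' J) (ht₂J' J), ENNReal.toReal_mul] at hX
    calc _ ≤ _ := by gcongr; exact hX
      _ = _ := h1
      _ ≤ _ := by gcongr; exact hVJ J
  -- passage to the limit
  refine ENNReal_add_le_of_forall_lt hVt fun a b ha hb => ?_
  have hfin1 : posTrace (ptrace m D) ≠ ∞ := ht₁.trans_ne ht'
  have hfin2 : posTrace (ptrace m.flip D) ≠ ∞ := ht₂.trans_ne ht'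
  have ha' : ∀ᶠ J in Filter.atTop, a ≤ entSum (αJ J).basis (αJ J).val ψ g := by
    rcases ha with ha | rfl
    · exact (eventually_lt_entSum hP₁ hfin1 α hP₁J αJ hq1le hq1lim ψ hg0
        (by rw [hg]; exact ENNReal.one_ne_top) hc₁ ha).mono fun _ h => h.le
    · simp
  have hb' : ∀ᶠ J in Filter.atTop, b ≤ entSum (βJ J).basis (βJ J).val χ h := by
    rcases hb with hb | rfl
    · exact (eventually_lt_entSum hP₂ hfin2 β hP₂J βJ hq2le hq2lim χ hh0
        (by rw [hh]; exact ENNReal.one_ne_top) hc₂ hb).mono fun _ h => h.le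
    · simp
  have hℓ : Filter.Tendsto ℓ Filter.atTop (nhds (ENNReal.ofReal (((qf D (m x y)).toReal -
      (qf (ptrace m D) x).toReal * (qf (ptrace m.flip D) y).toReal) ^ 2 / 4))) := by
    have l0 := (ENNReal.tendsto_toReal (qf_ne_top D (m x y))).comp (hqlim (m x y))
    have l1 := (ENNReal.tendsto_toReal (qf_ne_top (ptrace m D) x)).comp (hq1lim x)
    have l2 := (ENNReal.tendsto_toReal (qf_ne_top (ptrace m.flip D) y)).comp (hq2lim y)
    exact ENNReal.tendsto_ofReal (((l0.sub (l1.mul l2)).pow 2).div_const 4)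
  have hL : Filter.Tendsto (fun J => a + b + ℓ J + 2 * posTrace (DJ J)) Filter.atTop
      (nhds (a + b + ENNReal.ofReal (((qf D (m x y)).toReal -
      (qf (ptrace m D) x).toReal * (qf (ptrace m.flip D) y).toReal) ^ 2 / 4) + 2 * 1)) :=
    (hℓ.const_add _).add (ENNReal.Tendsto.const_mul htlim (Or.inl one_ne_zero))
  have hR : Filter.Tendsto (fun J => V + r J + 1 + posTrace (DJ J) ^ 2) Filter.atTop
      (nhds (V + 0 + 1 + 1 ^ 2)) :=
    ((hr.const_add V).add_const 1).add (((ENNReal.continuous_pow 2).tendsto 1).comp htlim)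
  have hle := le_of_tendsto_of_tendsto hL hR (by
    filter_upwards [ha', hb'] with J h1 h2
    exact le_trans (by gcongr) (hineq J))
  -- As the traces tend to `1`, the corrections `2 t` and `1 + t²` both tend to `2` and cancel.
  have e2 : V + 0 + 1 + 1 ^ 2 = V + 2 * 1 := by
    rw [add_zero, add_assoc]
    norm_num
  rw [e2] at hle
  exact ENNReal.le_of_add_le_add_right (by norm_num) hle

/-- Additivity of the relative entropy on products. -/
theorem entSum_prod (hm : IsHilbertTensor m) {ι₁ ι₂ κ₁ κ₂ : Type*} (α : HilbertBasis ι₁ ℂ E₁)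
    (β : HilbertBasis ι₂ ℂ E₂) (ψ : HilbertBasis κ₁ ℂ E₁) (χ : HilbertBasis κ₂ ℂ E₂)
    {u : ι₁ → ℝ} {v : ι₂ → ℝ} {g : κ₁ → ℝ} {h : κ₂ → ℝ} (hu0 : ∀ i, 0 ≤ u i) (hv0 : ∀ i, 0 ≤ v i)
    (hg0 : ∀ i, 0 ≤ g i) (hh0 : ∀ i, 0 ≤ h i)
    (hu : ∑' i, ENNReal.ofReal (u i) = 1) (hv : ∑' k, ENNReal.ofReal (v k) = 1)
    (hg : ∑' i, ENNReal.ofReal (g i) = 1) (hh : ∑' k, ENNReal.ofReal (h k) = 1)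
    (hc₁ : KerCompat α u ψ g) (hc₂ : KerCompat β v χ h) :
    entSum (hm.basis α β) (fun p => u p.1 * v p.2) (hm.basis ψ χ) (fun p => g p.1 * h p.2) =
      entSum α u ψ g + entSum β v χ h := by
  -- The identity `relTerm (u v) (g h) = relTerm u g * v + u * relTerm v h + (g - u) * (h - v)`,
  -- weighted and cleared of subtractions. As all masses are `1`, the last product sums to zero.
  have key : ∀ i j k l, ‖⟪α i, ψ k⟫_ℂ‖ₑ ^ 2 * ‖⟪β j, χ l⟫_ℂ‖ₑ ^ 2 *
        ENNReal.ofReal (relTerm (u i * v j) (g k * h l)) +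
      ‖⟪α i, ψ k⟫_ℂ‖ₑ ^ 2 * ENNReal.ofReal (g k) *
        (‖⟪β j, χ l⟫_ℂ‖ₑ ^ 2 * ENNReal.ofReal (v j)) +
      ‖⟪α i, ψ k⟫_ℂ‖ₑ ^ 2 * ENNReal.ofReal (u i) *
        (‖⟪β j, χ l⟫_ℂ‖ₑ ^ 2 * ENNReal.ofReal (h l)) =
      ‖⟪α i, ψ k⟫_ℂ‖ₑ ^ 2 * ENNReal.ofReal (relTerm (u i) (g k)) *
        (‖⟪β j, χ l⟫_ℂ‖ₑ ^ 2 * ENNReal.ofReal (v j)) +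
      ‖⟪α i, ψ k⟫_ℂ‖ₑ ^ 2 * ENNReal.ofReal (u i) *
        (‖⟪β j, χ l⟫_ℂ‖ₑ ^ 2 * ENNReal.ofReal (relTerm (v j) (h l))) +
      ‖⟪α i, ψ k⟫_ℂ‖ₑ ^ 2 * ENNReal.ofReal (g k) *
        (‖⟪β j, χ l⟫_ℂ‖ₑ ^ 2 * ENNReal.ofReal (h l)) +
      ‖⟪α i, ψ k⟫_ℂ‖ₑ ^ 2 * ENNReal.ofReal (u i) *
        (‖⟪β j, χ l⟫_ℂ‖ₑ ^ 2 * ENNReal.ofReal (v j)) := by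
    intro i j k l
    by_cases hw : ⟪α i, ψ k⟫_ℂ = 0
    · simp [hw]
    by_cases hw' : ⟪β j, χ l⟫_ℂ = 0
    · simp [hw']
    suffices h : ENNReal.ofReal (relTerm (u i * v j) (g k * h l)) +
        ENNReal.ofReal (g k) * ENNReal.ofReal (v j) + ENNReal.ofReal (u i) * ENNReal.ofReal (h l) =
        ENNReal.ofReal (relTerm (u i) (g k)) * ENNReal.ofReal (v j) +
        ENNReal.ofReal (u i) * ENNReal.ofReal (relTerm (v j) (h l)) +
        ENNReal.ofReal (g k) * ENNReal.ofReal (h l) + ENNReal.ofReal (u i) * ENNReal.ofReal (v j) by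
      have h' := congr_arg (‖⟪α i, ψ k⟫_ℂ‖ₑ ^ 2 * ‖⟪β j, χ l⟫_ℂ‖ₑ ^ 2 * ·) h
      simp only [mul_add] at h'
      convert h' using 1 <;> ring
    have hu := hu0 i
    have hv := hv0 j
    rcases (hg0 k).eq_or_lt with h0 | h0
    · simp [← h0, (hc₁ i k h0.symm).resolve_right hw, relTerm_zero]
    rcases (hh0 l).eq_or_lt with h1 | h1
    · simp [← h1, (hc₂ j l h1.symm).resolve_right hw', relTerm_zero]
    have r0 : 0 ≤ relTerm (u i * v j) (g k * h l) := relTerm_nonneg (by positivity) (by positivity)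
    have r1 := relTerm_nonneg hu h0
    have r2 := relTerm_nonneg hv h1
    rw [← ENNReal.ofReal_mul h0.le, ← ENNReal.ofReal_mul hu, ← ENNReal.ofReal_mul r1,
      ← ENNReal.ofReal_mul hu, ← ENNReal.ofReal_mul h0.le, ← ENNReal.ofReal_mul hu,
      ← ENNReal.ofReal_add r0 (by positivity), ← ENNReal.ofReal_add (by positivity) (by positivity),
      ← ENNReal.ofReal_add (by positivity) (by positivity),
      ← ENNReal.ofReal_add (by positivity) (by positivity),
      ← ENNReal.ofReal_add (by positivity) (by positivity)]
    congr 1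
    unfold relTerm
    rw [Real.log_mul h0.ne' h1.ne']
    rcases hu.eq_or_lt with h2 | h2
    · rw [← h2]
      ring
    rcases hv.eq_or_lt with h3 | h3
    · rw [← h3]
      ring
    rw [Real.log_mul h2.ne' h3.ne']
    ring
  have four : ∀ (a : ι₁ → κ₁ → ℝ≥0∞) (b : ι₂ → κ₂ → ℝ≥0∞),
      ∑' (p : ι₁ × ι₂) (q : κ₁ × κ₂), a p.1 q.1 * b p.2 q.2 =
        (∑' (i) (k), a i k) * ∑' (j) (l), b j l := by
    intro a b
    rw [ENNReal.tsum_prod', ← ENNReal.tsum_mul_right]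
    refine tsum_congr fun i => ?_
    rw [← ENNReal.tsum_mul_left]
    refine tsum_congr fun j => ?_
    rw [ENNReal.tsum_prod', ← ENNReal.tsum_mul_right]
    exact tsum_congr fun k => by simp only [ENNReal.tsum_mul_left]
  have hsum := tsum_congr (L := .unconditional _) fun p : ι₁ × ι₂ =>
    tsum_congr (L := .unconditional _) fun q : κ₁ × κ₂ => key p.1 p.2 q.1 q.2
  simp only [ENNReal.tsum_add] at hsum
  rw [four (fun i k => ‖⟪α i, ψ k⟫_ℂ‖ₑ ^ 2 * ENNReal.ofReal (g k))
      (fun j l => ‖⟪β j, χ l⟫_ℂ‖ₑ ^ 2 * ENNReal.ofReal (v j)),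
    four (fun i k => ‖⟪α i, ψ k⟫_ℂ‖ₑ ^ 2 * ENNReal.ofReal (u i))
      (fun j l => ‖⟪β j, χ l⟫_ℂ‖ₑ ^ 2 * ENNReal.ofReal (h l)),
    four (fun i k => ‖⟪α i, ψ k⟫_ℂ‖ₑ ^ 2 * ENNReal.ofReal (relTerm (u i) (g k)))
      (fun j l => ‖⟪β j, χ l⟫_ℂ‖ₑ ^ 2 * ENNReal.ofReal (v j)),
    four (fun i k => ‖⟪α i, ψ k⟫_ℂ‖ₑ ^ 2 * ENNReal.ofReal (u i))
      (fun j l => ‖⟪β j, χ l⟫_ℂ‖ₑ ^ 2 * ENNReal.ofReal (relTerm (v j) (h l))),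
    four (fun i k => ‖⟪α i, ψ k⟫_ℂ‖ₑ ^ 2 * ENNReal.ofReal (g k))
      (fun j l => ‖⟪β j, χ l⟫_ℂ‖ₑ ^ 2 * ENNReal.ofReal (h l)),
    four (fun i k => ‖⟪α i, ψ k⟫_ℂ‖ₑ ^ 2 * ENNReal.ofReal (u i))
      (fun j l => ‖⟪β j, χ l⟫_ℂ‖ₑ ^ 2 * ENNReal.ofReal (v j)),
    tsum_tsum_right α ψ (fun k => ENNReal.ofReal (g k)),
    tsum_tsum_right β χ (fun k => ENNReal.ofReal (h k)),
    tsum_tsum_left α ψ (fun k => ENNReal.ofReal (u k)),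
    tsum_tsum_left β χ (fun k => ENNReal.ofReal (v k)), hu, hv, hg, hh] at hsum
  simp only [mul_one, one_mul, add_assoc] at hsum
  simp only [← add_assoc] at hsum
  rw [add_assoc, add_assoc _ (1 : ℝ≥0∞) 1] at hsum
  rw [ENNReal.add_left_inj (by norm_num)] at hsum
  unfold entSum
  rw [← hsum]
  refine tsum_congr fun p => tsum_congr fun q => ?_
  rw [hm.basis_apply, hm.basis_apply, hm.inner_eq, enorm_mul, mul_pow]

end Tensor

/-! ### Relative entropy with respect to a product operator. -/

section Tensor

variable {E₁ E₂ E : Type u} [NormedAddCommGroup E₁] [InnerProductSpace ℂ E₁] [CompleteSpace E₁]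
  [NormedAddCommGroup E₂] [InnerProductSpace ℂ E₂] [CompleteSpace E₂]
  [NormedAddCommGroup E] [InnerProductSpace ℂ E] [CompleteSpace E]
  {m : E₁ →L[ℂ] E₂ →L[ℂ] E}

theorem apply_eq_zero_of_qf_eq_zero {D : E →L[ℂ] E} (hD : D.IsPositive) {x : E}
    (hx : qf D x = 0) : D x = 0 := by
  obtain ⟨S, hS, rfl⟩ := exists_sqrt hD
  rw [qf_comp_self hS] at hx
  have h : S x = 0 := by simpa using hx
  rw [ContinuousLinearMap.comp_apply, h, map_zero]

theorem qf_eq_zero_of_apply {D : E →L[ℂ] E} {x : E} (hx : D x = 0) : qf D x = 0 := by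
  simp [qf, hx]

/-- The product of eigenbases is an eigenbasis of a product. -/
def IsHilbertTensor.eigenbasis (hm : IsHilbertTensor m) {G : E →L[ℂ] E} {G₁ : E₁ →L[ℂ] E₁}
    {G₂ : E₂ →L[ℂ] E₂} (hG : ∀ x y, G (m x y) = m (G₁ x) (G₂ y)) (ψ : Eigenbasis G₁)
    (χ : Eigenbasis G₂) : Eigenbasis G where
  index := ψ.index × χ.index
  basis := hm.basis ψ.basis χ.basis
  val p := ψ.val p.1 * χ.val p.2
  apply_basis p := by
    rw [hm.basis_apply, hG, ψ.apply_basis, χ.apply_basis, map_smul, map_smul, smul_apply,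
      smul_smul]
    push_cast
    rw [mul_comm]

/-- Over `ℂ` an operator is determined by its quadratic form. Polarization is applied in the first
factor with `y` fixed, then in the second. -/
theorem IsHilbertTensor.eq_zero_of_forall (hm : IsHilbertTensor m) {T : E →L[ℂ] E}
    (h : ∀ x y, ⟪m x y, T (m x y)⟫_ℂ = 0) : T = 0 := by
  have zero_of : ∀ {F : Type u} [NormedAddCommGroup F] [InnerProductSpace ℂ F]
      (S : F →L[ℂ] F), (∀ x, ⟪x, S x⟫_ℂ = 0) → S = 0 := by
    intro F _ _ S hS
    have := (inner_map_self_eq_zero (S : F →ₗ[ℂ] F)).1 fun x => by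
      rw [← inner_conj_symm, ContinuousLinearMap.coe_coe, hS x, map_zero]
    ext x
    exact DFunLike.congr_fun this x
  have h1 : ∀ x x' y, ⟪m x y, T (m x' y)⟫_ℂ = 0 := fun x x' y => by
    have := zero_of ((m.flip y).adjoint ∘L T ∘L m.flip y) fun x => by
      simpa [ContinuousLinearMap.adjoint_inner_right] using h x y
    have h2 : ⟪x, ((m.flip y).adjoint ∘L T ∘L m.flip y) x'⟫_ℂ = 0 := by rw [this]; simp
    simpa [ContinuousLinearMap.adjoint_inner_right] using h2
  have h2 : ∀ x x' y y', ⟪m x y, T (m x' y')⟫_ℂ = 0 := fun x x' y y' => by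
    have := zero_of ((m x).adjoint ∘L T ∘L m x') fun y => by
      simpa [ContinuousLinearMap.adjoint_inner_right] using h1 x x' y
    have h2 : ⟪y, ((m x).adjoint ∘L T ∘L m x') y'⟫_ℂ = 0 := by rw [this]; simp
    simpa [ContinuousLinearMap.adjoint_inner_right] using h2
  refine eq_of_forall_basis (hm.basis (stdBasis E₁) (stdBasis E₂)) fun p => ?_
  rw [hm.basis_apply]
  exact hm.total _ fun a b => h2 _ _ _ _

/-- Relative entropy with respect to a product state: superadditivity and the case of
equality. -/
theorem relEntropy_tensor (hm : IsHilbertTensor m) {D : E →L[ℂ] E} (hD : D.IsPositive)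
    (ht : posTrace D = 1) {G : E →L[ℂ] E} {G₁ : E₁ →L[ℂ] E₁} {G₂ : E₂ →L[ℂ] E₂}
    (hG₁ : G₁.IsPositive) (hG₂ : G₂.IsPositive) (hg : posTrace G₁ = 1) (hh : posTrace G₂ = 1)
    (hG : ∀ x y, G (m x y) = m (G₁ x) (G₂ y)) :
    relEntropy (ptrace m D) G₁ + relEntropy (ptrace m.flip D) G₂ ≤ relEntropy D G ∧
      (relEntropy D G < ∞ →
        (relEntropy D G = relEntropy (ptrace m D) G₁ + relEntropy (ptrace m.flip D) G₂ ↔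
          ∀ x y, D (m x y) = m (ptrace m D x) (ptrace m.flip D y))) := by
  by_cases hker : ∀ v, G v = 0 → D v = 0
  swap
  · have : relEntropy D G = ∞ := by rw [relEntropy, if_neg hker]
    simp [this]
  have ht' : posTrace D ≠ ∞ := by rw [ht]; exact ENNReal.one_ne_top
  have hP₁ := ptrace_isPositive hm hD ht'
  have hP₂ := ptrace_isPositive hm.flip hD ht'
  have ht₁ := (posTrace_ptrace hm hD ht').trans ht
  have ht₂ := (posTrace_ptrace hm.flip hD ht').trans ht
  have ht₁' : posTrace (ptrace m D) ≠ ∞ := by rw [ht₁]; exact ENNReal.one_ne_top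
  have ht₂' : posTrace (ptrace m.flip D) ≠ ∞ := by rw [ht₂]; exact ENNReal.one_ne_top
  obtain ⟨φ⟩ := nonempty_eigenbasis hD ht'
  obtain ⟨α⟩ := nonempty_eigenbasis hP₁ ht₁'
  obtain ⟨β⟩ := nonempty_eigenbasis hP₂ ht₂'
  obtain ⟨ψ⟩ := nonempty_eigenbasis hG₁ (by rw [hg]; exact ENNReal.one_ne_top)
  obtain ⟨χ⟩ := nonempty_eigenbasis hG₂ (by rw [hh]; exact ENNReal.one_ne_top)
  let ξ := hm.eigenbasis hG ψ χ
  have hψ0 := ψ.val_nonneg hG₁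
  have hχ0 := χ.val_nonneg hG₂
  have hGpos : G.IsPositive := isPositive_of_basis ξ.basis (x := ξ.val)
    (fun p => mul_nonneg (hψ0 p.1) (hχ0 p.2)) ξ.apply_basis
  -- If `G₁ v = 0` then `G` kills every `m v y`, hence so does `D`, and the partial trace has zero
  -- form at `v`.
  have hker₁ : ∀ v, G₁ v = 0 → ptrace m D v = 0 := fun v hv => by
    refine apply_eq_zero_of_qf_eq_zero hP₁ ?_
    rw [qf_ptrace hm hD ht' (stdBasis E₂), ENNReal.tsum_eq_zero]
    refine fun k => qf_eq_zero_of_apply (hker _ ?_)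
    rw [hG, hv, map_zero, zero_apply]
  have hker₂ : ∀ v, G₂ v = 0 → ptrace m.flip D v = 0 := fun v hv => by
    refine apply_eq_zero_of_qf_eq_zero hP₂ ?_
    rw [qf_ptrace_flip hm hD ht' (stdBasis E₁), ENNReal.tsum_eq_zero]
    refine fun k => qf_eq_zero_of_apply (hker _ ?_)
    rw [hG, hv, map_zero]
  have hgs := (ψ.tsum_val hG₁).trans hg
  have hhs := (χ.tsum_val hG₂).trans hh
  have hsuper := fun (x : E₁) (y : E₂) (hx : ‖x‖ = 1) (hy : ‖y‖ = 1) =>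
    entSum_superadditive hm hD ht φ ψ.basis χ.basis hψ0 hχ0 hgs hhs
      (kerCompat_of_ker hD hker φ ξ) α β hx hy
  rw [relEntropy_eq hD hGpos hker φ ξ, relEntropy_eq hP₁ hG₁ hker₁ α ψ,
    relEntropy_eq hP₂ hG₂ hker₂ β χ]
  change _ + _ ≤ entSum φ.basis φ.val (hm.basis ψ.basis χ.basis)
    (fun p => ψ.val p.1 * χ.val p.2) ∧ (entSum φ.basis φ.val (hm.basis ψ.basis χ.basis)
    (fun p => ψ.val p.1 * χ.val p.2) < ∞ → (entSum φ.basis φ.val (hm.basis ψ.basis χ.basis)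
    (fun p => ψ.val p.1 * χ.val p.2) = _ ↔ _))
  -- Trace one excludes a trivial factor. Some pair of unit vectors is needed before the remainder
  -- in `hsuper` can be dropped.
  have hα : ∃ i : α.index, ‖α.basis i‖ = 1 := by
    by_contra hne
    have : IsEmpty α.index := ⟨fun i => hne ⟨i, α.basis.orthonormal.1 i⟩⟩
    have h0 := α.tsum_val hP₁
    rw [ht₁, tsum_empty] at h0
    exact zero_ne_one h0
  have hβ : ∃ i : β.index, ‖β.basis i‖ = 1 := by
    by_contra hne
    have : IsEmpty β.index := ⟨fun i => hne ⟨i, β.basis.orthonormal.1 i⟩⟩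
    have h0 := β.tsum_val hP₂
    rw [ht₂, tsum_empty] at h0
    exact zero_ne_one h0
  obtain ⟨i, hi⟩ := hα
  obtain ⟨j, hj⟩ := hβ
  refine ⟨le_self_add.trans (hsuper _ _ hi hj), fun hfin => ⟨fun heq => ?_, fun hten => ?_⟩⟩
  · have hX := tensorOp_isPositive hm hP₁ hP₂ ht₁' ht₂' α β
    -- At a finite value, equality leaves no room for the remainder.
    have hunit : ∀ x y, ‖x‖ = 1 → ‖y‖ = 1 →
        ⟪m x y, (D - tensorOp hm α β) (m x y)⟫_ℂ = 0 := by
      intro x y hx hy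
      have h1 := hsuper x y hx hy
      rw [heq] at h1 hfin
      have h2 := ENNReal.le_of_add_le_add_left hfin.ne (h1.trans_eq (add_zero _).symm)
      have h3 := ENNReal.ofReal_eq_zero.1 (le_antisymm h2 zero_le)
      rw [← ENNReal.toReal_mul, ← qf_tensorOp hm hP₁ hP₂ ht₁' ht₂' α β] at h3
      have h4 : (qf D (m x y)).toReal - (qf (tensorOp hm α β) (m x y)).toReal = 0 := by
        have := sq_nonneg ((qf D (m x y)).toReal - (qf (tensorOp hm α β) (m x y)).toReal)
        exact pow_eq_zero_iff two_ne_zero |>.1 (by linarith)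
      rw [qf, qf, ENNReal.toReal_ofReal (re_inner_nonneg hD _),
        ENNReal.toReal_ofReal (re_inner_nonneg hX _)] at h4
      rw [sub_apply, inner_sub_right, inner_eq_re hD, inner_eq_re hX, ← Complex.ofReal_sub, h4,
        Complex.ofReal_zero]
    have hall : ∀ x y, ⟪m x y, (D - tensorOp hm α β) (m x y)⟫_ℂ = 0 := by
      intro x y
      by_cases hx : x = 0
      · simp [hx]
      by_cases hy : y = 0
      · simp [hy]
      have h1 := hunit (((‖x‖⁻¹ : ℝ) : ℂ) • x) (((‖y‖⁻¹ : ℝ) : ℂ) • y)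
        (by simp [norm_smul, hx]) (by simp [norm_smul, hy])
      simp only [map_smul, smul_apply, inner_smul_left, inner_smul_right] at h1
      simpa [hx, hy, inner_sub_right, sub_eq_zero] using h1
    have h0 := hm.eq_zero_of_forall hall
    intro x y
    rw [← tensorOp_apply hm hP₁ hP₂ ht₁' ht₂' α β]
    exact DFunLike.congr_fun (sub_eq_zero.1 h0) _
  -- For a product `D` the eigenbasis may be taken to be the product one.
  · let φ' := hm.eigenbasis hten α β
    have e := entSum_eq_of_eigenbasis hD hGpos φ φ' ξ ξ
    refine Eq.trans e ?_
    exact entSum_prod hm α.basis β.basis ψ.basis χ.basis (α.val_nonneg hP₁) (β.val_nonneg hP₂)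
      hψ0 hχ0 ((α.tsum_val hP₁).trans ht₁) ((β.tsum_val hP₂).trans ht₂) hgs hhs
      (kerCompat_of_ker hP₁ hker₁ α ψ) (kerCompat_of_ker hP₂ hker₂ β χ)

end Tensor

/-! ### Wedge products and Slater determinants -/

section Wedge

variable {H : Type u} [NormedAddCommGroup H] [InnerProductSpace ℂ H]

theorem fock_total {x : Fock H} (h : ∀ (n : ℕ) (y : Fin n → H), ⟪wedge y, x⟫_ℂ = 0) : x = 0 := by
  have key : ∀ y : Fock H, ⟪y, x⟫_ℂ = 0 := by
    intro y
    induction y using UniformSpace.Completion.induction_on with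
    | hp => exact isClosed_eq (by fun_prop) (by fun_prop)
    | ih f =>
      induction f using fockPre_induction with
      | h0 =>
        rw [show ((0 : FockPre H) : Fock H) = 0 from UniformSpace.Completion.coe_zero,
          inner_zero_left]
      | hadd f g hf hg => rw [UniformSpace.Completion.coe_add, inner_add_left, hf, hg, add_zero]
      | hsmul c y =>
        rw [UniformSpace.Completion.coe_smul, inner_smul_left]
        exact mul_eq_zero_of_right _ (h y.1 y.2)
  exact inner_self_eq_zero.1 (key x)

theorem fock_ext {x y : Fock H} (h : ∀ (n : ℕ) (w : Fin n → H), ⟪wedge w, x⟫_ℂ = ⟪wedge w, y⟫_ℂ) :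
    x = y :=
  sub_eq_zero.1 <| fock_total fun n w => by rw [inner_sub_right, h, sub_self]

theorem inner_wedge_of_ne {n m : ℕ} (hnm : n ≠ m) (x : Fin n → H) (y : Fin m → H) :
    ⟪wedge x, wedge y⟫_ℂ = 0 := by
  rw [wedge, wedge, UniformSpace.Completion.inner_coe, inner_preWedge, gramKernel_ne hnm]

/-- A nonzero determinant has a nonzero term in its Leibniz expansion. -/
theorem exists_equiv_of_inner_wedge_ne_zero {n m : ℕ} {x : Fin n → H} {y : Fin m → H}
    (h : ⟪wedge x, wedge y⟫_ℂ ≠ 0) : ∃ σ : Fin m ≃ Fin n, ∀ i, ⟪x (σ i), y i⟫_ℂ ≠ 0 := by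
  by_cases hnm : n = m
  · subst hnm
    rw [inner_wedge, Matrix.det_apply] at h
    obtain ⟨σ, -, hσ⟩ := Finset.exists_ne_zero_of_sum_ne_zero h
    refine ⟨σ, fun i h0 => hσ ?_⟩
    rw [Finset.prod_eq_zero (Finset.mem_univ i) (by simpa using h0), smul_zero]
  · exact absurd (inner_wedge_of_ne hnm x y) h

theorem gram_update {n : ℕ} (w x : Fin n → H) (k : Fin n) (a : H) :
    (Matrix.of fun i j => ⟪w i, Function.update x k a j⟫_ℂ) =
      (Matrix.of fun i j => ⟪w i, x j⟫_ℂ).updateCol k fun i => ⟪w i, a⟫_ℂ := by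
  ext i j
  by_cases h : j = k
  · subst h
    simp
  · simp [h]

/-- The wedge product as an alternating map. -/
def wedgeMap (H : Type u) [NormedAddCommGroup H] [InnerProductSpace ℂ H] (n : ℕ) :
    H [⋀^Fin n]→ₗ[ℂ] Fock H where
  toFun := wedge
  -- Tested against wedge products, which are total, the axioms become properties of determinants in
  -- their columns.
  map_update_add' {inst} x k a b := by
    obtain rfl := Subsingleton.elim inst (instDecidableEqFin n)
    refine fock_ext fun m w => ?_
    by_cases hm : m = n
    · subst hm
      simp only [inner_add_right, inner_wedge, gram_update]
      exact Matrix.det_updateCol_add _ _ _ _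
    · simp [inner_add_right, inner_wedge_of_ne hm]
  map_update_smul' {inst} x k c a := by
    obtain rfl := Subsingleton.elim inst (instDecidableEqFin n)
    refine fock_ext fun m w => ?_
    by_cases hm : m = n
    · subst hm
      simp only [inner_smul_right, inner_wedge, gram_update]
      exact Matrix.det_updateCol_smul _ _ _ _
    · simp [inner_smul_right, inner_wedge_of_ne hm]
  map_eq_zero_of_eq' x i j hij hne := by
    refine fock_total fun m w => ?_
    by_cases hm : m = n
    · subst hm
      rw [inner_wedge]
      exact Matrix.det_zero_of_column_eq hne fun k => by simp [hij]
    · exact inner_wedge_of_ne hm _ _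

theorem wedgeMap_apply {n : ℕ} (x : Fin n → H) : wedgeMap H n x = wedge x := rfl

theorem wedge_eq_or_eq_neg {n m : ℕ} {x : Fin n → H} {y : Fin m → H} (σ : Fin n ≃ Fin m)
    (h : ∀ i, x i = y (σ i)) : wedge x = wedge y ∨ wedge x = -wedge y := by
  obtain rfl : n = m := by simpa using Fintype.card_congr σ
  have e : wedge x = Equiv.Perm.sign σ • wedge y := by
    rw [← wedgeMap_apply, ← wedgeMap_apply, ← AlternatingMap.map_perm]
    congr 1
    exact funext h
  rw [e]
  rcases Int.units_eq_one_or (Equiv.Perm.sign σ) with h1 | h1 <;> simp [h1]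

/-- Induction, using `‖h ∧ f‖ ≤ ‖h‖ ‖f‖`. It yields the continuity needed to pass from basis vectors
to arbitrary ones. -/
theorem norm_wedge_le {n : ℕ} (x : Fin n → H) : ‖wedge x‖ ≤ ∏ i, ‖x i‖ := by
  induction n with
  | zero =>
    have h : ‖wedge x‖ ^ 2 = 1 := by
      rw [← inner_self_eq_norm_sq (𝕜 := ℂ), inner_wedge, Matrix.det_fin_zero]
      simp
    simpa using ((pow_eq_one_iff_of_nonneg (norm_nonneg _) two_ne_zero).1 h).le
  | succ n ih =>
    rw [Fin.prod_univ_succ, ← Fin.cons_self_tail x, wedge,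
      show preWedge ⟨n + 1, Fin.cons (x 0) (Fin.tail x)⟩ =
        prependPre (x 0) (preWedge ⟨n, Fin.tail x⟩) from
        (prependPre_preWedge (x 0) ⟨n, Fin.tail x⟩).symm,
      UniformSpace.Completion.norm_coe]
    refine (norm_prependPre_le _ _).trans ?_
    have h := ih (Fin.tail x)
    rw [wedge, UniformSpace.Completion.norm_coe] at h
    exact mul_le_mul_of_nonneg_left h (norm_nonneg _)

/-- The wedge product as a continuous multilinear map. -/
def wedgeL (H : Type u) [NormedAddCommGroup H] [InnerProductSpace ℂ H] (n : ℕ) :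
    ContinuousMultilinearMap ℂ (fun _ : Fin n => H) (Fock H) :=
  (wedgeMap H n).toMultilinearMap.mkContinuous 1 fun x => by
    rw [one_mul]
    exact norm_wedge_le x

theorem wedgeL_apply {n : ℕ} (x : Fin n → H) : wedgeL H n x = wedge x := rfl

theorem inner_creator (h : H) (φ ψ : Fock H) :
    ⟪creator h φ, ψ⟫_ℂ = ⟪φ, annihilator h ψ⟫_ℂ :=
  (ContinuousLinearMap.adjoint_inner_right _ _ _).symm

/-- Induction on `n`. A leading basis vector is moved onto `ψ` as an annihilator, so the induction
hypothesis frees the other factors; linearity and continuity in the first slot then free that one.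
-/
theorem inner_wedge_eq_zero_of_basis [CompleteSpace H] {ι : Type*} (f : HilbertBasis ι ℂ H) {n : ℕ}
    {ψ : Fock H} (h : ∀ t : Fin n → ι, ⟪wedge fun i => f (t i), ψ⟫_ℂ = 0) (y : Fin n → H) :
    ⟪wedge y, ψ⟫_ℂ = 0 := by
  induction n generalizing ψ with
  | zero =>
    rw [← h Fin.elim0]
    congr 2
    exact Subsingleton.elim _ _
  | succ n ih =>
    have h1 : ∀ (i : ι) (z : Fin n → H), ⟪wedge (Fin.cons (f i) z : Fin (n + 1) → H), ψ⟫_ℂ = 0 := by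
      intro i z
      rw [← creator_wedge, inner_creator]
      refine ih (fun t => ?_) z
      rw [← inner_creator, creator_wedge, ← h (Fin.cons i t)]
      congr 2
      funext k
      refine Fin.cases ?_ (fun k => ?_) k <;> simp
    have h2 : ∀ z : Fin n → H, innerSL ℂ ψ ∘L
        ContinuousMultilinearMap.apply ℂ (fun _ : Fin n => H) (Fock H) z ∘L
          (wedgeL H (n + 1)).curryLeft = 0 := by
      intro z
      refine eq_of_forall_basis f fun i => ?_
      have := h1 i z
      rw [← inner_conj_symm, map_eq_zero] at this
      simpa [ContinuousMultilinearMap.curryLeft_apply, wedgeL_apply] using this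
    have h3 := DFunLike.congr_fun (h2 (Fin.tail y)) (y 0)
    rw [← inner_conj_symm, map_eq_zero, ← Fin.cons_self_tail y]
    simpa [ContinuousMultilinearMap.curryLeft_apply, wedgeL_apply] using h3

/-- `slater` orders its factors by an arbitrary enumeration, so other orders agree with it only up
to sign; the sign drops out of eigenvalue equations and orthogonality. -/
theorem slater_eq_or_eq_neg {ι : Type u} (f : ι → H) {n : ℕ} {t : Fin n → ι}
    (ht : Function.Injective t) {s : Finset ι} (hs : ∀ i, i ∈ s ↔ ∃ k, t k = i) :
    slater f s = wedge (fun k => f (t k)) ∨ slater f s = -wedge fun k => f (t k) := by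
  let e : Fin n ≃ s := Equiv.ofBijective (fun k => ⟨t k, (hs _).2 ⟨k, rfl⟩⟩)
    ⟨fun a b hab => ht (congrArg Subtype.val hab), fun ⟨i, hi⟩ => by
      obtain ⟨k, hk⟩ := (hs i).1 hi
      exact ⟨k, Subtype.ext hk⟩⟩
  refine wedge_eq_or_eq_neg (s.equivFin.symm.trans e.symm) fun i => ?_
  have : t (e.symm (s.equivFin.symm i)) = s.equivFin.symm i :=
    congrArg Subtype.val (e.apply_symm_apply (s.equivFin.symm i))
  simp [this]

theorem exists_equiv_of_inner_slater_ne_zero {ι κ : Type u} {f : ι → H} {g : κ → H} {s : Finset ι}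
    {t : Finset κ} (h : ⟪slater f s, slater g t⟫_ℂ ≠ 0) :
    ∃ e : t ≃ s, ∀ k, ⟪f (e k), g k⟫_ℂ ≠ 0 := by
  obtain ⟨σ, hσ⟩ := exists_equiv_of_inner_wedge_ne_zero h
  refine ⟨(t.equivFin.trans σ).trans s.equivFin.symm, fun k => ?_⟩
  simpa using hσ (t.equivFin k)

theorem orthonormal_slater {ι : Type u} {f : ι → H} (hf : Orthonormal ℂ f) :
    Orthonormal ℂ (slater f) := by
  classical
  rw [orthonormal_iff_ite]
  intro s t
  split_ifs with hst
  · subst hst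
    rw [slater, inner_wedge]
    convert Matrix.det_one (n := Fin s.card) (R := ℂ)
    ext i j
    simp [orthonormal_iff_ite.1 hf, Matrix.one_apply]
  · by_contra h
    obtain ⟨e, he⟩ := exists_equiv_of_inner_slater_ne_zero h
    have he' : ∀ k, (e k : ι) = k := fun k => by
      by_contra hk
      exact he k (hf.2 hk)
    refine hst (Finset.ext fun i => ⟨fun hi => ?_, fun hi => ?_⟩)
    · have := he' (e.symm ⟨i, hi⟩)
      rw [Equiv.apply_symm_apply] at this
      rw [show i = (e.symm ⟨i, hi⟩ : ι) from this]
      exact (e.symm ⟨i, hi⟩).2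
    · rw [show i = (e ⟨i, hi⟩ : ι) from (he' ⟨i, hi⟩).symm]
      exact (e ⟨i, hi⟩).2

variable [CompleteSpace H]

theorem eq_zero_of_forall_slater {ι : Type u} (f : HilbertBasis ι ℂ H) {ψ : Fock H}
    (h : ∀ s : Finset ι, ⟪slater f s, ψ⟫_ℂ = 0) : ψ = 0 := by
  classical
  refine fock_total fun n y => inner_wedge_eq_zero_of_basis f (fun t => ?_) y
  by_cases ht : Function.Injective t
  · have h0 := h (Finset.univ.image t)
    rcases slater_eq_or_eq_neg f ht (s := Finset.univ.image t) (by simp) with e | e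
    · rwa [e] at h0
    · rwa [e, inner_neg_left, neg_eq_zero] at h0
  · rw [Function.Injective] at ht
    push Not at ht
    obtain ⟨a, b, hab, hne⟩ := ht
    rw [← wedgeMap_apply, (wedgeMap H n).map_eq_zero_of_eq _ (by simp [hab]) hne, inner_zero_left]

/-- The orthonormal basis of Fock space consisting of the Slater determinants in an orthonormal
basis. -/
def slaterBasis {ι : Type u} (f : HilbertBasis ι ℂ H) : HilbertBasis (Finset ι) ℂ (Fock H) :=
  HilbertBasis.mkOfOrthogonalEqBot (orthonormal_slater f.orthonormal) <| by
    rw [eq_bot_iff]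
    intro ψ hψ
    rw [Submodule.mem_orthogonal] at hψ
    exact eq_zero_of_forall_slater f fun s => hψ _ (Submodule.subset_span ⟨s, rfl⟩)

theorem slaterBasis_apply {ι : Type u} (f : HilbertBasis ι ℂ H) (s : Finset ι) :
    slaterBasis f s = slater f s :=
  congr_fun (HilbertBasis.coe_mkOfOrthogonalEqBot _ _) s

end Wedge

/-! ### Fock space over an orthogonal sum as a tensor product -/

section Split

variable {H : Type u} [NormedAddCommGroup H] [InnerProductSpace ℂ H] [CompleteSpace H]
  (K : Submodule ℂ H) [CompleteSpace K] {ι κ : Type u}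

/-- The union of orthonormal bases of a closed subspace and of its orthogonal complement. -/
def sumBasis (f : HilbertBasis ι ℂ K) (g : HilbertBasis κ ℂ Kᗮ) : HilbertBasis (ι ⊕ κ) ℂ H :=
  HilbertBasis.mkOfOrthogonalEqBot
    (v := Sum.elim (fun i => (f i : H)) fun k => (g k : H))
    (by
      constructor
      · rintro (i | k)
        · simpa using f.orthonormal.1 i
        · simpa using g.orthonormal.1 k
      · rintro (i | k) (j | l) hne
        · simpa using f.orthonormal.2 fun h => hne (congrArg Sum.inl h)
        · exact Submodule.inner_right_of_mem_orthogonal (f i).2 (g l).2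
        · exact Submodule.inner_left_of_mem_orthogonal (f j).2 (g k).2
        · simpa using g.orthonormal.2 fun h => hne (congrArg Sum.inr h))
    (by
      rw [eq_bot_iff]
      intro x hx
      rw [Submodule.mem_orthogonal'] at hx
      have h1 : innerSL ℂ x ∘L K.subtypeL = 0 := eq_of_forall_basis f fun i =>
        hx _ (Submodule.subset_span ⟨Sum.inl i, rfl⟩)
      have h2 : innerSL ℂ x ∘L Kᗮ.subtypeL = 0 := eq_of_forall_basis g fun k =>
        hx _ (Submodule.subset_span ⟨Sum.inr k, rfl⟩)
      have hx1 : x ∈ Kᗮ := (Submodule.mem_orthogonal' _ _).2 fun y hy =>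
        DFunLike.congr_fun h1 ⟨y, hy⟩
      exact inner_self_eq_zero.1 (DFunLike.congr_fun h2 ⟨x, hx1⟩))

theorem sumBasis_apply (f : HilbertBasis ι ℂ K) (g : HilbertBasis κ ℂ Kᗮ) (i : ι ⊕ κ) :
    sumBasis K f g i = Sum.elim (fun i => (f i : H)) (fun k => (g k : H)) i :=
  congr_fun (HilbertBasis.coe_mkOfOrthogonalEqBot _ _) i

theorem slater_disjSum (f : HilbertBasis ι ℂ K) (g : HilbertBasis κ ℂ Kᗮ) (s : Finset ι)
    (t : Finset κ) :
    slater (sumBasis K f g) (s.disjSum t) = fockMul K (slater f s) (slater g t) ∨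
      slater (sumBasis K f g) (s.disjSum t) = -fockMul K (slater f s) (slater g t) := by
  let u : Fin (s.card + t.card) → ι ⊕ κ :=
    Fin.append (fun i => Sum.inl (s.equivFin.symm i : ι)) fun k => Sum.inr (t.equivFin.symm k : κ)
  have hu : Function.Injective u := by
    intro a b
    refine Fin.addCases (fun a => ?_) (fun a => ?_) a <;>
      refine Fin.addCases (fun b => ?_) (fun b => ?_) b <;> simp [u]
  have hs : ∀ i, i ∈ s.disjSum t ↔ ∃ k, u k = i := by
    rintro (i | k)
    · rw [Finset.inl_mem_disjSum]
      constructor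
      · intro hi
        exact ⟨Fin.castAdd _ (s.equivFin ⟨i, hi⟩), by simp [u]⟩
      · rintro ⟨k, hk⟩
        induction k using Fin.addCases with
        | left k =>
          simp only [u, Fin.append_left, Sum.inl.injEq] at hk
          rw [← hk]
          exact Subtype.prop _
        | right k => simp [u] at hk
    · rw [Finset.inr_mem_disjSum]
      constructor
      · intro hi
        exact ⟨Fin.natAdd _ (t.equivFin ⟨k, hi⟩), by simp [u]⟩
      · rintro ⟨l, hl⟩
        induction l using Fin.addCases with
        | left l => simp [u] at hl
        | right l =>
          simp only [u, Fin.append_right, Sum.inr.injEq] at hl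
          rw [← hl]
          exact Subtype.prop _
  have e : (fun k => sumBasis K f g (u k)) = Fin.append (fun i => (f (s.equivFin.symm i) : H))
      fun k => (g (t.equivFin.symm k) : H) := by
    funext k
    simp only [sumBasis_apply, u]
    induction k using Fin.addCases <;> simp
  have h := slater_eq_or_eq_neg (sumBasis K f g) hu hs
  rw [e, ← fockMul_wedge] at h
  exact h

theorem exists_disjSum (u : Finset (ι ⊕ κ)) :
    ∃ (s : Finset ι) (t : Finset κ), u = s.disjSum t :=
  ⟨u.toLeft, u.toRight, Finset.toLeft_disjSum_toRight.symm⟩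

/-- Totality holds because, up to sign, the Slater determinants in the union of two bases are
products, by `slater_disjSum`. -/
theorem isHilbertTensor_fockMul : IsHilbertTensor (fockMul K) where
  inner_eq := inner_fockMul K
  total ψ hψ := by
    refine eq_zero_of_forall_slater (sumBasis K (stdBasis K) (stdBasis Kᗮ)) fun u => ?_
    obtain ⟨s, t, rfl⟩ := exists_disjSum u
    rcases slater_disjSum K (stdBasis K) (stdBasis Kᗮ) s t with e | e
    · rw [e, hψ]
    · rw [e, inner_neg_left, hψ, neg_zero]

end Split

/-! ### The weights of a free state -/

section Weight

open Filter Topology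

theorem one_sub_sum_le_prod {ι : Type*} (p : ι → ℝ) (h0 : ∀ i, 0 ≤ p i) (h1 : ∀ i, p i ≤ 1)
    (s : Finset ι) : 1 - ∑ i ∈ s, p i ≤ ∏ i ∈ s, (1 - p i) := by
  classical
  induction s using Finset.induction_on with
  | empty => simp
  | insert a s ha ih =>
    rw [Finset.sum_insert ha, Finset.prod_insert ha]
    have h2 : ∏ i ∈ s, (1 - p i) ≤ 1 :=
      Finset.prod_le_one (fun i _ => sub_nonneg.2 (h1 i)) fun i _ => by linarith [h0 i]
    nlinarith [h0 a, mul_le_mul_of_nonneg_left h2 (h0 a)]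

theorem antitone_prod_of_le_one {ι : Type*} {q : ι → ℝ} (h0 : ∀ i, 0 ≤ q i) (h1 : ∀ i, q i ≤ 1) :
    Antitone fun s : Finset ι => ∏ i ∈ s, q i := fun s t hst => by
  classical
  have h2 : ∏ i ∈ t \ s, q i ≤ 1 := Finset.prod_le_one (fun i _ => h0 i) fun i _ => h1 i
  calc ∏ i ∈ t, q i = (∏ i ∈ t \ s, q i) * ∏ i ∈ s, q i := (Finset.prod_sdiff hst).symm
    _ ≤ 1 * ∏ i ∈ s, q i := mul_le_mul_of_nonneg_right h2 (Finset.prod_nonneg fun i _ => h0 i)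
    _ = ∏ i ∈ s, q i := one_mul _

/-- The partial products decrease and are bounded below; the limit is allowed to be `0`. -/
theorem multipliable_of_le_one {ι : Type*} {q : ι → ℝ} (h0 : ∀ i, 0 ≤ q i) (h1 : ∀ i, q i ≤ 1) :
    Multipliable q :=
  ⟨_, tendsto_atTop_ciInf (antitone_prod_of_le_one h0 h1)
    ⟨0, by rintro _ ⟨s, rfl⟩; exact Finset.prod_nonneg fun i _ => h0 i⟩⟩

variable {ι : Type u} {p : ι → ℝ}

open Classical in
/-- The factors of the weight of a finite set. -/
def weightFactor (p : ι → ℝ) (s : Finset ι) (j : ι) : ℝ := if j ∈ s then p j else 1 - p j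

theorem weightFactor_nonneg (h0 : ∀ i, 0 ≤ p i) (h1 : ∀ i, p i ≤ 1) (s : Finset ι) (j : ι) :
    0 ≤ weightFactor p s j := by
  unfold weightFactor
  split_ifs
  · exact h0 j
  · exact sub_nonneg.2 (h1 j)

theorem weightFactor_le_one (h0 : ∀ i, 0 ≤ p i) (h1 : ∀ i, p i ≤ 1) (s : Finset ι) (j : ι) :
    weightFactor p s j ≤ 1 := by
  unfold weightFactor
  split_ifs
  · exact h1 j
  · linarith [h0 j]

theorem hasProd_weight (h0 : ∀ i, 0 ≤ p i) (h1 : ∀ i, p i ≤ 1) (s : Finset ι) :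
    HasProd (weightFactor p s) (weight p s) :=
  (multipliable_of_le_one (weightFactor_nonneg h0 h1 s) (weightFactor_le_one h0 h1 s)).hasProd

theorem weight_nonneg (h0 : ∀ i, 0 ≤ p i) (h1 : ∀ i, p i ≤ 1) (s : Finset ι) : 0 ≤ weight p s :=
  ge_of_tendsto' (hasProd_weight h0 h1 s) fun _ =>
    Finset.prod_nonneg fun j _ => weightFactor_nonneg h0 h1 s j

theorem weight_le_prod (h0 : ∀ i, 0 ≤ p i) (h1 : ∀ i, p i ≤ 1) (s F : Finset ι) :
    weight p s ≤ ∏ j ∈ F, weightFactor p s j :=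
  (antitone_prod_of_le_one (weightFactor_nonneg h0 h1 s) (weightFactor_le_one h0 h1 s)).le_of_tendsto
    (hasProd_weight h0 h1 s) F

/-- Expansion of `∏ (p j + (1 - p j)) = 1`. -/
theorem sum_powerset_prod (p : ι → ℝ) (F : Finset ι) :
    ∑ s ∈ F.powerset, ∏ j ∈ F, weightFactor p s j = 1 := by
  classical
  have h := Finset.prod_add p (fun j => 1 - p j) F
  simp only [add_sub_cancel, Finset.prod_const_one] at h
  rw [h]
  refine Finset.sum_congr rfl fun s hs => ?_
  rw [← Finset.prod_sdiff (Finset.mem_powerset.1 hs), mul_comm]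
  congr 1
  · exact Finset.prod_congr rfl fun j hj => by simp [weightFactor, hj]
  · exact Finset.prod_congr rfl fun j hj => by simp [weightFactor, (Finset.mem_sdiff.1 hj).2]

theorem sum_weight_le_one (h0 : ∀ i, 0 ≤ p i) (h1 : ∀ i, p i ≤ 1) (T : Finset (Finset ι)) :
    ∑ s ∈ T, weight p s ≤ 1 := by
  classical
  calc ∑ s ∈ T, weight p s ≤ ∑ s ∈ (T.biUnion id).powerset, weight p s :=
        Finset.sum_le_sum_of_subset_of_nonneg
          (fun s hs => Finset.mem_powerset.2 (Finset.subset_biUnion_of_mem id hs))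
          fun s _ _ => weight_nonneg h0 h1 s
    _ ≤ ∑ s ∈ (T.biUnion id).powerset, ∏ j ∈ T.biUnion id, weightFactor p s j :=
        Finset.sum_le_sum fun s _ => weight_le_prod h0 h1 s _
    _ = 1 := sum_powerset_prod p _

theorem summable_weight (h0 : ∀ i, 0 ≤ p i) (h1 : ∀ i, p i ≤ 1) : Summable (weight p) :=
  summable_of_sum_le (weight_nonneg h0 h1) (sum_weight_le_one h0 h1)

/-- In probabilistic terms, independent events with summable probabilities almost surely occur only
finitely often, so the finite sets carry all the mass. -/
theorem tsum_weight (h0 : ∀ i, 0 ≤ p i) (h1 : ∀ i, p i ≤ 1) (hs : Summable p) :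
    ∑' s, weight p s = 1 := by
  classical
  refine le_antisymm ((summable_weight h0 h1).tsum_le_of_sum_le (sum_weight_le_one h0 h1)) ?_
  refine le_of_forall_pos_sub_le fun ε hε => ?_
  obtain ⟨F, hF⟩ := summable_iff_vanishing_norm.1 hs ε hε
  -- For `s ⊆ F` the factors outside `F` are `1 - p j`, and their product is at least `1 - ε` since
  -- the `p j` there sum to less than `ε`.
  have h2 : ∀ s ∈ F.powerset, (1 - ε) * ∏ j ∈ F, weightFactor p s j ≤ weight p s := by
    intro s hsF
    refine ge_of_tendsto (hasProd_weight h0 h1 s) ?_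
    filter_upwards [eventually_ge_atTop F] with G hG
    rw [← Finset.prod_sdiff hG]
    refine mul_le_mul_of_nonneg_right ?_
      (Finset.prod_nonneg fun j _ => weightFactor_nonneg h0 h1 s j)
    have e : ∏ j ∈ G \ F, weightFactor p s j = ∏ j ∈ G \ F, (1 - p j) :=
      Finset.prod_congr rfl fun j hj => by
        have : j ∉ s := fun h => (Finset.mem_sdiff.1 hj).2 (Finset.mem_powerset.1 hsF h)
        simp [weightFactor, this]
    rw [e]
    refine le_trans ?_ (one_sub_sum_le_prod p h0 h1 _)
    have := (le_abs_self _).trans_lt (hF (G \ F) Finset.sdiff_disjoint)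
    linarith
  calc 1 - ε = ∑ s ∈ F.powerset, (1 - ε) * ∏ j ∈ F, weightFactor p s j := by
        rw [← Finset.mul_sum, sum_powerset_prod, mul_one]
    _ ≤ ∑ s ∈ F.powerset, weight p s := Finset.sum_le_sum h2
    _ ≤ ∑' s, weight p s :=
        (summable_weight h0 h1).sum_le_tsum _ fun s _ => weight_nonneg h0 h1 s

theorem weight_disjSum {κ : Type u} {q : κ → ℝ} (h0 : ∀ i, 0 ≤ p i) (h1 : ∀ i, p i ≤ 1)
    (k0 : ∀ i, 0 ≤ q i) (k1 : ∀ i, q i ≤ 1) (s : Finset ι) (t : Finset κ) :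
    weight (Sum.elim p q) (s.disjSum t) = weight p s * weight q t := by
  refine (HasProd.sum (f := weightFactor (Sum.elim p q) (s.disjSum t)) ?_ ?_).tprod_eq
  · convert hasProd_weight h0 h1 s using 1
    funext j
    have hj := Finset.inl_mem_disjSum (s := s) (t := t) (a := j)
    simp only [weightFactor, Function.comp_apply]
    split_ifs <;> first | rfl | tauto
  · convert hasProd_weight k0 k1 t using 1
    funext j
    have hj := Finset.inr_mem_disjSum (s := s) (t := t) (b := j)
    simp only [weightFactor, Function.comp_apply]
    split_ifs <;> first | rfl | tauto

/-- An infinite product depends only on the multiplicities of its factors. -/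
theorem tprod_eq_of_nonempty_equiv {ι κ : Type*} {g : ι → ℝ} {g' : κ → ℝ}
    (h : ∀ c, c ≠ 1 → Nonempty ({j // g j = c} ≃ {k // g' k = c})) :
    ∏' j, g j = ∏' k, g' k := by
  classical
  have key : ∀ c, Nonempty ({a : {j // g j ≠ 1} // g a = c} ≃ {b : {k // g' k ≠ 1} // g' b = c}) := by
    intro c
    by_cases hc : c = 1
    · subst hc
      have h₁ : IsEmpty {a : {j // g j ≠ 1} // g a = 1} := ⟨fun a => a.1.2 a.2⟩
      have h₂ : IsEmpty {b : {k // g' k ≠ 1} // g' b = 1} := ⟨fun b => b.1.2 b.2⟩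
      exact ⟨Equiv.equivOfIsEmpty _ _⟩
    · obtain ⟨e⟩ := h c hc
      exact ⟨((Equiv.subtypeSubtypeEquivSubtype (p := fun j => g j ≠ 1)
        (q := fun j => g j = c) fun h => by rwa [h]).trans e).trans
        (Equiv.subtypeSubtypeEquivSubtype (p := fun j => g' j ≠ 1)
        (q := fun j => g' j = c) fun h => by rwa [h]).symm⟩
  let E : {j // g j ≠ 1} ≃ {k // g' k ≠ 1} :=
    Equiv.ofFiberEquiv (f := fun a => g a.1) (g := fun b => g' b.1) fun c => (key c).some
  have hE : ∀ a, g' (E a) = g a := fun a =>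
    Equiv.ofFiberEquiv_map (f := fun a : {j // g j ≠ 1} => g a.1)
      (g := fun b : {k // g' k ≠ 1} => g' b.1) (fun c => (key c).some) a
  rw [← tprod_subtype_mulSupport g, ← tprod_subtype_mulSupport g']
  exact (tprod_congr fun a => (hE a).symm).trans
    (E.tprod_eq fun b : {k // g' k ≠ 1} => g' b)

/-- Matching `s` with `t` and cancelling finite multiplicities matches the complements too, for
every nonzero eigenvalue. Zero eigenvalues outside the sets give the factor `1` and are irrelevant.
-/
theorem weight_eq_of_equiv {κ : Type u} {p' : κ → ℝ} {s : Finset ι} {t : Finset κ} (e : t ≃ s)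
    (he : ∀ k, p (e k) = p' k) (hfin : ∀ c, c ≠ 0 → {j | p j = c}.Finite)
    (hcard : ∀ c, {j | p j = c}.encard = {k | p' k = c}.encard) : weight p s = weight p' t := by
  have hfin' : ∀ c, c ≠ 0 → {k | p' k = c}.Finite := fun c hc => by
    rw [← Set.encard_lt_top_iff, ← hcard, Set.encard_lt_top_iff]
    exact hfin c hc
  have hin : ∀ c, ({j | p j = c} ∩ s).encard = ({k | p' k = c} ∩ t).encard := fun c => by
    have h₁ : ({j | p j = c} ∩ s : Set ι) =
        Set.range fun x : {x : s // p x = c} => (x : ι) := by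
      ext j
      simp [and_comm]
    have h₂ : ({k | p' k = c} ∩ t : Set κ) =
        Set.range fun x : {x : t // p' x = c} => (x : κ) := by
      ext j
      simp [and_comm]
    rw [h₁, h₂, ← Set.image_univ, ← Set.image_univ, Function.Injective.encard_image,
      Function.Injective.encard_image, Set.encard_univ, Set.encard_univ]
    · exact (ENat.card_congr (e.subtypeEquiv fun k => by rw [he])).symm
    · exact Subtype.val_injective.comp Subtype.val_injective
    · exact Subtype.val_injective.comp Subtype.val_injective
  have hout : ∀ c, c ≠ 0 → ({j | p j = c} \ s).encard = ({k | p' k = c} \ t).encard := fun c hc => by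
    have h := hcard c
    rw [← Set.encard_sdiff_add_encard_inter {j | p j = c} s,
      ← Set.encard_sdiff_add_encard_inter {k | p' k = c} t, hin] at h
    exact ENat.add_left_injective_of_ne_top
      ((hfin' c hc).subset Set.inter_subset_left).encard_lt_top.ne h
  -- A factor `c ≠ 1` arises from an eigenvalue `c` inside the set or from `1 - c ≠ 0` outside it,
  -- finitely often in either case.
  refine tprod_eq_of_nonempty_equiv (g := weightFactor p s) (g' := weightFactor p' t) fun c hc => ?_
  have split : ∀ {α : Type u} (r : α → ℝ) (u : Finset α), {j | weightFactor r u j = c} =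
      ({j | r j = c} ∩ u) ∪ ({j | r j = 1 - c} \ u) := fun r u => by
    ext j
    by_cases hj : j ∈ u
    · simp [weightFactor, hj]
    · simp only [weightFactor, hj, Set.mem_ofPred_eq, if_false, Set.mem_union, Set.mem_inter_iff,
        Set.mem_sdiff, Finset.mem_coe, and_false, not_false_eq_true, and_true, false_or]
      constructor <;> intro h <;> linarith
  have hc' : 1 - c ≠ 0 := sub_ne_zero.2 (Ne.symm hc)
  have f₁ : {j | weightFactor p s j = c}.Finite := by
    rw [split]
    exact (s.finite_toSet.inter_of_right _).union ((hfin _ hc').sdiff)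
  have f₂ : {j | weightFactor p' t j = c}.Finite := by
    rw [split]
    exact (t.finite_toSet.inter_of_right _).union ((hfin' _ hc').sdiff)
  have hd : ∀ {α : Type u} (A B : Set α) (u : Finset α), Disjoint (A ∩ u) (B \ u) :=
    fun A B u => Set.disjoint_left.2 fun j h₁ h₂ => h₂.2 h₁.2
  have hE : {j | weightFactor p s j = c}.encard = {j | weightFactor p' t j = c}.encard := by
    rw [split, split, Set.encard_union_eq (hd _ _ _), Set.encard_union_eq (hd _ _ _), hin,
      hout _ hc']
  have : Finite {j // weightFactor p s j = c} := f₁.to_subtype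
  have : Finite {k // weightFactor p' t k = c} := f₂.to_subtype
  exact Finite.card_eq.1 (congrArg ENat.toNat hE)

end Weight

/-! ### Free states -/

section FreeState

variable {H : Type u} [NormedAddCommGroup H] [InnerProductSpace ℂ H] [CompleteSpace H]

/-- Positive contractions of finite trace. -/
structure IsOccupation (γ : H →L[ℂ] H) : Prop where
  pos : γ.IsPositive
  qf_le : ∀ x, qf γ x ≤ ‖x‖ₑ ^ 2
  posTrace_ne_top : posTrace γ ≠ ∞

variable {γ : H →L[ℂ] H}

theorem IsOccupation.val_le_one (hγ : IsOccupation γ) (φ : Eigenbasis γ) (i : φ.index) :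
    φ.val i ≤ 1 := by
  have h := hγ.qf_le (φ.basis i)
  rw [φ.qf_basis, enorm_basis, one_pow] at h
  exact ENNReal.ofReal_le_one.1 h

theorem IsOccupation.summable_val (hγ : IsOccupation γ) (φ : Eigenbasis γ) : Summable φ.val := by
  have h := hγ.posTrace_ne_top
  rw [← φ.tsum_val hγ.pos] at h
  exact (ENNReal.summable_toReal h).congr fun i =>
    ENNReal.toReal_ofReal (φ.val_nonneg hγ.pos i)

/-- The multiplicity is the double sum of `|⟪φᵢ, ψₖ⟫|²` over the `k` with eigenvalue `c`, and for
fixed `i` the inner sum does not depend on the eigenbasis `ψ`. -/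
theorem encard_val_eq (hγ : γ.IsPositive) (φ φ' : Eigenbasis γ) (c : ℝ) :
    {j | φ.val j = c}.encard = {k | φ'.val k = c}.encard := by
  classical
  have h : ∀ ψ : Eigenbasis γ, (({j | ψ.val j = c}.encard : ℕ∞) : ℝ≥0∞) =
      ∑' j, if ψ.val j = c then 1 else 0 := fun ψ => by
    rw [← ENNReal.tsum_set_one, tsum_subtype {j | ψ.val j = c} fun _ => (1 : ℝ≥0∞)]
    rfl
  have e : ((({j | φ.val j = c}.encard : ℕ∞) : ℝ≥0∞)) = ({k | φ'.val k = c}.encard : ℕ∞) := by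
    rw [h, h, ← tsum_tsum_right φ.basis φ.basis fun j => if φ.val j = c then (1 : ℝ≥0∞) else 0,
      ← tsum_tsum_right φ.basis φ'.basis fun j => if φ'.val j = c then (1 : ℝ≥0∞) else 0]
    exact tsum_congr fun i =>
      tsum_eigenbasis_eq hγ φ φ' (fun r => if r = c then 1 else 0) (φ.basis i)
  exact_mod_cast e

theorem IsOccupation.weight_eq (hγ : IsOccupation γ) (φ φ' : Eigenbasis γ) {s : Finset φ.index}
    {t : Finset φ'.index} (h : ⟪slater φ.basis s, slater φ'.basis t⟫_ℂ ≠ 0) :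
    weight φ.val s = weight φ'.val t := by
  obtain ⟨e, he⟩ := exists_equiv_of_inner_slater_ne_zero h
  refine weight_eq_of_equiv e (fun k => ?_) (fun c hc => ?_) (encard_val_eq hγ.pos φ φ')
  · by_contra hne
    exact he k (inner_eq_zero_of_val_ne hγ.pos φ φ' hne)
  · have h0 := (hγ.summable_val φ).tendsto_cofinite_zero
    have h1 := h0.eventually_ne hc.symm
    rw [Filter.eventually_cofinite] at h1
    simpa using h1

/-- Frees `freeState` from its chosen eigenbasis. Coefficients are compared in the chosen Slater
basis: a nonzero overlap pairs equal eigenvalues, because eigenvectors with different eigenvalues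
are orthogonal, and so forces equal weights. -/
theorem freeState_slater (hγ : IsOccupation γ) (φ : Eigenbasis γ) (s : Finset φ.index) :
    freeState γ (slater φ.basis s) = (weight φ.val s : ℂ) • slater φ.basis s := by
  have hne : Nonempty (Eigenbasis γ) := ⟨φ⟩
  have e : freeState γ = diagOp (slaterBasis hne.some.basis) (weight hne.some.val) := by
    rw [freeState, dif_pos hne, diagOp]
    simp_rw [slaterBasis_apply]
  set φ' := hne.some
  refine eq_of_forall_inner_basis (slaterBasis φ'.basis) fun t => ?_
  have hs := summable_weight (φ'.val_nonneg hγ.pos) (hγ.val_le_one φ')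
  have hsym := (diagOp_isPositive (slaterBasis φ'.basis) hs
    (weight_nonneg (φ'.val_nonneg hγ.pos) (hγ.val_le_one φ'))).isSymmetric
    (slaterBasis φ'.basis t) (slater φ.basis s)
  simp only [ContinuousLinearMap.coe_coe] at hsym
  rw [e, ← hsym, diagOp_apply_basis _ hs, inner_smul_left, inner_smul_right, Complex.conj_ofReal]
  by_cases h : ⟪slaterBasis φ'.basis t, slater φ.basis s⟫_ℂ = 0
  · rw [h, mul_zero, mul_zero]
  · rw [slaterBasis_apply] at h ⊢
    rw [hγ.weight_eq φ' φ h]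

theorem IsOccupation.exists_eigenbasis (hγ : IsOccupation γ) : Nonempty (Eigenbasis γ) :=
  nonempty_eigenbasis hγ.pos hγ.posTrace_ne_top

theorem freeState_isPositive (hγ : IsOccupation γ) : (freeState γ).IsPositive := by
  obtain ⟨φ⟩ := hγ.exists_eigenbasis
  refine isPositive_of_basis (slaterBasis φ.basis)
    (weight_nonneg (φ.val_nonneg hγ.pos) (hγ.val_le_one φ)) fun s => ?_
  rw [slaterBasis_apply, freeState_slater hγ]

theorem posTrace_freeState (hγ : IsOccupation γ) : posTrace (freeState γ) = 1 := by
  obtain ⟨φ⟩ := hγ.exists_eigenbasis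
  have h0 := weight_nonneg (φ.val_nonneg hγ.pos) (hγ.val_le_one φ)
  have hs := summable_weight (φ.val_nonneg hγ.pos) (hγ.val_le_one φ)
  let Ψ : Eigenbasis (freeState γ) :=
    { index := Finset φ.index
      basis := slaterBasis φ.basis
      val := weight φ.val
      apply_basis := fun s => by rw [slaterBasis_apply, freeState_slater hγ] }
  rw [← Ψ.tsum_val (freeState_isPositive hγ)]
  change ∑' s, ENNReal.ofReal (weight φ.val s) = 1
  rw [← ENNReal.ofReal_tsum_of_nonneg h0 hs,
    tsum_weight (φ.val_nonneg hγ.pos) (hγ.val_le_one φ) (hγ.summable_val φ), ENNReal.ofReal_one]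

variable (K : Submodule ℂ H) [CompleteSpace K]

theorem directSum_apply_fst (A : K →L[ℂ] K) (B : Kᗮ →L[ℂ] Kᗮ) (x : K) :
    directSum K A B x = A x := by
  have h : Kᗮ.orthogonalProjectionOnto (x : H) = 0 :=
    Submodule.orthogonalProjectionOnto_eq_zero_iff.2 (K.le_orthogonal_orthogonal x.2)
  simp [directSum, h]

theorem directSum_apply_snd (A : K →L[ℂ] K) (B : Kᗮ →L[ℂ] Kᗮ) (x : Kᗮ) :
    directSum K A B x = B x := by
  have h : K.orthogonalProjectionOnto (x : H) = 0 :=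
    Submodule.orthogonalProjectionOnto_eq_zero_iff.2 x.2
  simp [directSum, h]

/-- The union of eigenbases of two operators, as an eigenbasis of their direct sum. -/
def sumEigenbasis {γ₁ : K →L[ℂ] K} {γ₂ : Kᗮ →L[ℂ] Kᗮ} (φ : Eigenbasis γ₁) (ψ : Eigenbasis γ₂) :
    Eigenbasis (directSum K γ₁ γ₂) where
  index := φ.index ⊕ ψ.index
  basis := sumBasis K φ.basis ψ.basis
  val := Sum.elim φ.val ψ.val
  apply_basis := by
    rintro (i | k)
    · rw [sumBasis_apply]
      simp [directSum_apply_fst, φ.apply_basis]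
    · rw [sumBasis_apply]
      simp [directSum_apply_snd, ψ.apply_basis]

/-- In the union of eigenbases the weights multiply by `weight_disjSum`, and the sign from
`slater_disjSum` appears on both sides of the eigenvalue equation. The identity extends by
continuity from Slater vectors. -/
theorem freeState_directSum {γ₁ : K →L[ℂ] K} {γ₂ : Kᗮ →L[ℂ] Kᗮ}
    (hγ : IsOccupation (directSum K γ₁ γ₂)) (h₁ : IsOccupation γ₁) (h₂ : IsOccupation γ₂)
    (x : Fock K) (y : Fock Kᗮ) :
    freeState (directSum K γ₁ γ₂) (fockMul K x y) =
      fockMul K (freeState γ₁ x) (freeState γ₂ y) := by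
  obtain ⟨φ⟩ := h₁.exists_eigenbasis
  obtain ⟨ψ⟩ := h₂.exists_eigenbasis
  have key : ∀ s t, freeState (directSum K γ₁ γ₂)
      (fockMul K (slater φ.basis s) (slater ψ.basis t)) =
      fockMul K (freeState γ₁ (slater φ.basis s)) (freeState γ₂ (slater ψ.basis t)) := by
    intro s t
    have h := freeState_slater hγ (sumEigenbasis K φ ψ) (s.disjSum t)
    have hw : weight (sumEigenbasis K φ ψ).val (s.disjSum t) = weight φ.val s * weight ψ.val t :=
      weight_disjSum (φ.val_nonneg h₁.pos) (h₁.val_le_one φ) (ψ.val_nonneg h₂.pos)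
        (h₂.val_le_one ψ) s t
    rw [hw] at h
    have h' : freeState (directSum K γ₁ γ₂)
        (fockMul K (slater φ.basis s) (slater ψ.basis t)) =
        ((weight φ.val s * weight ψ.val t : ℝ) : ℂ) •
          fockMul K (slater φ.basis s) (slater ψ.basis t) := by
      rcases slater_disjSum K φ.basis ψ.basis s t with e | e
      · rw [← e]
        exact h
      · rw [← neg_eq_iff_eq_neg] at e
        rw [← e, map_neg, smul_neg]
        exact congrArg Neg.neg h
    rw [h', freeState_slater h₁, freeState_slater h₂, map_smul, map_smul, smul_apply, smul_smul]
    push_cast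
    rw [mul_comm]
  have k1 : ∀ s, freeState (directSum K γ₁ γ₂) ∘L fockMul K (slater φ.basis s) =
      fockMul K (freeState γ₁ (slater φ.basis s)) ∘L freeState γ₂ := fun s =>
    eq_of_forall_basis (slaterBasis ψ.basis) fun t => by
      rw [slaterBasis_apply]
      exact key s t
  have k2 : freeState (directSum K γ₁ γ₂) ∘L (fockMul K).flip y =
      (fockMul K).flip (freeState γ₂ y) ∘L freeState γ₁ :=
    eq_of_forall_basis (slaterBasis φ.basis) fun s => by
      rw [slaterBasis_apply]
      exact DFunLike.congr_fun (k1 s) y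
  exact DFunLike.congr_fun k2 x

end FreeState

/-! ### The one-particle statistical operator -/

section OneParticle

/-- The product of two coefficients is bounded by the sum of their squares, which Parseval sums to
at most `2 C` for each `j`. This justifies the interchange of sums in `trace_comp`. -/
theorem summable_trace_aux {E : Type u} [NormedAddCommGroup E] [InnerProductSpace ℂ E]
    {ι κ : Type*} (b : HilbertBasis ι ℂ E) {d : κ → ℝ} (hd0 : ∀ j, 0 ≤ d j) (hd : Summable d)
    (u v : κ → E) {C : ℝ} (hu : ∀ j, ‖u j‖ ^ 2 ≤ C) (hv : ∀ j, ‖v j‖ ^ 2 ≤ C) :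
    Summable fun p : κ × ι => (d p.1 : ℂ) * (⟪u p.1, b p.2⟫_ℂ * ⟪b p.2, v p.1⟫_ℂ) := by
  have hs : ∀ j, HasSum (fun i => d j * (‖⟪u j, b i⟫_ℂ‖ ^ 2 + ‖⟪v j, b i⟫_ℂ‖ ^ 2))
      (d j * (‖u j‖ ^ 2 + ‖v j‖ ^ 2)) := fun j => by
    have h := ((hasSum_norm_inner_sq b (u j)).add (hasSum_norm_inner_sq b (v j))).mul_left (d j)
    simpa only [norm_inner_symm (b _)] using h
  have hsum : Summable fun p : κ × ι =>
      d p.1 * (‖⟪u p.1, b p.2⟫_ℂ‖ ^ 2 + ‖⟪v p.1, b p.2⟫_ℂ‖ ^ 2) := by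
    rw [summable_prod_of_nonneg fun p => mul_nonneg (hd0 _) (by positivity)]
    refine ⟨fun j => (hs j).summable, ?_⟩
    simp_rw [fun j => (hs j).tsum_eq]
    refine Summable.of_nonneg_of_le (fun j => mul_nonneg (hd0 j) (by positivity))
      (fun j => mul_le_mul_of_nonneg_left (add_le_add (hu j) (hv j)) (hd0 j)) (hd.mul_right _)
  refine hsum.of_norm_bounded fun p => ?_
  rw [norm_mul, norm_mul, Complex.norm_real, Real.norm_of_nonneg (hd0 _), norm_inner_symm (b p.2)]
  refine mul_le_mul_of_nonneg_left ?_ (hd0 _)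
  nlinarith [sq_nonneg (‖⟪u p.1, b p.2⟫_ℂ‖ - ‖⟪v p.1, b p.2⟫_ℂ‖),
    sq_nonneg ‖⟪u p.1, b p.2⟫_ℂ‖, sq_nonneg ‖⟪v p.1, b p.2⟫_ℂ‖]

theorem trace_comp {E : Type u} [NormedAddCommGroup E] [InnerProductSpace ℂ E] [CompleteSpace E]
    {D : E →L[ℂ] E} (hD : D.IsPositive) (ht : posTrace D ≠ ∞) (φ : Eigenbasis D) (T : E →L[ℂ] E) :
    trace (D ∘L T) = ∑' j, (φ.val j : ℂ) * ⟪φ.basis j, T (φ.basis j)⟫_ℂ := by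
  have hd : Summable φ.val := by
    rw [← φ.tsum_val hD] at ht
    exact (ENNReal.summable_toReal ht).congr fun i => ENNReal.toReal_ofReal (φ.val_nonneg hD i)
  have hn : ∀ j, ‖φ.basis j‖ = 1 := φ.basis.orthonormal.1
  have hs := summable_trace_aux (stdBasis E) (φ.val_nonneg hD) hd
    (fun j => T.adjoint (φ.basis j)) (fun j => φ.basis j) (C := ‖T.adjoint‖ ^ 2 + 1)
    (fun j => by
      have := T.adjoint.le_opNorm (φ.basis j)
      rw [hn, mul_one] at this
      nlinarith [norm_nonneg (T.adjoint (φ.basis j))])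
    (fun j => by
      rw [hn]
      nlinarith [sq_nonneg ‖T.adjoint‖])
  calc trace (D ∘L T)
      = ∑' i, ∑' j, (φ.val j : ℂ) * (⟪T.adjoint (φ.basis j), stdBasis E i⟫_ℂ *
          ⟪stdBasis E i, φ.basis j⟫_ℂ) := by
        refine tsum_congr fun i => ?_
        have h := φ.basis.hasSum_inner_mul_inner (stdBasis E i) (D (T (stdBasis E i)))
        rw [ContinuousLinearMap.comp_apply, ← h.tsum_eq]
        refine tsum_congr fun j => ?_
        rw [φ.inner_apply hD, ContinuousLinearMap.adjoint_inner_left]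
        ring
    _ = ∑' j, ∑' i, (φ.val j : ℂ) * (⟪T.adjoint (φ.basis j), stdBasis E i⟫_ℂ *
          ⟪stdBasis E i, φ.basis j⟫_ℂ) := Summable.tsum_comm hs
    _ = _ := by
        refine tsum_congr fun j => ?_
        rw [tsum_mul_left, ((stdBasis E).hasSum_inner_mul_inner _ _).tsum_eq,
          ContinuousLinearMap.adjoint_inner_left]

variable {H : Type u} [NormedAddCommGroup H] [InnerProductSpace ℂ H]

theorem norm_creator_le (h : H) : ‖creator h‖ ≤ ‖h‖ := by
  refine ContinuousLinearMap.opNorm_le_bound _ (norm_nonneg _) fun ψ => ?_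
  induction ψ using UniformSpace.Completion.induction_on with
  | hp => exact isClosed_le (by fun_prop) (by fun_prop)
  | ih f =>
    rw [creator_coe, UniformSpace.Completion.norm_coe, UniformSpace.Completion.norm_coe]
    exact norm_prependPre_le h f

theorem enorm_annihilator_le (h : H) (ψ : Fock H) : ‖annihilator h ψ‖ₑ ≤ ‖h‖ₑ * ‖ψ‖ₑ := by
  have h1 : ‖annihilator h ψ‖ ≤ ‖h‖ * ‖ψ‖ := by
    refine ((annihilator h).le_opNorm ψ).trans (mul_le_mul_of_nonneg_right ?_ (norm_nonneg _))
    rw [annihilator, ContinuousLinearMap.adjoint.norm_map]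
    exact norm_creator_le h
  simp only [← ofReal_norm]
  rw [← ENNReal.ofReal_mul (norm_nonneg _)]
  exact ENNReal.ofReal_le_ofReal h1

variable [CompleteSpace H]

open scoped ComplexOrder in
-- `⟪h, γ h⟫ = ∑ dⱼ ‖a_h φⱼ‖²` over an eigenbasis of `Δ`. This is nonnegative, and at most `‖h‖²` by
-- the Pauli bound `‖a_h‖ ≤ ‖h‖`; the trace of `γ` is the expected particle number.
theorem isOccupation_of_isOneParticle {Δ : Fock H →L[ℂ] Fock H} (hΔ : IsClassD Δ)
    {γ : H →L[ℂ] H} (hγ : IsOneParticle Δ γ) : IsOccupation γ := by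
  have hD := hΔ.density.pos
  have ht : posTrace Δ ≠ ∞ := by
    rw [hΔ.density.posTrace_eq]
    exact ENNReal.one_ne_top
  obtain ⟨φ⟩ := nonempty_eigenbasis hD ht
  have hd : Summable φ.val := by
    rw [← φ.tsum_val hD] at ht
    exact (ENNReal.summable_toReal ht).congr fun i => ENNReal.toReal_ofReal (φ.val_nonneg hD i)
  have h1 : ∀ h : H, ⟪h, γ h⟫_ℂ =
      ((∑' j, φ.val j * ‖annihilator h (φ.basis j)‖ ^ 2 : ℝ) : ℂ) := fun h => by
    rw [hγ, trace_comp hD ht φ, Complex.ofReal_tsum]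
    refine tsum_congr fun j => ?_
    rw [ContinuousLinearMap.comp_apply, ← inner_conj_symm, inner_creator,
      inner_self_eq_norm_sq_to_K]
    simp
  have hpos : γ.IsPositive := isPositive_of_inner fun h => by
    rw [h1]
    exact_mod_cast tsum_nonneg fun j => mul_nonneg (φ.val_nonneg hD j) (sq_nonneg _)
  have hle : ∀ (h : H) (j : φ.index), ENNReal.ofReal
      (φ.val j * ‖annihilator h (φ.basis j)‖ ^ 2) ≤ ENNReal.ofReal (φ.val j) * ‖h‖ₑ ^ 2 := by
    intro h j
    rw [ENNReal.ofReal_mul (φ.val_nonneg hD j), ← enorm_sq_eq_ofReal]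
    refine mul_le_mul' le_rfl (pow_le_pow_left' ?_ 2)
    simpa [enorm_basis] using enorm_annihilator_le h (φ.basis j)
  refine ⟨hpos, fun h => ?_, ?_⟩
  · rw [qf, h1, Complex.ofReal_re]
    by_cases hsum : Summable fun j => φ.val j * ‖annihilator h (φ.basis j)‖ ^ 2
    · rw [ENNReal.ofReal_tsum_of_nonneg
        (fun j => mul_nonneg (φ.val_nonneg hD j) (sq_nonneg _)) hsum]
      refine (ENNReal.tsum_le_tsum (hle h)).trans_eq ?_
      rw [ENNReal.tsum_mul_right, φ.tsum_val hD, hΔ.density.posTrace_eq, one_mul]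
    · simp [tsum_eq_zero_of_not_summable hsum]
  · have := (hΔ.finite_number _ (stdBasis H)).tsum_ofReal_ne_top
    have e : ∀ i, qf γ (stdBasis H i) = ENNReal.ofReal
        (trace (Δ ∘L creator (stdBasis H i) ∘L annihilator (stdBasis H i))).re := fun i => by
      rw [qf, hγ]
    simp_rw [posTrace, e]
    exact this

/-- Covers the default value of `oneParticle`. -/
theorem isOccupation_zero : IsOccupation (0 : H →L[ℂ] H) :=
  ⟨ContinuousLinearMap.isPositive_zero, fun x => by simp [qf], by simp [posTrace, qf]⟩

theorem isOccupation_oneParticle {Δ : Fock H →L[ℂ] Fock H} (hΔ : IsClassD Δ) :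
    IsOccupation (oneParticle Δ) := by
  unfold oneParticle
  split_ifs with h
  · exact isOccupation_of_isOneParticle hΔ h.choose_spec
  · exact isOccupation_zero

open scoped ComplexOrder in
/-- A compression of `γ` inherits its properties. -/
theorem IsOccupation.of_isometry {E : Type u} [NormedAddCommGroup E] [InnerProductSpace ℂ E]
    [CompleteSpace E] {γ : H →L[ℂ] H} (hγ : IsOccupation γ) {ι κ : Type*}
    (b : HilbertBasis ι ℂ H) (c : HilbertBasis κ ℂ E) (V : E →ₗᵢ[ℂ] H) {e : κ → ι}
    (he : Function.Injective e) (hb : ∀ k, V (c k) = b (e k)) {A : E →L[ℂ] E}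
    (hA : ∀ x, ⟪x, A x⟫_ℂ = ⟪V x, γ (V x)⟫_ℂ) : IsOccupation A := by
  have hq : ∀ x, qf A x = qf γ (V x) := fun x => by rw [qf, hA, qf]
  have hp : A.IsPositive := isPositive_of_inner fun x => by
    rw [hA]
    exact hγ.pos.inner_nonneg_right _
  refine ⟨hp, fun x => ?_, ?_⟩
  · rw [hq]
    refine (hγ.qf_le _).trans_eq ?_
    rw [← ofReal_norm, V.norm_map, ofReal_norm]
  · rw [← tsum_qf hp c]
    simp_rw [hq, hb]
    refine ne_top_of_le_ne_top hγ.posTrace_ne_top ?_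
    rw [← tsum_qf hγ.pos b]
    exact ENNReal.tsum_comp_le_tsum_of_injective he _

/-- Both summands are compressions of the sum. For the restrictions of `Δ`, the required properties
are thus read off from `γ_Δ` alone. -/
theorem IsOccupation.of_directSum (K : Submodule ℂ H) [CompleteSpace K] {γ₁ : K →L[ℂ] K}
    {γ₂ : Kᗮ →L[ℂ] Kᗮ} (h : IsOccupation (directSum K γ₁ γ₂)) :
    IsOccupation γ₁ ∧ IsOccupation γ₂ := by
  constructor
  · refine h.of_isometry (sumBasis K (stdBasis K) (stdBasis Kᗮ)) (stdBasis K) K.subtypeₗᵢ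
      Sum.inl_injective (fun k => (sumBasis_apply K _ _ (Sum.inl k)).symm) fun x => ?_
    simp [directSum_apply_fst]
  · refine h.of_isometry (sumBasis K (stdBasis K) (stdBasis Kᗮ)) (stdBasis Kᗮ) Kᗮ.subtypeₗᵢ
      Sum.inr_injective (fun k => (sumBasis_apply K _ _ (Sum.inr k)).symm) fun x => ?_
    simp [directSum_apply_snd]

end OneParticle

end Fermion

end

theorem proposition3 {H : Type*} [NormedAddCommGroup H] [InnerProductSpace ℂ H] [CompleteSpace H]
    (K : Submodule ℂ H) [CompleteSpace K]
    (Δ : Fermion.Fock H →L[ℂ] Fermion.Fock H) (hΔ : Fermion.IsClassD Δ)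
    (hγ : Fermion.oneParticle Δ =
      Fermion.directSum K (Fermion.oneParticle (Fermion.restrictFst K Δ))
        (Fermion.oneParticle (Fermion.restrictSnd K Δ))) :
    Fermion.nonfreeness (Fermion.restrictFst K Δ) + Fermion.nonfreeness (Fermion.restrictSnd K Δ) ≤
        Fermion.nonfreeness Δ ∧
      (Fermion.nonfreeness Δ < ⊤ →
        (Fermion.nonfreeness Δ =
            Fermion.nonfreeness (Fermion.restrictFst K Δ) +
              Fermion.nonfreeness (Fermion.restrictSnd K Δ) ↔
          Fermion.IsTensor K Δ (Fermion.restrictFst K Δ) (Fermion.restrictSnd K Δ))) := by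
  have h := Fermion.isOccupation_oneParticle hΔ
  rw [hγ] at h
  obtain ⟨h₁, h₂⟩ := Fermion.IsOccupation.of_directSum K h
  have key := Fermion.relEntropy_tensor (Fermion.isHilbertTensor_fockMul K) hΔ.density.pos
    hΔ.density.posTrace_eq (Fermion.freeState_isPositive h₁) (Fermion.freeState_isPositive h₂)
    (Fermion.posTrace_freeState h₁) (Fermion.posTrace_freeState h₂)
    (Fermion.freeState_directSum K h h₁ h₂)
  rw [← hγ] at key
  -- `restrictFst` and `restrictSnd` unfold to the partial traces for `fockMul K` and its flip.
  exact key
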